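/- Let $\mathcal H$ be a complex separable Hilbert space, $H_0$ a self-adjoint operator on $\mathcal H$ bounded from below, $V$ a bounded operator on $\mathcal H$ and $H:=H_0+V$ with domain $\mathcal D(H_0)$. Write $R_H(z)=(H-z)^{-1}$, $R_0(z)=(H_0-z)^{-1}$, let $\mathcal L_1(\mathcal H)$ be the trace class, and let $\langle x\rangle=(1+x^2)^{1/2}$. Let $c\in\mathbb R$ and $m\ge 1$ be an integer such that $\sigma(H_0)\subset(-c,\infty)$ and $$\sigma(H+c)\subset\{\rho e^{i\theta}:\rho>0,\ |\theta|<\pi/(2m)\}$$ (so that $(H+c)^{-m}$ exists and its spectrum lies in $\{0\}\cup\{\operatorname{Re}z>0\}$). Let $I\subset(-c,\infty)$ be an open interval such that 1. $H$ has only finitely many non-real eigenvalues with real part in $I$; 2. there are $a,n,C>0$ such that every $z$ with $\operatorname{Re}z\in I$, $0<|\operatorname{Im}z|<a$ lies in $\rho(H)$ and satisfies $\|R_H(z)\|\le C|\operatorname{Im}z|^{-1}\big(\langle\operatorname{Re}z\rangle/|\operatorname{Im}z|\big)^{n}$; 3. $(H+c)^{-m}-(H_0+c)^{-m}\in\mathcal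 L_1(\mathcal H)$; 4. $(H_0+c)^{-m}\big((H+c)^{-1}-(H_0+c)^{-1}\big)\in\mathcal L_1(\mathcal H)$. *Spectral shift function.* For a bounded operator $X$ and a test function $g$, let $g(X)=\pi^{-1}\int_{\mathbb C}\partial_{\bar z}\tilde g(z)\,(X-z)^{-1}\,dx\,dy$ (Helffer–Sjöstrand formula), where $\tilde g(x+iy)=\sum_{k\le N}\frac{g^{(k)}(x)}{k!}(iy)^k\,\tau(y/\langle x\rangle)$, $N$ is large enough, and $\tau\in C_c^\infty(\mathbb R)$ equals $1$ near $0$ and is such that no non-real point of $\sigma(X)$ with real part in $\operatorname{supp}g$ lies in the support of $(x,y)\mapsto\tau(y/\langle x\rangle)$; the integral has to converge absolutely and not to depend on $N,\tau$. Let $X=(H+c)^{-m}$, $X_0=(H_0+c)^{-m}$ and $J=\{(\lambda+c)^{-m}:\lambda\in I\}$. A spectral shift function of $(X,X_0)$ on $J$ is a distribution $\xi_{c,m}\in D'(J)$ such that for all $g\in D(J)$ the operators $g(X)$, $g(X_0)$ are well defined, $g(X)-g(X_0)\in\mathcal L_1(\mathcal H)$ and $\langle\xi_{c,m},g'\rangle=\operatorname{Tr}\big(g(X)-g(X_0)\big)$.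 A spectral shift function of $(H,H_0)$ on $I$ is a distribution of the form $\xi(\lambda)=\xi_{c,m}\big((\lambda+c)^{-m}\big)\in D'(I)$ with such a $\xi_{c,m}$. **Claim.** A spectral shift function $\xi$ of $(H,H_0)$ on $I$ exists. For every $z\in\rho(H)\cap\rho(H_0)$ the operator $(H+c)^{-m+1}R_H(z)-(H_0+c)^{-m+1}R_0(z)$ is trace class; put $$\sigma_m(z)=(z+c)^{m-1}\operatorname{Tr}\big((H+c)^{-m+1}R_H(z)-(H_0+c)^{-m+1}R_0(z)\big).$$ For all small $\varepsilon>0$ the function $\lambda\mapsto\sigma_m(\lambda+i\varepsilon)-\sigma_m(\lambda-i\varepsilon)$ is locally integrable on $I$, and for every spectral shift function $\xi$ of $(H,H_0)$ on $I$, $$\xi'=\frac1{2\pi i}\lim_{\varepsilon\to0^+}\big(\sigma_m(\cdot+i\varepsilon)-\sigma_m(\cdot-i\varepsilon)\big)\quad\text{in }D'(I),$$ that is, tested against every function of $D(I)$. -/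

import Mathlib

open scoped Distributions LineDeriv InnerProductSpace Topology

noncomputable section

namespace SSF

variable {E : Type*} [NormedAddCommGroup E] [InnerProductSpace ℂ E]

/-! ### Unbounded operators: resolvent, spectrum, eigenvalues -/

/-- The bounded operator `R` is a two-sided inverse of `A - z : D(A) → E`. -/
def IsResolventAt (A : E →ₗ.[ℂ] E) (z : ℂ) (R : E →L[ℂ] E) : Prop :=
  (∀ u : E, ∃ h : R u ∈ A.domain, A ⟨R u, h⟩ - z • R u = u) ∧
    ∀ u : A.domain, R (A u - z • (u : E)) = u

theorem IsResolventAt.unique {A : E →ₗ.[ℂ] E} {z : ℂ} {R R' : E →L[ℂ] E}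
    (h : IsResolventAt A z R) (h' : IsResolventAt A z R') : R = R' := by
  ext u
  obtain ⟨hu, e⟩ := h'.1 u
  have := h.2 ⟨R' u, hu⟩
  simp only [e] at this
  exact this

/-- The resolvent set `ρ(A)`. -/
def rho (A : E →ₗ.[ℂ] E) : Set ℂ := {z | ∃ R : E →L[ℂ] E, IsResolventAt A z R}

/-- The spectrum `σ(A)`. -/
def spec (A : E →ₗ.[ℂ] E) : Set ℂ := (rho A)ᶜ

open Classical in
/-- The resolvent `R_A(z) = (A - z)⁻¹` for `z ∈ ρ(A)` (and `0` elsewhere). -/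
def res (A : E →ₗ.[ℂ] E) (z : ℂ) : E →L[ℂ] E :=
  if h : ∃ R : E →L[ℂ] E, IsResolventAt A z R then h.choose else 0

theorem res_spec {A : E →ₗ.[ℂ] E} {z : ℂ} (h : z ∈ rho A) : IsResolventAt A z (res A z) := by
  have h' : ∃ R : E →L[ℂ] E, IsResolventAt A z R := h
  rw [res, dif_pos h']
  exact h'.choose_spec

/-- The point spectrum: the set of eigenvalues of `A`. -/
def pointSpec (A : E →ₗ.[ℂ] E) : Set ℂ :=
  {z | ∃ u : A.domain, (u : E) ≠ 0 ∧ A u = z • (u : E)}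

/-- The operator `H₀ + V` with domain `D(H₀)`, for a bounded operator `V`. -/
def addBounded (H₀ : E →ₗ.[ℂ] E) (V : E →L[ℂ] E) : E →ₗ.[ℂ] E :=
  (V : E →ₗ[ℂ] E) +ᵥ H₀

/-- `A` is bounded from below: `⟪A u, u⟫ ≥ b ‖u‖²` on `D(A)` for some real `b`. -/
def IsBoundedBelow (A : E →ₗ.[ℂ] E) : Prop :=
  ∃ b : ℝ, ∀ u : A.domain, b * ‖(u : E)‖ ^ 2 ≤ (⟪A u, (u : E)⟫_ℂ).re

/-! ### The trace class -/

/-- Trace class (equivalently, on a Hilbert space, nuclear) operators: absolutely convergent sums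
`∑ n, ⟪a n, ·⟫ b n` of operators of rank at most one. -/
def IsTraceClass (T : E →L[ℂ] E) : Prop :=
  ∃ a b : ℕ → E, Summable (fun n => ‖a n‖ * ‖b n‖) ∧
    ∀ u : E, HasSum (fun n => ⟪a n, u⟫_ℂ • b n) (T u)

/-- The trace `∑ i, ⟪e i, T (e i)⟫` in a Hilbert basis `e`; for a trace class operator the sum
converges absolutely and does not depend on the basis. -/
def trace [CompleteSpace E] (T : E →L[ℂ] E) : ℂ :=
  ∑' i, ⟪(exists_hilbertBasis ℂ E).choose_spec.choose i,
    T ((exists_hilbertBasis ℂ E).choose_spec.choose i)⟫_ℂ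

/-! ### The hypotheses on the perturbed operator -/

/-- `A` has only finitely many non-real eigenvalues whose real part lies in `I`. -/
def FinitelyManyNonrealEigenvalues (A : E →ₗ.[ℂ] E) (I : Set ℝ) : Prop :=
  {z : ℂ | z ∈ pointSpec A ∧ z.im ≠ 0 ∧ z.re ∈ I}.Finite

/-- For some `a, n, C > 0`, the punctured strip `re z ∈ I`, `0 < |im z| < a` lies in `ρ(A)` and
`‖R_A(z)‖ ≤ C |im z|⁻¹ (⟨re z⟩ / |im z|) ^ n` on it, where `⟨x⟩ = √(1 + x²)`. -/
def PolynomialResolventBound (A : E →ₗ.[ℂ] E) (I : Set ℝ) : Prop :=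
  ∃ a > (0 : ℝ), ∃ n > (0 : ℝ), ∃ C > (0 : ℝ), ∀ z : ℂ, z.re ∈ I → 0 < |z.im| → |z.im| < a →
    z ∈ rho A ∧ ‖res A z‖ ≤ C * |z.im|⁻¹ * (√(1 + z.re ^ 2) / |z.im|) ^ n

/-! ### The Helffer–Sjöstrand functional calculus -/

/-- `∂F/∂z̄ = (∂F/∂x + i ∂F/∂y) / 2`. -/
def dbar (F : ℂ → ℂ) (z : ℂ) : ℂ :=
  (1 / 2) * (fderiv ℝ F z 1 + Complex.I * fderiv ℝ F z Complex.I)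

/-- The almost analytic extension
`f̃(x + iy) = (∑ k ≤ N, f⁽ᵏ⁾(x) (iy)ᵏ / k!) τ(y / ⟨x⟩)` of order `N` with cut-off `τ`. -/
def almostAnalytic (f : ℝ → ℂ) (N : ℕ) (τ : ℝ → ℝ) (z : ℂ) : ℂ :=
  (∑ k ∈ Finset.range (N + 1),
      iteratedDeriv k f z.re / (k.factorial : ℂ) * (Complex.I * (z.im : ℂ)) ^ k) *
    (τ (z.im / √(1 + z.re ^ 2)) : ℂ)

/-- `τ` is a smooth compactly supported cut-off function, equal to `1` near `0`, for which no
non-real spectral point of `X` above the support of `f` lies in the support of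
`(x, y) ↦ τ(y / ⟨x⟩)`. -/
def IsAdmissibleCutoff (X : E →L[ℂ] E) (f : ℝ → ℂ) (τ : ℝ → ℝ) : Prop :=
  ContDiff ℝ (⊤ : ℕ∞) τ ∧ HasCompactSupport τ ∧ (∀ᶠ s in 𝓝 (0 : ℝ), τ s = 1) ∧
    ∀ z ∈ spectrum ℂ X, z.im ≠ 0 → z.re ∈ tsupport f → z.im / √(1 + z.re ^ 2) ∉ tsupport τ

/-- `B = f(X)` for the bounded operator `X`: there are admissible cut-offs and, for every one of
them and every large enough order of the almost analytic extension,
`B = π⁻¹ ∫ ∂f̃/∂z̄ (X - z)⁻¹ dx dy`, the integral being absolutely convergent. -/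
def IsFunctionOf (X : E →L[ℂ] E) (f : ℝ → ℂ) (B : E →L[ℂ] E) : Prop :=
  (∃ τ, IsAdmissibleCutoff X f τ) ∧
    ∃ N₀ : ℕ, ∀ N ≥ N₀, ∀ τ, IsAdmissibleCutoff X f τ →
      MeasureTheory.Integrable
        (fun z : ℂ => dbar (almostAnalytic f N τ) z • Ring.inverse (X - algebraMap ℂ _ z)) ∧
      B = (Real.pi : ℂ)⁻¹ •
        ∫ z : ℂ, dbar (almostAnalytic f N τ) z • Ring.inverse (X - algebraMap ℂ _ z)

/-! ### The spectral shift function -/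

/-- `η` is a spectral shift function on `J` of the pair `(X, X₀)` of bounded operators:
`g(X) - g(X₀)` is trace class and `⟨η, g'⟩ = Tr (g(X) - g(X₀))` for all test functions `g`. -/
def IsSSF [CompleteSpace E] (J : TopologicalSpace.Opens ℝ) (X X₀ : E →L[ℂ] E)
    (η : 𝓓'(J, ℂ)) : Prop :=
  ∀ g : 𝓓(J, ℝ), ∃ B B₀ : E →L[ℂ] E,
    IsFunctionOf X (fun x => (g x : ℂ)) B ∧ IsFunctionOf X₀ (fun x => (g x : ℂ)) B₀ ∧
    IsTraceClass (B - B₀) ∧ η (∂_{(1 : ℝ)} g) = trace (B - B₀)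

/-- `ξ` is a spectral shift function on `I ⊆ (-c, ∞)` of the pair `(H, H₀)`:
`ξ(t) = η((t + c)⁻ᵐ)` for a spectral shift function `η` of the pair `((H + c)⁻ᵐ, (H₀ + c)⁻ᵐ)` on
the image `J` of `I` under `t ↦ (t + c)⁻ᵐ`. The composition of distributions is the change of
variables formula `⟨ξ, f⟩ = ⟨η, g⟩` for `f(t) = g((t + c)⁻ᵐ) · m (t + c)⁻ᵐ⁻¹`. -/
def IsRelSSF [CompleteSpace E] (I : TopologicalSpace.Opens ℝ) (H H₀ : E →ₗ.[ℂ] E) (c : ℝ) (m : ℕ)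
    (ξ : 𝓓'(I, ℂ)) : Prop :=
  ∃ J : TopologicalSpace.Opens ℝ, (J : Set ℝ) = (fun t : ℝ => ((t + c) ^ m)⁻¹) '' (I : Set ℝ) ∧
    ∃ η : 𝓓'(J, ℂ), IsSSF J (res H (-c) ^ m) (res H₀ (-c) ^ m) η ∧
      ∀ (f : 𝓓(I, ℝ)) (g : 𝓓(J, ℝ)),
        (∀ t ∈ I, f t = g (((t + c) ^ m)⁻¹) * (m * ((t + c) ^ (m + 1))⁻¹)) → ξ f = η g

/-- `(H + c)^{-m+1} R_H(z) - (H₀ + c)^{-m+1} R_{H₀}(z)`. -/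
def sigmaOp (H H₀ : E →ₗ.[ℂ] E) (c : ℝ) (m : ℕ) (z : ℂ) : E →L[ℂ] E :=
  res H (-c) ^ (m - 1) * res H z - res H₀ (-c) ^ (m - 1) * res H₀ z

/-- `σ_m(z) = (z + c)^{m-1} Tr ((H + c)^{-m+1} R_H(z) - (H₀ + c)^{-m+1} R_{H₀}(z))`. -/
def sigma [CompleteSpace E] (H H₀ : E →ₗ.[ℂ] E) (c : ℝ) (m : ℕ) (z : ℂ) : ℂ :=
  (z + c) ^ (m - 1) * trace (sigmaOp H H₀ c m z)

end SSF

end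

noncomputable section

namespace SSF

/-! ### The Banach space of trace class operators -/

section Nuclear

variable {E : Type*} [NormedAddCommGroup E] [InnerProductSpace ℂ E]

/-! Write `R = (H + c)⁻¹`, `R₀ = (H₀ + c)⁻¹`, `X = Rᵐ`, `X₀ = R₀ᵐ`, `ν = z + c` and `w = ν⁻ᵐ`. The
function `k(w) = Tr ((X - w)⁻¹ - (X₀ - w)⁻¹)` is holomorphic off the real axis near `J` and grows
there at most like a power of `|im w|⁻¹`. The Helffer–Sjöstrand formula makes `Tr (g(X) - g(X₀))` an
area integral of `∂g̃/∂z̄` against `k`, and Green's formula turns it into a boundary value: `2πi Tr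
(g(X) - g(X₀))` is the limit of the jump of `k` across the real axis tested against `g`
(`tendsto_jump`, `tendsto_jump_almostAnalytic`). That limit sees only `g`, so the calculus does not
depend on `N` and `τ` (`exists_isFunctionOf`). It is bounded by finitely many derivatives of `g`, so
the trace is a distribution in `g`; a primitive of it, up to sign, on the interval `J` is a spectral
shift function (`exists_isSSF`).

The formula for `ξ'` rests on an algebraic identity. With `Y = ν R` and `Q(x) = ∑ j < m, xʲ`, one
has `Rᵐ - w = -w (1 - Y) Q(Y)`, and partial fractions give `m / (1 - xᵐ) = 1 / (1 - x) + P(x) /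
Q(x)` with `P` the polynomial `geomDefect`. Hence `w'(z) ((X - w)⁻¹ - (X₀ - w)⁻¹)` equals the
operator whose trace is `σ_m(z)` plus a defect (`smul_resDiff_eq`). The zeros of `Q` are the `m`-th
roots of unity other than `1`, so the sector condition on the spectra makes `Q(ν R)` and `Q(ν R₀)`
invertible near the positive axis (`isUnit_geomSum`). The defect is therefore continuous across the
axis in trace norm and has no jump.

It remains to pass from `w` to `z`. The map `z ↦ (z + c)⁻ᵐ` is conformal and injective on the
shifted sector. Composing an almost analytic extension with it preserves the order of vanishing of
`∂/∂z̄` on the real axis, and the Jacobian `|w'|²` is one factor `conj w'` from the chain rule times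
one factor `w'` attached to `k` (`exists_comp_conformal`, `tendsto_jump_resDiffComp`). All integrals
of operators are taken in the Banach space `Nuc E` with its trace norm, where the trace is a
continuous functional and commutes with them. -/

/-- `T = ∑ n, ⟪a n, ·⟫ b n` with `∑ n, ‖a n‖ ‖b n‖ ≤ s`. -/
def HasNuclearRep (T : E →L[ℂ] E) (s : ℝ) : Prop :=
  ∃ a b : ℕ → E, Summable (fun n => ‖a n‖ * ‖b n‖) ∧ ∑' n, ‖a n‖ * ‖b n‖ ≤ s ∧
    ∀ u : E, HasSum (fun n => ⟪a n, u⟫_ℂ • b n) (T u)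

theorem HasNuclearRep.isTraceClass {T : E →L[ℂ] E} {s : ℝ} (h : HasNuclearRep T s) :
    IsTraceClass T := by
  obtain ⟨a, b, h1, -, h2⟩ := h
  exact ⟨a, b, h1, h2⟩

theorem IsTraceClass.exists_rep {T : E →L[ℂ] E} (h : IsTraceClass T) :
    ∃ s, HasNuclearRep T s := by
  obtain ⟨a, b, h1, h2⟩ := h
  exact ⟨_, a, b, h1, le_rfl, h2⟩

theorem HasNuclearRep.nonneg {T : E →L[ℂ] E} {s : ℝ} (h : HasNuclearRep T s) : 0 ≤ s := by
  obtain ⟨a, b, -, h1, -⟩ := h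
  exact (tsum_nonneg fun n => by positivity).trans h1

theorem HasNuclearRep.mono {T : E →L[ℂ] E} {s t : ℝ} (h : HasNuclearRep T s) (hst : s ≤ t) :
    HasNuclearRep T t := by
  obtain ⟨a, b, h0, h1, h2⟩ := h
  exact ⟨a, b, h0, h1.trans hst, h2⟩

theorem HasNuclearRep.zero : HasNuclearRep (0 : E →L[ℂ] E) 0 :=
  ⟨0, 0, by simp, by simp, fun u => by simp⟩

theorem HasNuclearRep.smul {T : E →L[ℂ] E} {s : ℝ} (h : HasNuclearRep T s) (c : ℂ) :
    HasNuclearRep (c • T) (‖c‖ * s) := by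
  obtain ⟨a, b, h0, h1, h2⟩ := h
  have e : (fun n => ‖a n‖ * ‖c • b n‖) = fun n => ‖c‖ * (‖a n‖ * ‖b n‖) := by
    ext n; rw [norm_smul]; ring
  refine ⟨a, fun n => c • b n, ?_, ?_, fun u => ?_⟩
  · rw [e]; exact h0.mul_left _
  · rw [e, tsum_mul_left]; gcongr
  · simp only [smul_apply, smul_comm _ c]
    exact (h2 u).const_smul c

theorem HasNuclearRep.norm_le {T : E →L[ℂ] E} {s : ℝ} (h : HasNuclearRep T s) : ‖T‖ ≤ s := by
  refine T.opNorm_le_bound h.nonneg fun u => ?_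
  obtain ⟨a, b, h0, h1, h2⟩ := h
  have hle : ∀ n, ‖⟪a n, u⟫_ℂ • b n‖ ≤ ‖a n‖ * ‖b n‖ * ‖u‖ := fun n => by
    rw [norm_smul]
    calc _ ≤ ‖a n‖ * ‖u‖ * ‖b n‖ := by gcongr; exact norm_inner_le_norm _ _
      _ = _ := by ring
  rw [← (h2 u).tsum_eq]
  calc _ ≤ ∑' n, ‖a n‖ * ‖b n‖ * ‖u‖ := tsum_of_norm_bounded (h0.mul_right _).hasSum hle
    _ = (∑' n, ‖a n‖ * ‖b n‖) * ‖u‖ := tsum_mul_right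
    _ ≤ s * ‖u‖ := by gcongr

/-- Cauchy–Schwarz in `i`, then Bessel for `a n` and for `b n`, bounds the contribution of each rank
one piece by `‖a n‖ ‖b n‖`. This yields both the absolute convergence of the trace and its bound by
the trace norm. -/
theorem HasNuclearRep.sum_inner_le {T : E →L[ℂ] E} {s : ℝ} (h : HasNuclearRep T s) {ι : Type*} {e : ι → E}
    (he : Orthonormal ℂ e) (F : Finset ι) : ∑ i ∈ F, ‖⟪e i, T (e i)⟫_ℂ‖ ≤ s := by
  obtain ⟨a, b, h0, h1, h2⟩ := h
  have hab : ∀ n, ∑ i ∈ F, ‖⟪a n, e i⟫_ℂ‖ * ‖⟪e i, b n⟫_ℂ‖ ≤ ‖a n‖ * ‖b n‖ := fun n => by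
    refine (Real.sum_mul_le_sqrt_mul_sqrt F _ _).trans ?_
    gcongr
    · refine Real.sqrt_le_iff.2 ⟨norm_nonneg _, ?_⟩
      simpa only [norm_inner_symm (a n)] using he.sum_inner_products_le (a n)
    · exact Real.sqrt_le_iff.2 ⟨norm_nonneg _, he.sum_inner_products_le (b n)⟩
  have hsum : ∀ i, Summable fun n => ‖⟪a n, e i⟫_ℂ‖ * ‖⟪e i, b n⟫_ℂ‖ := fun i => by
    refine h0.of_nonneg_of_le (fun n => by positivity) fun n => ?_
    gcongr
    · simpa [he.1 i] using norm_inner_le_norm (𝕜 := ℂ) (a n) (e i)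
    · simpa [he.1 i] using norm_inner_le_norm (𝕜 := ℂ) (e i) (b n)
  calc ∑ i ∈ F, ‖⟪e i, T (e i)⟫_ℂ‖
      ≤ ∑ i ∈ F, ∑' n, ‖⟪a n, e i⟫_ℂ‖ * ‖⟪e i, b n⟫_ℂ‖ := by
        refine Finset.sum_le_sum fun i _ => ?_
        have h3 := (h2 (e i)).mapL (innerSL ℂ (e i))
        rw [innerSL_apply_apply] at h3
        rw [← h3.tsum_eq]
        refine tsum_of_norm_bounded (hsum i).hasSum fun n => ?_
        rw [innerSL_apply_apply, inner_smul_right, norm_mul]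
    _ = ∑' n, ∑ i ∈ F, ‖⟪a n, e i⟫_ℂ‖ * ‖⟪e i, b n⟫_ℂ‖ :=
        (Summable.tsum_finsetSum fun i _ => hsum i).symm
    _ ≤ ∑' n, ‖a n‖ * ‖b n‖ :=
        Summable.tsum_le_tsum hab (summable_sum fun i _ => hsum i) h0
    _ ≤ s := h1

variable [CompleteSpace E]

/-- Trace class operators are stable under absolutely convergent sums. -/
theorem HasNuclearRep.hasSum {T : ℕ → E →L[ℂ] E} {S : E →L[ℂ] E} {s : ℕ → ℝ}
    (h : ∀ j, HasNuclearRep (T j) (s j)) (hs : Summable s) (hS : HasSum T S) :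
    HasNuclearRep S (∑' j, s j) := by
  choose a b h0 h1 h2 using h
  -- Absolute summability of the double family allows all rank one pieces to be listed in a single
  -- sequence.
  have key : Summable fun p : ℕ × ℕ => ‖a p.1 p.2‖ * ‖b p.1 p.2‖ := by
    refine (summable_prod_of_nonneg fun p => by positivity).2 ⟨h0, ?_⟩
    exact hs.of_nonneg_of_le (fun j => tsum_nonneg fun n => by positivity) h1
  obtain ⟨e⟩ : Nonempty (ℕ ≃ ℕ × ℕ) := ⟨(Denumerable.eqv (ℕ × ℕ)).symm⟩
  refine ⟨fun n => a (e n).1 (e n).2, fun n => b (e n).1 (e n).2, ?_, ?_, fun u => ?_⟩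
  · exact e.summable_iff.2 key
  · rw [e.tsum_eq (fun p : ℕ × ℕ => ‖a p.1 p.2‖ * ‖b p.1 p.2‖), key.tsum_prod' h0]
    exact Summable.tsum_le_tsum h1
      (hs.of_nonneg_of_le (fun j => tsum_nonneg fun n => by positivity) h1) hs
  · have hsum : Summable fun p : ℕ × ℕ => ⟪a p.1 p.2, u⟫_ℂ • b p.1 p.2 := by
      refine Summable.of_norm_bounded (key.mul_right ‖u‖) fun p => ?_
      rw [norm_smul]
      calc _ ≤ ‖a p.1 p.2‖ * ‖u‖ * ‖b p.1 p.2‖ := by gcongr; exact norm_inner_le_norm _ _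
        _ = _ := by ring
    have h3 := hsum.hasSum.prod_fiberwise fun j => h2 j u
    have h4 : HasSum (fun j => T j u) (S u) := hS.mapL (ContinuousLinearMap.apply ℂ E u)
    rw [← h3.unique h4]
    exact (e.hasSum_iff (f := fun p : ℕ × ℕ => ⟪a p.1 p.2, u⟫_ℂ • b p.1 p.2)).2 hsum.hasSum

/-- Presents a sum of two terms as a series, so that stability under addition follows from stability
under series. -/
theorem hasSum_pair {M : Type*} [AddCommMonoid M] [TopologicalSpace M] (x y : M) :
    HasSum (fun j : ℕ => if j = 0 then x else if j = 1 then y else 0) (x + y) := by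
  have h := hasSum_sum_of_ne_finset_zero (L := .unconditional ℕ) (s := {0, 1})
    (f := fun j : ℕ => if j = 0 then x else if j = 1 then y else 0) fun j hj => by
      simp only [Finset.mem_insert, Finset.mem_singleton, not_or] at hj
      simp [hj]
  simpa using h

theorem HasNuclearRep.add {T S : E →L[ℂ] E} {s t : ℝ} (hT : HasNuclearRep T s)
    (hS : HasNuclearRep S t) : HasNuclearRep (T + S) (s + t) := by
  rw [← (hasSum_pair s t).tsum_eq]
  refine HasNuclearRep.hasSum (fun j => ?_) (hasSum_pair s t).summable (hasSum_pair T S)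
  split_ifs
  · exact hT
  · exact hS
  · exact HasNuclearRep.zero

/-- `A` acts on the vectors `b n`, and `B` passes to the `a n` as its adjoint. -/
theorem HasNuclearRep.mul_mul {T : E →L[ℂ] E} {s : ℝ} (h : HasNuclearRep T s) (A B : E →L[ℂ] E) :
    HasNuclearRep (A * T * B) (‖A‖ * s * ‖B‖) := by
  obtain ⟨a, b, h0, h1, h2⟩ := h
  have hle : ∀ n, ‖B.adjoint (a n)‖ * ‖A (b n)‖ ≤ ‖A‖ * (‖a n‖ * ‖b n‖) * ‖B‖ := fun n => by
    have h3 := B.adjoint.le_opNorm (a n)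
    rw [ContinuousLinearMap.adjoint.norm_map] at h3
    calc _ ≤ (‖B‖ * ‖a n‖) * (‖A‖ * ‖b n‖) := by gcongr; exact A.le_opNorm _
      _ = _ := by ring
  have hsum := (h0.mul_left ‖A‖).mul_right ‖B‖
  refine ⟨fun n => B.adjoint (a n), fun n => A (b n), ?_, ?_, fun u => ?_⟩
  · exact hsum.of_nonneg_of_le (fun n => by positivity) hle
  · refine (Summable.tsum_le_tsum hle (hsum.of_nonneg_of_le (fun n => by positivity) hle)
      hsum).trans ?_
    rw [tsum_mul_right, tsum_mul_left]
    gcongr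
  · have := (h2 (B u)).mapL A
    simpa [ContinuousLinearMap.adjoint_inner_left] using this

variable (E) in
/-- The trace class operators, as a subspace of the bounded operators. -/
def nuclearSubmodule : Submodule ℂ (E →L[ℂ] E) where
  carrier := {T | IsTraceClass T}
  add_mem' := fun h h' => by
    obtain ⟨s, hs⟩ := IsTraceClass.exists_rep h
    obtain ⟨t, ht⟩ := IsTraceClass.exists_rep h'
    exact (hs.add ht).isTraceClass
  zero_mem' := HasNuclearRep.zero.isTraceClass
  smul_mem' := fun c T h => by
    obtain ⟨s, hs⟩ := IsTraceClass.exists_rep h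
    exact (hs.smul c).isTraceClass

variable (E) in
/-- The trace class operators, to be equipped with the trace norm. -/
def Nuc : Type _ := nuclearSubmodule E

/-! ### The trace norm, its completeness, and the trace as a continuous functional. -/

namespace Nuc

instance : AddCommGroup (Nuc E) := inferInstanceAs (AddCommGroup (nuclearSubmodule E))

instance : Module ℂ (Nuc E) := inferInstanceAs (Module ℂ (nuclearSubmodule E))

/-- The underlying bounded operator, as a linear map. -/
def valₗ : Nuc E →ₗ[ℂ] (E →L[ℂ] E) := (nuclearSubmodule E).subtype

theorem valₗ_injective : Function.Injective (valₗ (E := E)) := Subtype.val_injective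

/-- A trace class operator as an element of `Nuc E`. -/
def mk (T : E →L[ℂ] E) (h : IsTraceClass T) : Nuc E := ⟨T, h⟩

@[simp] theorem valₗ_mk (T : E →L[ℂ] E) (h : IsTraceClass T) : valₗ (mk T h) = T := rfl

/-- The trace norm in its nuclear form, an infimum over representations; no singular values are
needed. -/
instance : Norm (Nuc E) := ⟨fun T => sInf {s | HasNuclearRep (valₗ T) s}⟩

theorem norm_le_of_rep {T : Nuc E} {s : ℝ} (h : HasNuclearRep (valₗ T) s) : ‖T‖ ≤ s :=
  csInf_le ⟨0, fun _ ht => ht.nonneg⟩ h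

theorem exists_rep_lt {T : Nuc E} {s : ℝ} (h : ‖T‖ < s) : HasNuclearRep (valₗ T) s := by
  obtain ⟨t, ht, hts⟩ := exists_lt_of_csInf_lt (IsTraceClass.exists_rep T.2) h
  exact HasNuclearRep.mono ht hts.le

theorem le_norm_of_rep {T : Nuc E} {r : ℝ} (h : ∀ s, HasNuclearRep (valₗ T) s → r ≤ s) :
    r ≤ ‖T‖ :=
  le_csInf (IsTraceClass.exists_rep T.2) h

theorem opNorm_le (T : Nuc E) : ‖valₗ T‖ ≤ ‖T‖ := le_norm_of_rep fun _ hs => hs.norm_le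

theorem norm_smul_le' (c : ℂ) (T : Nuc E) : ‖c • T‖ ≤ ‖c‖ * ‖T‖ := by
  refine le_of_forall_pos_le_add fun ε hε => ?_
  -- The `+ 1` covers `c = 0`.
  have h1 : ‖T‖ < ‖T‖ + ε / (‖c‖ + 1) := by
    have : 0 < ε / (‖c‖ + 1) := by positivity
    linarith
  have h2 := (exists_rep_lt h1).smul c
  rw [← map_smul] at h2
  refine (norm_le_of_rep h2).trans ?_
  rw [mul_add]
  gcongr
  rw [mul_div_assoc', div_le_iff₀ (by positivity)]
  nlinarith [norm_nonneg c]

instance : NormedAddCommGroup (Nuc E) :=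
  AddGroupNorm.toNormedAddCommGroup
    { toFun := fun T => ‖T‖
      map_zero' := by
        refine le_antisymm (norm_le_of_rep ?_) ((norm_nonneg _).trans (opNorm_le _))
        rw [map_zero]
        exact HasNuclearRep.zero
      add_le' := fun S T => by
        refine le_of_forall_pos_le_add fun ε hε => ?_
        have h1 := exists_rep_lt (T := S) (lt_add_of_pos_right _ (half_pos hε))
        have h2 := exists_rep_lt (T := T) (lt_add_of_pos_right _ (half_pos hε))
        have h3 := h1.add h2
        rw [← map_add] at h3
        refine (norm_le_of_rep h3).trans (le_of_eq (by ring))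
      neg' := fun T => by
        have h (S : Nuc E) : ‖-S‖ ≤ ‖S‖ := by
          simpa using norm_smul_le' (-1) S
        exact le_antisymm (h T) (by simpa using h (-T))
      eq_zero_of_map_eq_zero' := fun T h => by
        apply valₗ_injective
        rw [map_zero, ← norm_le_zero_iff]
        exact (opNorm_le T).trans h.le }

instance : NormedSpace ℂ (Nuc E) := ⟨norm_smul_le'⟩

variable (E) in
/-- The underlying bounded operator, as a continuous linear map. -/
def val : Nuc E →L[ℂ] (E →L[ℂ] E) :=
  valₗ.mkContinuous 1 fun T => by simpa using opNorm_le T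

theorem val_injective : Function.Injective (val E) := valₗ_injective

@[simp] theorem val_mk (T : E →L[ℂ] E) (h : IsTraceClass T) : val E (mk T h) = T := rfl

/-- An absolutely convergent series also converges in operator norm; representations of its terms
concatenate to one of the sum and of every tail, and the tails of `s` control the latter in trace
norm. -/
instance : CompleteSpace (Nuc E) := by
  refine NormedAddCommGroup.completeSpace_of_summable_imp_tendsto fun u hu => ?_
  -- The summable slack `(1 / 2) ^ n` is there because the infimum defining the norm need not be
  -- attained.
  let s : ℕ → ℝ := fun n => ‖u n‖ + (1 / 2) ^ n
  have hs : Summable s := hu.add summable_geometric_two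
  have hrep : ∀ n, HasNuclearRep (valₗ (u n)) (s n) := fun n =>
    exists_rep_lt (lt_add_of_pos_right _ (by positivity))
  have hsum : Summable fun n => valₗ (u n) :=
    Summable.of_norm_bounded hs fun n => (hrep n).norm_le
  have htail (k : ℕ) : HasNuclearRep (∑' n, valₗ (u n) - ∑ n ∈ Finset.range k, valₗ (u n))
      (∑' j, s (j + k)) := by
    refine HasNuclearRep.hasSum (fun j => hrep (j + k)) ((summable_nat_add_iff k).2 hs) ?_
    exact (hasSum_nat_add_iff' k).2 hsum.hasSum
  have h0 := htail 0
  simp only [Finset.range_zero, Finset.sum_empty, sub_zero] at h0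
  refine ⟨mk _ h0.isTraceClass, ?_⟩
  rw [tendsto_iff_norm_sub_tendsto_zero]
  refine squeeze_zero (fun _ => norm_nonneg _) (fun k => ?_) (tendsto_sum_nat_add s)
  rw [norm_sub_rev]
  apply norm_le_of_rep
  rw [map_sub, map_sum, valₗ_mk]
  exact htail k

theorem isTraceClass (T : Nuc E) : IsTraceClass (val E T) := T.2

theorem trace_summable (T : Nuc E) {ι : Type*} {e : ι → E} (he : Orthonormal ℂ e) :
    Summable fun i => ‖⟪e i, val E T (e i)⟫_ℂ‖ := by
  obtain ⟨s, hs⟩ := T.isTraceClass.exists_rep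
  exact summable_of_sum_le (fun _ => norm_nonneg _) (hs.sum_inner_le he)

variable (E) in
/-- The trace, as a continuous linear functional on the trace class. -/
def tr : Nuc E →L[ℂ] ℂ :=
  LinearMap.mkContinuous
    { toFun := fun T => trace (val E T)
      map_add' := fun S T => by
        have he := (exists_hilbertBasis ℂ E).choose_spec.choose.orthonormal
        simp only [trace]
        rw [← Summable.tsum_add (trace_summable S he).of_norm (trace_summable T he).of_norm]
        simp
      map_smul' := fun c T => by
        simp only [trace]
        rw [RingHom.id_apply, smul_eq_mul, ← tsum_mul_left]
        simp } 1 fun T => by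
    have he := (exists_hilbertBasis ℂ E).choose_spec.choose.orthonormal
    rw [one_mul]
    refine le_norm_of_rep fun s hs => ?_
    refine (norm_tsum_le_tsum_norm (trace_summable T he)).trans ?_
    exact Real.tsum_le_of_sum_le (fun _ => norm_nonneg _) (hs.sum_inner_le he)

theorem tr_apply (T : Nuc E) : tr E T = trace (val E T) := rfl

/-- Near-optimal representations of `T` are transported by `A` and `B`, and the slack `δ` tends to
`0`. With `S` given only through its value, one bound serves left, right and two-sided products. -/
theorem norm_le_mul_mul {T S : Nuc E} {A B : E →L[ℂ] E} (h : val E S = A * val E T * B) :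
    ‖S‖ ≤ ‖A‖ * ‖T‖ * ‖B‖ := by
  have h1 : Filter.Tendsto (fun δ : ℝ => ‖A‖ * (‖T‖ + δ) * ‖B‖) (𝓝[>] 0)
      (𝓝 (‖A‖ * (‖T‖ + 0) * ‖B‖)) :=
    Filter.Tendsto.mono_left (Continuous.tendsto (by fun_prop) 0) nhdsWithin_le_nhds
  rw [add_zero] at h1
  refine ge_of_tendsto h1 (eventually_nhdsWithin_of_forall fun δ hδ => ?_)
  have h2 := (exists_rep_lt (T := T) (lt_add_of_pos_right _ hδ)).mul_mul A B
  apply norm_le_of_rep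
  change HasNuclearRep (val E S) _
  rw [h]
  exact h2

variable (E) in
/-- Multiplication `A T` of a trace class operator `T` by a bounded operator on the left. -/
def lmul : (E →L[ℂ] E) →L[ℂ] Nuc E →L[ℂ] Nuc E :=
  LinearMap.mkContinuous₂
    (LinearMap.mk₂ ℂ
      (fun A T => mk (A * val E T) (by
        obtain ⟨s, hs⟩ := T.isTraceClass.exists_rep
        simpa using (hs.mul_mul A 1).isTraceClass))
      (fun A B T => val_injective (by simp [add_mul]))
      (fun c A T => val_injective (by simp))
      (fun A S T => val_injective (by simp [mul_add]))
      (fun c A T => val_injective (by simp))) 1 fun A T => by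
    rw [one_mul, LinearMap.mk₂_apply]
    have h := norm_le_mul_mul (T := T) (A := A) (B := 1) (S := mk (A * val E T) (by
        obtain ⟨s, hs⟩ := T.isTraceClass.exists_rep
        simpa using (hs.mul_mul A 1).isTraceClass)) (by simp)
    refine h.trans (mul_le_of_le_one_right (by positivity) ContinuousLinearMap.norm_id_le)

variable (E) in
/-- Multiplication `T A` of a trace class operator `T` by a bounded operator on the right. -/
def rmul : (E →L[ℂ] E) →L[ℂ] Nuc E →L[ℂ] Nuc E :=
  LinearMap.mkContinuous₂
    (LinearMap.mk₂ ℂ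
      (fun A T => mk (val E T * A) (by
        obtain ⟨s, hs⟩ := T.isTraceClass.exists_rep
        simpa using (hs.mul_mul 1 A).isTraceClass))
      (fun A B T => val_injective (by simp [mul_add]))
      (fun c A T => val_injective (by simp))
      (fun A S T => val_injective (by simp [add_mul]))
      (fun c A T => val_injective (by simp))) 1 fun A T => by
    rw [one_mul, LinearMap.mk₂_apply]
    have h := norm_le_mul_mul (T := T) (A := 1) (B := A) (S := mk (val E T * A) (by
        obtain ⟨s, hs⟩ := T.isTraceClass.exists_rep
        simpa using (hs.mul_mul 1 A).isTraceClass)) (by simp)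
    refine h.trans ?_
    rw [mul_comm]
    gcongr
    exact mul_le_of_le_one_left (by positivity) ContinuousLinearMap.norm_id_le

@[simp] theorem val_lmul (A : E →L[ℂ] E) (T : Nuc E) : val E (lmul E A T) = A * val E T := rfl

@[simp] theorem val_rmul (A : E →L[ℂ] E) (T : Nuc E) : val E (rmul E A T) = val E T * A := rfl

end Nuc

end Nuclear

/-! ### Boundary values of holomorphic functions of moderate growth -/

section BoundaryValues

open Complex MeasureTheory Filter Set

variable {F : Type*} [NormedAddCommGroup F] [NormedSpace ℂ F]

/-- Near `p` and off the real axis, `k` is holomorphic and `O(|im z|⁻ᴹ)`. -/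
def ModerateAt (k : ℂ → F) (M : ℕ) (p : ℂ) : Prop :=
  ∃ C : ℝ, ∀ᶠ z in 𝓝 p, z.im ≠ 0 → DifferentiableAt ℂ k z ∧ ‖k z‖ * |z.im| ^ M ≤ C

theorem ModerateAt.eventually {k : ℂ → F} {M : ℕ} {p : ℂ} (h : ModerateAt k M p) :
    ∀ᶠ q in 𝓝 p, ModerateAt k M q := by
  obtain ⟨C, hC⟩ := h
  exact hC.eventually_nhds.mono fun q hq => ⟨C, hq⟩

/-- The reflection `z ↦ -z` is holomorphic and exchanges the half planes, so results above the axis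
carry over to those below. -/
theorem ModerateAt.comp_neg {k : ℂ → F} {M : ℕ} {p : ℂ} (h : ModerateAt k M (-p)) :
    ModerateAt (fun z => k (-z)) M p := by
  obtain ⟨C, hC⟩ := h
  refine ⟨C, (continuous_neg.tendsto p).eventually hC |>.mono fun z hz hne => ?_⟩
  have h2 := hz (by simpa using hne)
  refine ⟨?_, by simpa using h2.2⟩
  exact DifferentiableAt.comp z h2.1 differentiable_neg.differentiableAt

/-- Compactness makes the radius and the constant uniform. The uniform `δ` is what permits vertical
shifts of points of the support by small `ε`. -/
theorem exists_uniform_moderate {k : ℂ → F} {M : ℕ} {K : Set ℂ} (hK : IsCompact K)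
    (hk : ∀ p ∈ K, ModerateAt k M p) :
    ∃ δ > (0 : ℝ), ∃ C : ℝ, 0 ≤ C ∧ ∀ p ∈ K, ∀ z, dist z p < δ → z.im ≠ 0 →
      DifferentiableAt ℂ k z ∧ ‖k z‖ * |z.im| ^ M ≤ C := by
  refine hK.induction_on (p := fun s => ∃ δ > (0 : ℝ), ∃ C : ℝ, 0 ≤ C ∧ ∀ p ∈ s, ∀ z,
    dist z p < δ → z.im ≠ 0 → DifferentiableAt ℂ k z ∧ ‖k z‖ * |z.im| ^ M ≤ C) ?_ ?_ ?_ ?_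
  · exact ⟨1, one_pos, 0, le_rfl, by simp⟩
  · rintro s t hst ⟨δ, hδ, C, hC, h⟩
    exact ⟨δ, hδ, C, hC, fun p hp => h p (hst hp)⟩
  · rintro s t ⟨δ, hδ, C, hC, h⟩ ⟨δ', hδ', C', hC', h'⟩
    refine ⟨min δ δ', lt_min hδ hδ', max C C', le_max_of_le_left hC, ?_⟩
    rintro p (hp | hp) z hz hne
    · have := h p hp z (hz.trans_le (min_le_left _ _)) hne
      exact ⟨this.1, this.2.trans (le_max_left _ _)⟩
    · have := h' p hp z (hz.trans_le (min_le_right _ _)) hne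
      exact ⟨this.1, this.2.trans (le_max_right _ _)⟩
  · intro p hp
    obtain ⟨C, hC⟩ := hk p hp
    obtain ⟨ε, hε, hball⟩ := Metric.eventually_nhds_iff.1 hC
    refine ⟨Metric.ball p (ε / 2), mem_nhdsWithin_of_mem_nhds (Metric.ball_mem_nhds _ (by positivity)),
      ε / 2, by positivity, max C 0, le_max_right _ _, fun q hq z hz hne => ?_⟩
    have := hball (y := z) (by
      have := dist_triangle z q p
      rw [Metric.mem_ball] at hq
      linarith) hne
    exact ⟨this.1, this.2.trans (le_max_left _ _)⟩

theorem dbar_eq_zero_of_notMem {U : ℂ → ℂ} {z : ℂ} (h : z ∉ tsupport U) : dbar U z = 0 := by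
  have : fderiv ℝ U z = 0 := by
    by_contra h2
    exact h (support_fderiv_subset ℝ h2)
  simp [dbar, this]

theorem continuous_dbar {U : ℂ → ℂ} (hU : ContDiff ℝ 1 U) : Continuous (dbar U) := by
  have := hU.continuous_fderiv one_ne_zero
  unfold dbar
  fun_prop

/-- Off the support of `U` the product vanishes locally, so nothing is asked of `k` there. -/
theorem continuousOn_smul_of_tsupport {X : Type*} [TopologicalSpace X] {V U : X → ℂ} {k : X → F}
    {s : Set X} (hV : Continuous V) (hVU : ∀ z ∉ tsupport U, V z = 0)
    (hk : ∀ z ∈ tsupport U, z ∈ s → ContinuousAt k z) : ContinuousOn (fun z => V z • k z) s := by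
  intro z hz
  apply ContinuousAt.continuousWithinAt
  by_cases h : z ∈ tsupport U
  · exact hV.continuousAt.smul (hk z h hz)
  · have : (fun z => V z • k z) =ᶠ[𝓝 z] fun _ => 0 := by
      filter_upwards [(isClosed_tsupport U).isOpen_compl.mem_nhds h] with w hw
      rw [hVU w hw, zero_smul]
    exact continuousAt_const.congr this.symm

theorem setIntegral_reProdIm {f : ℂ → F} [CompleteSpace F] {s t : Set ℝ}
    (hf : IntegrableOn f (s ×ℂ t)) :
    ∫ z in s ×ℂ t, f z = ∫ x in s, ∫ y in t, f (x + y * I) := by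
  have hs : s ×ℂ t = measurableEquivRealProd ⁻¹' (s ×ˢ t) := rfl
  have e := volume_preserving_equiv_real_prod
  have h1 : ∀ p : ℝ × ℝ, f (measurableEquivRealProd.symm p) = f (p.1 + p.2 * I) := fun p => by
    rw [measurableEquivRealProd_symm_apply, Complex.mk_eq_add_mul_I]
  have h2 := e.setIntegral_preimage_emb measurableEquivRealProd.measurableEmbedding
    (fun p => f (measurableEquivRealProd.symm p)) (s ×ˢ t)
  simp only [MeasurableEquiv.symm_apply_apply] at h2
  have h3 := (e.integrableOn_comp_preimage measurableEquivRealProd.measurableEmbedding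
    (f := fun p => f (measurableEquivRealProd.symm p)) (s := s ×ˢ t)).1 (by
      convert! hf using 1)
  rw [hs, h2, Measure.volume_eq_prod, setIntegral_prod _ h3]
  simp only [h1]

variable [CompleteSpace F] {U : ℂ → ℂ} {k : ℂ → F} {M : ℕ}

/-- Green's formula in the upper half plane for `U k`, with `k` holomorphic. -/
theorem integral_real_eq_integral_dbar {A : ℝ} (hU : ContDiff ℝ 1 U)
    (hA : tsupport U ⊆ Metric.ball 0 A)
    (hk : ∀ z ∈ tsupport U, 0 ≤ z.im → DifferentiableAt ℂ k z) :
    ∫ t : ℝ, U t • k t = (2 * I) • ∫ z in {z : ℂ | 0 < z.im}, dbar U z • k z := by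
  rcases le_or_gt A 0 with hA0 | hA0
  · rw [Metric.ball_eq_empty.2 hA0, subset_empty_iff] at hA
    have hU0 : U = 0 := tsupport_eq_empty_iff.1 hA
    have hd : ∀ z, dbar U z = 0 := fun z => dbar_eq_zero_of_notMem (by simp [hA])
    simp only [hd, zero_smul, integral_zero, smul_zero]
    simp [hU0]
  have hout : ∀ z : ℂ, A ≤ |z.re| ∨ A ≤ |z.im| → z ∉ tsupport U := fun z hz hmem => by
    have := hA hmem
    rw [mem_ball_zero_iff] at this
    rcases hz with h | h
    · exact absurd ((abs_re_le_norm z).trans_lt this) (not_lt.2 h)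
    · exact absurd ((abs_im_le_norm z).trans_lt this) (not_lt.2 h)
  have hU0 : ∀ z ∉ tsupport U, U z = 0 := fun z hz => image_eq_zero_of_notMem_tsupport hz
  -- The product rule. Off the support of `U` both terms vanish, whatever `k` does there.
  let W' : ℂ → ℂ →L[ℝ] F := fun z => U z • (fderiv ℂ k z).restrictScalars ℝ +
    (fderiv ℝ U z).smulRight (k z)
  have hW : ∀ z : ℂ, 0 ≤ z.im → HasFDerivAt (fun z => U z • k z) (W' z) z := fun z hz => by
    by_cases h : z ∈ tsupport U
    · exact ((hU.differentiable one_ne_zero z).hasFDerivAt).smul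
        ((hk z h hz).hasFDerivAt.restrictScalars ℝ)
    · have h1 : (fun z => U z • k z) =ᶠ[𝓝 z] fun _ => 0 := by
        filter_upwards [(isClosed_tsupport U).isOpen_compl.mem_nhds h] with w hw
        rw [hU0 w hw, zero_smul]
      have h2 : fderiv ℝ U z = 0 := by
        by_contra h2
        exact h (support_fderiv_subset ℝ h2)
      have h3 : W' z = 0 := by
        ext v
        simp [W', hU0 z h, h2]
      rw [h3]
      exact (hasFDerivAt_const (0 : F) z).congr_of_eventuallyEq h1
  -- The integrand of Green's formula. The terms with the derivative of `k` cancel because it is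
  -- complex linear.
  have hW2 : ∀ z, I • W' z 1 - W' z I = (2 * I) • (dbar U z • k z) := fun z => by
    have h1 : fderiv ℂ k z I = I • fderiv ℂ k z 1 := by
      rw [← map_smul, smul_eq_mul, mul_one]
    have h2 : (2 * I) * dbar U z = I * fderiv ℝ U z 1 - fderiv ℝ U z I := by
      simp only [dbar]
      linear_combination (fderiv ℝ U z I) * I_mul_I
    rw [smul_smul, h2]
    simp only [W', add_apply, smul_apply, ContinuousLinearMap.coe_restrictScalars',
      ContinuousLinearMap.smulRight_apply, h1, smul_add, sub_smul, smul_smul]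
    rw [mul_comm I (U z)]
    abel
  have hcont : ContinuousOn (fun z => dbar U z • k z) {z : ℂ | 0 ≤ z.im} :=
    continuousOn_smul_of_tsupport (continuous_dbar hU) (fun z hz => dbar_eq_zero_of_notMem hz)
      fun z hz hz' => (hk z hz hz').continuousAt
  have hrect : IsCompact (uIcc (-A) A ×ℂ uIcc 0 A) := isCompact_uIcc.reProdIm isCompact_uIcc
  have hrsub : uIcc (-A) A ×ℂ uIcc 0 A ⊆ {z : ℂ | 0 ≤ z.im} := fun z hz => by
    have := hz.2
    rw [mem_preimage, uIcc_of_le hA0.le] at this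
    exact this.1
  have hint := (hcont.mono hrsub).integrableOn_compact (μ := volume) hrect
  -- On the rectangle `[-A, A] × [0, A]` every side but the one on the real axis avoids the support
  -- of `U`.
  have key := integral_boundary_rect_of_hasFDerivAt_real_off_countable (fun z => U z • k z) W'
    (-A : ℝ) (A + A * I) ∅ countable_empty (by
      intro z hz
      refine ((hW z ?_).continuousAt).continuousWithinAt
      exact hrsub (by simpa using hz)) (by
      rintro z ⟨hz, -⟩
      refine hW z ?_
      have := hz.2
      simp only [mem_preimage, ofReal_im, add_im, mul_im, ofReal_re, I_im, mul_one, I_re, mul_zero,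
        add_zero, zero_add, min_eq_left hA0.le] at this
      exact this.1.le) (by
      simp only [hW2]
      simpa using! hint.smul (2 * I))
  simp only [hW2, ofReal_im, ofReal_re, add_re, add_im, mul_re, mul_im, I_re, I_im, mul_zero, mul_one,
    sub_zero, add_zero, zero_add, ofReal_zero, zero_mul] at key
  have e1 : ∀ x : ℝ, U (x + A * I) = 0 := fun x => hU0 _ (hout _ (Or.inr (by simp [le_abs_self])))
  have e2 : ∀ y : ℝ, U (A + y * I) = 0 := fun x => hU0 _ (hout _ (Or.inl (by simp [le_abs_self])))
  have e3 : ∀ y : ℝ, U ((-A : ℝ) + y * I) = 0 := fun x =>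
    hU0 _ (hout _ (Or.inl (by simp [le_abs_self])))
  simp only [e1, e2, e3, zero_smul, intervalIntegral.integral_zero, smul_zero, sub_zero,
    add_zero] at key
  rw [intervalIntegral.integral_eq_integral_of_support_subset] at key
  · rw [key, intervalIntegral.integral_of_le (by linarith)]
    simp only [intervalIntegral.integral_of_le hA0.le]
    rw [← setIntegral_reProdIm (f := fun z => (2 * I) • (dbar U z • k z)), integral_smul]
    · congr 1
      refine (setIntegral_eq_of_subset_of_forall_sdiff_eq_zero ?_ ?_ ?_).symm
      · exact measurableSet_lt measurable_const measurable_im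
      · exact fun z hz => hz.2.1
      · rintro z ⟨hz, hz'⟩
        rw [dbar_eq_zero_of_notMem, zero_smul]
        apply hout
        by_contra! h
        refine hz' ⟨⟨(abs_lt.1 h.1).1, (abs_lt.1 h.1).2.le⟩, hz, (abs_lt.1 h.2).2.le⟩
    · refine Integrable.smul _ (hint.mono_set ?_)
      rintro z ⟨h1, h2⟩
      rw [uIcc_of_le hA0.le, uIcc_of_le (by linarith)]
      exact ⟨Ioc_subset_Icc_self h1, Ioc_subset_Icc_self h2⟩
  · intro x hx
    have h1 : (x : ℂ) ∈ tsupport U := by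
      by_contra h
      exact hx (by simp [hU0 _ h])
    have h2 : ¬ A ≤ |x| := fun h => hout _ (Or.inl (by simpa using h)) h1
    rw [not_le, abs_lt] at h2
    exact ⟨h2.1, h2.2.le⟩

-- When `w` is at least as far from the axis as `z`, the zero of `dbar U` at height `|z.im|`
-- compensates the growth of `k` at `w`. The bound is uniform in the shift from `z` to `w`, which
-- supplies a dominating function.
omit [CompleteSpace F] in
theorem exists_bound_dbar_smul (hU : HasCompactSupport U)
    (hk : ∀ p ∈ tsupport U, ModerateAt k M p) (hd : ∃ C, ∀ z, ‖dbar U z‖ ≤ C * |z.im| ^ M) :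
    ∃ δ > (0 : ℝ), ∃ C : ℝ, (∀ p ∈ tsupport U, ∀ z, dist z p < δ → z.im ≠ 0 →
      DifferentiableAt ℂ k z) ∧ ∀ z ∈ tsupport U, ∀ w, dist w z < δ → w.im ≠ 0 →
        |z.im| ≤ |w.im| → ‖dbar U z • k w‖ ≤ C := by
  obtain ⟨δ, hδ, C, hC, h⟩ := exists_uniform_moderate hU.isCompact hk
  obtain ⟨D, hD⟩ := hd
  have hD0 : 0 ≤ D := by
    -- At the point `I` the factor `|im z| ^ M` is `1`.
    have := (norm_nonneg _).trans (hD I)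
    simpa using this
  refine ⟨δ, hδ, D * C, fun p hp z hz hne => (h p hp z hz hne).1, fun z hz w hw hne hle => ?_⟩
  have h1 := (h z hz w hw hne).2
  rw [norm_smul]
  calc ‖dbar U z‖ * ‖k w‖ ≤ D * |z.im| ^ M * ‖k w‖ := by gcongr; exact hD z
    _ ≤ D * |w.im| ^ M * ‖k w‖ := by gcongr
    _ = D * (‖k w‖ * |w.im| ^ M) := by ring
    _ ≤ D * C := by gcongr

/-- The boundary value from above. -/
theorem tendsto_boundaryValue_above (hU : ContDiff ℝ 1 U) (hc : HasCompactSupport U)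
    (hk : ∀ p ∈ tsupport U, ModerateAt k M p) (hd : ∃ C, ∀ z, ‖dbar U z‖ ≤ C * |z.im| ^ M) :
    IntegrableOn (fun z => dbar U z • k z) {z : ℂ | 0 < z.im} ∧
    (∀ᶠ ε : ℝ in 𝓝[>] 0, Integrable fun t : ℝ => U t • k (t + ε * I)) ∧
    Tendsto (fun ε : ℝ => ∫ t : ℝ, U t • k (t + ε * I)) (𝓝[>] 0)
      (𝓝 ((2 * I) • ∫ z in {z : ℂ | 0 < z.im}, dbar U z • k z)) := by
  obtain ⟨δ, hδ, C, hkd, hb⟩ := exists_bound_dbar_smul hc hk hd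
  obtain ⟨A, hA⟩ := hc.isCompact.isBounded.subset_ball 0
  have hmeas : MeasurableSet {z : ℂ | 0 < z.im} := measurableSet_lt measurable_const measurable_im
  have hdist : ∀ (z : ℂ) (ε : ℝ), 0 ≤ ε → dist (z + ε * I) z = ε := fun z ε hε => by
    simp [dist_eq_norm, abs_of_nonneg hε]
  have hdiff : ∀ ε : ℝ, 0 ≤ ε → ε < δ → ∀ z ∈ tsupport U, 0 < z.im + ε →
      DifferentiableAt ℂ (fun w => k (w + ε * I)) z := fun ε h0 hε z hz hpos => by
    have h1 := hkd z hz (z + ε * I) (by rwa [hdist z ε h0]) (by simpa using hpos.ne')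
    exact DifferentiableAt.comp (g := k) z h1 (differentiableAt_id.add_const _)
  have hcont : ∀ ε : ℝ, 0 ≤ ε → ε < δ →
      ContinuousOn (fun z => dbar U z • k (z + ε * I)) {z : ℂ | 0 < z.im} := fun ε h0 hε =>
    continuousOn_smul_of_tsupport (continuous_dbar hU) (fun z hz => dbar_eq_zero_of_notMem hz)
      fun z hz hz' => (hdiff ε h0 hε z hz (add_pos_of_pos_of_nonneg hz' h0)).continuousAt
  -- In the upper half plane an upward shift moves away from the axis, as the uniform bound
  -- requires.
  have hbound : ∀ ε : ℝ, 0 ≤ ε → ε < δ → ∀ z ∈ {z : ℂ | 0 < z.im},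
      ‖dbar U z • k (z + ε * I)‖ ≤ (tsupport U).indicator (fun _ => C) z := fun ε h0 hε z hz => by
    have hz' : 0 < z.im := hz
    by_cases h : z ∈ tsupport U
    · rw [indicator_of_mem h]
      refine hb z h _ (by rwa [hdist z ε h0]) (by simpa using (add_pos_of_pos_of_nonneg hz h0).ne') ?_
      simp only [add_im, mul_im, ofReal_re, I_im, mul_one, ofReal_im, I_re, mul_zero, add_zero]
      rw [abs_of_pos hz', abs_of_pos (by linarith)]
      linarith
    · rw [indicator_of_notMem h, dbar_eq_zero_of_notMem h, zero_smul, norm_zero]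
  have hbi : Integrable ((tsupport U).indicator fun _ => C) (volume.restrict {z : ℂ | 0 < z.im}) := by
    refine Integrable.restrict ?_
    rw [integrable_indicator_iff (isClosed_tsupport U).measurableSet]
    exact integrableOn_const hc.isCompact.measure_lt_top.ne
  have hev : ∀ᶠ ε : ℝ in 𝓝[>] 0, 0 < ε ∧ ε < δ := Ioo_mem_nhdsGT hδ
  have hb0 : IntegrableOn (fun z => dbar U z • k z) {z : ℂ | 0 < z.im} := by
    have h1 := hcont 0 le_rfl hδ
    have h2 := hbound 0 le_rfl hδ
    simp only [ofReal_zero, zero_mul, add_zero] at h1 h2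
    exact Integrable.mono' hbi (h1.aestronglyMeasurable hmeas)
      ((ae_restrict_iff' hmeas).2 (ae_of_all _ h2))
  refine ⟨hb0, ?_, ?_⟩
  · filter_upwards [hev] with ε hε
    have hUt : ∀ t : ℝ, t ∈ tsupport (fun t : ℝ => U t) → (t : ℂ) ∈ tsupport U := fun t ht =>
      closure_minimal (t := ofReal ⁻¹' tsupport U) (fun x hx => subset_tsupport U hx)
        ((isClosed_tsupport U).preimage continuous_ofReal) ht
    have hcU : Continuous fun t : ℝ => U t := hU.continuous.comp continuous_ofReal
    have h1 : Continuous fun t : ℝ => U t • k (t + ε * I) := by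
      rw [← continuousOn_univ]
      refine continuousOn_smul_of_tsupport hcU (U := fun t : ℝ => U t)
        (fun z hz => image_eq_zero_of_notMem_tsupport (f := fun t : ℝ => U t) hz)
        fun t ht _ => ?_
      have := (hdiff ε hε.1.le hε.2 t (hUt t ht) (by simpa using hε.1)).continuousAt
      exact ContinuousAt.comp (g := fun w : ℂ => k (w + ε * I)) this continuous_ofReal.continuousAt
    refine h1.integrable_of_hasCompactSupport ?_
    have h2 : HasCompactSupport fun t : ℝ => U t := by
      refine HasCompactSupport.of_support_subset_isCompact (isCompact_closedBall (0 : ℝ) A)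
        fun t ht => ?_
      have := hA (subset_tsupport U (show U t ≠ 0 from ht))
      rw [mem_ball_zero_iff, norm_real] at this
      simpa using this.le
    exact h2.smul_right
  -- The shifted function `k(· + iε)` is holomorphic up to the real axis, so Green's formula applies
  -- to it; dominated convergence then sends `ε` to `0`.
  · have h1 : ∀ᶠ ε : ℝ in 𝓝[>] 0, (2 * I) • ∫ z in {z : ℂ | 0 < z.im}, dbar U z • k (z + ε * I) =
        ∫ t : ℝ, U t • k (t + ε * I) := by
      filter_upwards [hev] with ε hε
      exact (integral_real_eq_integral_dbar (k := fun z => k (z + ε * I)) hU hA fun z hz hz' =>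
        hdiff ε hε.1.le hε.2 z hz (by linarith [hε.1])).symm
    refine Tendsto.congr' h1 (Tendsto.const_smul ?_ _)
    refine tendsto_integral_filter_of_dominated_convergence _ ?_ ?_ hbi ?_
    · filter_upwards [hev] with ε hε
      exact (hcont ε hε.1.le hε.2).aestronglyMeasurable hmeas
    · filter_upwards [hev] with ε hε
      exact (ae_restrict_iff' hmeas).2 (ae_of_all _ (hbound ε hε.1.le hε.2))
    · refine (ae_restrict_iff' hmeas).2 (ae_of_all _ fun z hz => ?_)
      have hz' : 0 < z.im := hz
      by_cases h : z ∈ tsupport U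
      · refine Tendsto.const_smul ?_ _
        have h2 : ContinuousAt k z := by
          simpa using (hdiff 0 le_rfl hδ z h (by simpa using hz')).continuousAt
        have h3 : Tendsto (fun ε : ℝ => z + ε * I) (𝓝[>] 0) (𝓝 (z + (0 : ℝ) * I)) :=
          (Continuous.tendsto (by fun_prop) 0).mono_left nhdsWithin_le_nhds
        rw [ofReal_zero, zero_mul, add_zero] at h3
        exact h2.tendsto.comp h3
      · simp only [dbar_eq_zero_of_notMem h, zero_smul]
        exact tendsto_const_nhds

theorem dbar_comp_neg (U : ℂ → ℂ) (z : ℂ) : dbar (fun w => U (-w)) z = -dbar U (-z) := by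
  have : fderiv ℝ (fun w => U (-w)) z = -fderiv ℝ U (-z) := by
    exact (ContinuousLinearEquiv.neg ℝ (M := ℂ)).comp_right_fderiv.trans (by ext; simp)
  simp only [dbar, this, neg_apply]
  ring

/-- The jump across the real axis of a function of moderate growth, tested against the values on
the real axis of an almost analytic function `U`. -/
theorem tendsto_jump (hU : ContDiff ℝ 1 U) (hc : HasCompactSupport U)
    (hk : ∀ p ∈ tsupport U, ModerateAt k M p) (hd : ∃ C, ∀ z, ‖dbar U z‖ ≤ C * |z.im| ^ M) :
    Integrable (fun z => dbar U z • k z) ∧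
    (∀ᶠ ε : ℝ in 𝓝[>] 0, Integrable fun t : ℝ => U t • (k (t + ε * I) - k (t - ε * I))) ∧
    Tendsto (fun ε : ℝ => ∫ t : ℝ, U t • (k (t + ε * I) - k (t - ε * I))) (𝓝[>] 0)
      (𝓝 ((2 * I) • ∫ z, dbar U z • k z)) := by
  obtain ⟨h1, h2, h3⟩ := tendsto_boundaryValue_above hU hc hk hd
  have hts : ∀ p, p ∈ tsupport (fun z => U (-z)) → -p ∈ tsupport U := fun p hp =>
    closure_minimal (t := Neg.neg ⁻¹' tsupport U) (fun x hx => subset_tsupport U hx)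
      ((isClosed_tsupport U).preimage continuous_neg) hp
  -- The boundary value from below is the one from above for the reflected pair `U(-z)`, `k(-z)`.
  -- Conjugation would not keep `k` holomorphic.
  obtain ⟨g1, g2, g3⟩ := tendsto_boundaryValue_above (U := fun z => U (-z))
    (k := fun z => k (-z)) (M := M) (hU.comp contDiff_neg)
    (hc.comp_homeomorph (Homeomorph.neg ℂ)) (fun p hp => (hk _ (hts p hp)).comp_neg) (by
      obtain ⟨C, hC⟩ := hd
      exact ⟨C, fun z => by simpa [dbar_comp_neg] using hC (-z)⟩)
  have eneg : ∀ ε : ℝ, (fun t : ℝ => U (-t) • k (-(t + ε * I))) =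
      fun t => (fun t : ℝ => U t • k (t - ε * I)) (-t) := fun ε => by
    ext t
    push_cast
    congr 2
    ring
  have g2' : ∀ᶠ ε : ℝ in 𝓝[>] 0, Integrable fun t : ℝ => U t • k (t - ε * I) := by
    filter_upwards [g2] with ε hε
    rw [eneg] at hε
    simpa using hε.comp_neg
  have hneg : MeasurePreserving (fun z : ℂ => -z) := Measure.measurePreserving_neg volume
  have hemb : MeasurableEmbedding (fun z : ℂ => -z) := (Homeomorph.neg ℂ).measurableEmbedding
  have epre : (fun z : ℂ => -z) ⁻¹' {z : ℂ | z.im < 0} = {z : ℂ | 0 < z.im} := by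
    ext z
    simp
  have g1' : IntegrableOn (fun z => dbar U z • k z) {z : ℂ | z.im < 0} := by
    rw [← hneg.integrableOn_comp_preimage hemb, epre]
    refine g1.neg.congr (ae_of_all _ fun z => ?_)
    simp [dbar_comp_neg]
  have g3' : (2 * I) • ∫ z in {z : ℂ | 0 < z.im}, dbar (fun z => U (-z)) z • k (-z) =
      -((2 * I) • ∫ z in {z : ℂ | z.im < 0}, dbar U z • k z) := by
    have h4 := hneg.setIntegral_preimage_emb hemb (fun z => dbar U z • k z) {z : ℂ | z.im < 0}
    rw [epre] at h4
    simp only [dbar_comp_neg, neg_smul]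
    rw [integral_neg, smul_neg, h4]
  have hae : ({z : ℂ | 0 < z.im} ∪ {z : ℂ | z.im < 0} : Set ℂ) =ᵐ[volume] univ := by
    have h0 : volume {z : ℂ | z.im = 0} = 0 := by
      have h5 : {z : ℂ | z.im = 0} = measurableEquivRealProd ⁻¹' (univ ×ˢ {0}) := by
        ext z
        simp [measurableEquivRealProd_apply]
      rw [h5, volume_preserving_equiv_real_prod.measure_preimage
        (MeasurableSet.univ.prod (measurableSet_singleton _)).nullMeasurableSet,
        Measure.volume_eq_prod, Measure.prod_prod]
      simp
    refine ae_eq_univ.2 (measure_mono_null (fun z hz => ?_) h0)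
    simp only [mem_compl_iff, mem_union, mem_ofPred_eq, not_or, not_lt] at hz
    exact le_antisymm hz.1 hz.2
  have hint : Integrable (fun z => dbar U z • k z) := by
    rw [← integrableOn_univ]
    exact (h1.union g1').congr_set_ae hae.symm
  refine ⟨hint, ?_, ?_⟩
  · filter_upwards [h2, g2'] with ε a b
    simp only [smul_sub]
    exact a.sub b
  · have h6 : ∫ z, dbar U z • k z = (∫ z in {z : ℂ | 0 < z.im}, dbar U z • k z) +
        ∫ z in {z : ℂ | z.im < 0}, dbar U z • k z := by
      rw [← setIntegral_univ, ← setIntegral_congr_set hae]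
      refine setIntegral_union ?_ (measurableSet_lt measurable_im measurable_const) h1 g1'
      rw [Set.disjoint_left]
      intro z hz hz'
      have h7 : 0 < z.im := hz
      have h8 : z.im < 0 := hz'
      exact absurd h7 (not_lt.2 h8.le)
    rw [h6, smul_add, ← neg_neg ((2 * I) • ∫ z in {z : ℂ | z.im < 0}, dbar U z • k z), ← g3',
      ← sub_eq_add_neg]
    refine (h3.sub g3).congr' ?_
    filter_upwards [h2, g2'] with ε a b
    simp only [smul_sub]
    rw [integral_sub a b]
    congr 1
    have := integral_neg_eq_self (fun t : ℝ => U t • k (t - ε * I)) volume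
    rw [← this]
    exact congrArg (fun f : ℝ → F => ∫ t, f t) (eneg ε)

end BoundaryValues

/-! ### Almost analytic extensions -/

section AlmostAnalytic

open Complex MeasureTheory Filter Set

theorem dbar_add {F G : ℂ → ℂ} {z : ℂ} (hF : DifferentiableAt ℝ F z) (hG : DifferentiableAt ℝ G z) :
    dbar (fun z => F z + G z) z = dbar F z + dbar G z := by
  simp only [dbar, fderiv_fun_add hF hG, add_apply]
  ring

theorem dbar_mul {F G : ℂ → ℂ} {z : ℂ} (hF : DifferentiableAt ℝ F z) (hG : DifferentiableAt ℝ G z) :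
    dbar (fun z => F z * G z) z = dbar F z * G z + F z * dbar G z := by
  simp only [dbar, fderiv_fun_mul hF hG, add_apply, smul_apply, smul_eq_mul]
  ring

theorem dbar_comp_re {g : ℝ → ℂ} {z : ℂ} (hg : DifferentiableAt ℝ g z.re) :
    dbar (fun z => g z.re) z = 1 / 2 * deriv g z.re := by
  have h : HasFDerivAt (fun z : ℂ => g z.re) _ z := hg.hasFDerivAt.comp z reCLM.hasFDerivAt
  simp [dbar, h.fderiv]

theorem dbar_I_mul_im_pow (k : ℕ) (z : ℂ) :
    dbar (fun z : ℂ => (I * (z.im : ℂ)) ^ k) z = -(1 / 2) * (k * (I * z.im) ^ (k - 1)) := by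
  have h0 : HasFDerivAt (fun z : ℂ => (z.im : ℂ)) (ofRealCLM.comp imCLM) z :=
    (ofRealCLM.comp imCLM).hasFDerivAt
  have h := (h0.const_mul I).pow k
  rw [dbar, h.fderiv]
  simp
  linear_combination (1 / 2 * (k * (I * z.im) ^ (k - 1))) * I_mul_I

/-- The Taylor polynomial in the imaginary direction. -/
def taylorIm (f : ℝ → ℂ) (N : ℕ) (z : ℂ) : ℂ :=
  ∑ k ∈ Finset.range (N + 1), iteratedDeriv k f z.re / (k.factorial : ℂ) * (I * (z.im : ℂ)) ^ k

/-- The cut-off `(x, y) ↦ τ(y / ⟨x⟩)`. -/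
def coneCutoff (τ : ℝ → ℝ) (z : ℂ) : ℂ := (τ (z.im / √(1 + z.re ^ 2)) : ℂ)

theorem almostAnalytic_eq (f : ℝ → ℂ) (N : ℕ) (τ : ℝ → ℝ) :
    almostAnalytic f N τ = fun z => taylorIm f N z * coneCutoff τ z := rfl

/-- The points `x + iy` with `x ∈ K` and `y / ⟨x⟩ ∈ T`. -/
def coneSet (K T : Set ℝ) : Set ℂ := {z | z.re ∈ K ∧ z.im / √(1 + z.re ^ 2) ∈ T}

theorem one_le_sqrt_one_add_sq (x : ℝ) : 1 ≤ √(1 + x ^ 2) :=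
  Real.one_le_sqrt.2 (by nlinarith [sq_nonneg x])

theorem continuous_slope : Continuous fun z : ℂ => z.im / √(1 + z.re ^ 2) :=
  continuous_im.div (by fun_prop) fun z => (zero_lt_one.trans_le (one_le_sqrt_one_add_sq _)).ne'

/-- The set is the continuous image of `K × T` under `(x, s) ↦ x + i s ⟨x⟩`. -/
theorem isCompact_coneSet {K T : Set ℝ} (hK : IsCompact K) (hT : IsCompact T) :
    IsCompact (coneSet K T) := by
  have h : coneSet K T =
      (fun p : ℝ × ℝ => (p.1 : ℂ) + (p.2 * √(1 + p.1 ^ 2) : ℝ) * I) '' (K ×ˢ T) := by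
    ext z
    have h1 := zero_lt_one.trans_le (one_le_sqrt_one_add_sq z.re)
    constructor
    · rintro ⟨h2, h3⟩
      refine ⟨(z.re, z.im / √(1 + z.re ^ 2)), ⟨h2, h3⟩, ?_⟩
      dsimp only
      rw [div_mul_cancel₀ _ h1.ne', re_add_im]
    · rintro ⟨⟨x, s⟩, ⟨hx, hs⟩, rfl⟩
      have h2 := zero_lt_one.trans_le (one_le_sqrt_one_add_sq x)
      simp only at hx hs
      refine ⟨by simpa using hx, ?_⟩
      simpa [h2.ne'] using hs
  rw [h]
  exact (hK.prod hT).image (by fun_prop)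

/-- Smooth compactly supported functions equal to `1` near `0`. -/
def IsCutoff (τ : ℝ → ℝ) : Prop :=
  ContDiff ℝ (⊤ : ℕ∞) τ ∧ HasCompactSupport τ ∧ ∀ᶠ s in 𝓝 (0 : ℝ), τ s = 1

theorem isAdmissibleCutoff_iff {E : Type*} [NormedAddCommGroup E] [InnerProductSpace ℂ E]
    {X : E →L[ℂ] E} {f : ℝ → ℂ} {τ : ℝ → ℝ} :
    IsAdmissibleCutoff X f τ ↔ IsCutoff τ ∧
      ∀ z ∈ coneSet (tsupport f) (tsupport τ), z.im ≠ 0 → z ∉ spectrum ℂ X := by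
  unfold IsAdmissibleCutoff IsCutoff coneSet
  constructor
  · rintro ⟨h1, h2, h3, h4⟩
    exact ⟨⟨h1, h2, h3⟩, fun z hz hne hs => h4 z hs hne hz.1 hz.2⟩
  · rintro ⟨⟨h1, h2, h3⟩, h4⟩
    exact ⟨h1, h2, h3, fun z hs hne hz hz' => h4 z ⟨hz, hz'⟩ hne hs⟩

/-- A compact subset of the real line has a uniform thickening inside `G`, and `⟨x⟩` is bounded on
it, so a narrow enough cone fits. This is how properties known near real points reach the whole
support of an almost analytic extension. -/
theorem exists_cutoff {K : Set ℝ} (hK : IsCompact K) {G : Set ℂ} (hG : ∀ x ∈ K, G ∈ 𝓝 (x : ℂ)) :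
    ∃ τ, IsCutoff τ ∧ coneSet K (tsupport τ) ⊆ G := by
  obtain ⟨δ, hδ, hsub⟩ := (hK.image continuous_ofReal).exists_thickening_subset_open
    (isOpen_interior (s := G)) (by
      rintro _ ⟨x, hx, rfl⟩
      exact mem_interior_iff_mem_nhds.2 (hG x hx))
  obtain ⟨B, hB⟩ := hK.exists_bound_of_continuousOn (f := fun x : ℝ => √(1 + x ^ 2))
    (by fun_prop)
  have hB1 : 0 < |B| + 1 := by positivity
  -- The outer radius makes `|im z| ≤ δ / 2` on the cone, since `⟨x⟩ ≤ |B| + 1` over `K`; the `+ 1`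
  -- keeps the denominator positive.
  let b : ContDiffBump (0 : ℝ) := ⟨δ / (4 * (|B| + 1)), δ / (2 * (|B| + 1)), by positivity, by
    apply div_lt_div_of_pos_left hδ (by positivity)
    linarith⟩
  refine ⟨b, ⟨b.contDiff, b.hasCompactSupport, b.eventuallyEq_one⟩, fun z hz => ?_⟩
  obtain ⟨h1, h2⟩ := hz
  rw [b.tsupport_eq, mem_closedBall_zero_iff] at h2
  apply interior_subset
  apply hsub
  rw [Metric.mem_thickening_iff]
  refine ⟨z.re, mem_image_of_mem _ h1, ?_⟩
  have h3 : dist z z.re = |z.im| := by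
    rw [dist_eq_norm]
    have : z - z.re = z.im * I := by
      linear_combination -(re_add_im z)
    rw [this]
    simp
  have h4 := zero_lt_one.trans_le (one_le_sqrt_one_add_sq z.re)
  rw [norm_div, Real.norm_eq_abs, Real.norm_of_nonneg h4.le, div_le_iff₀ h4] at h2
  rw [h3]
  have h5 : √(1 + z.re ^ 2) ≤ |B| := by
    have := hB _ h1
    rw [Real.norm_of_nonneg h4.le] at this
    exact this.trans (le_abs_self B)
  calc |z.im| ≤ δ / (2 * (|B| + 1)) * √(1 + z.re ^ 2) := h2
    _ ≤ δ / (2 * (|B| + 1)) * (|B| + 1) := by gcongr; linarith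
    _ = δ / 2 := by field_simp
    _ < δ := half_lt_self hδ

theorem contDiff_coneCutoff {τ : ℝ → ℝ} (hτ : ContDiff ℝ (⊤ : ℕ∞) τ) :
    ContDiff ℝ (⊤ : ℕ∞) (coneCutoff τ) := by
  have h1 : ContDiff ℝ (⊤ : ℕ∞) fun z : ℂ => √(1 + z.re ^ 2) :=
    ContDiff.sqrt (by
      have : ContDiff ℝ (⊤ : ℕ∞) fun z : ℂ => z.re := reCLM.contDiff
      fun_prop) fun z => by positivity
  have h2 : ContDiff ℝ (⊤ : ℕ∞) fun z : ℂ => z.im / √(1 + z.re ^ 2) :=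
    ContDiff.div (imCLM.contDiff) h1 fun z =>
      (zero_lt_one.trans_le (one_le_sqrt_one_add_sq _)).ne'
  exact ofRealCLM.contDiff.comp (hτ.comp h2)

theorem contDiff_iteratedDeriv {f : ℝ → ℂ} (hf : ContDiff ℝ (⊤ : ℕ∞) f) (k : ℕ) :
    ContDiff ℝ (⊤ : ℕ∞) (iteratedDeriv k f) := by
  rw [iteratedDeriv_eq_iterate]
  exact ContDiff.iterate_deriv k hf

theorem contDiff_taylorIm {f : ℝ → ℂ} (hf : ContDiff ℝ (⊤ : ℕ∞) f) (N : ℕ) :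
    ContDiff ℝ (⊤ : ℕ∞) (taylorIm f N) := by
  refine ContDiff.sum fun k _ => ?_
  have h1 : ContDiff ℝ (⊤ : ℕ∞) fun z : ℂ => iteratedDeriv k f z.re :=
    (contDiff_iteratedDeriv hf k).comp reCLM.contDiff
  have h2 : ContDiff ℝ (⊤ : ℕ∞) fun z : ℂ => (z.im : ℂ) := (ofRealCLM.comp imCLM).contDiff
  exact (h1.div_const _).mul ((contDiff_const.mul h2).pow k)

theorem contDiff_almostAnalytic {f : ℝ → ℂ} (hf : ContDiff ℝ (⊤ : ℕ∞) f) (N : ℕ) {τ : ℝ → ℝ}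
    (hτ : IsCutoff τ) : ContDiff ℝ (⊤ : ℕ∞) (almostAnalytic f N τ) :=
  (contDiff_taylorIm hf N).mul (contDiff_coneCutoff hτ.1)

theorem iteratedDeriv_eq_zero_of_notMem_tsupport {f : ℝ → ℂ} {x : ℝ} (hx : x ∉ tsupport f) (k : ℕ) :
    iteratedDeriv k f x = 0 := by
  rw [← norm_eq_zero, ← norm_iteratedFDeriv_eq_norm_iteratedDeriv, norm_eq_zero]
  by_contra h
  exact hx (support_iteratedFDeriv_subset k h)

theorem taylorIm_eq_zero {f : ℝ → ℂ} {z : ℂ} (hz : z.re ∉ tsupport f) (N : ℕ) :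
    taylorIm f N z = 0 :=
  Finset.sum_eq_zero fun k _ => by
    rw [iteratedDeriv_eq_zero_of_notMem_tsupport hz, zero_div, zero_mul]

theorem tsupport_coneCutoff {τ : ℝ → ℝ} :
    tsupport (coneCutoff τ) ⊆ {z | z.im / √(1 + z.re ^ 2) ∈ tsupport τ} :=
  closure_minimal (fun z hz => subset_tsupport τ fun h => hz (by simp [coneCutoff, h]))
    ((isClosed_tsupport τ).preimage continuous_slope)

theorem tsupport_almostAnalytic (f : ℝ → ℂ) (N : ℕ) (τ : ℝ → ℝ) :
    tsupport (almostAnalytic f N τ) ⊆ coneSet (tsupport f) (tsupport τ) := by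
  refine closure_minimal (fun z hz => ⟨?_, ?_⟩) (((isClosed_tsupport f).preimage continuous_re).inter
    ((isClosed_tsupport τ).preimage continuous_slope))
  · by_contra h
    exact hz (by simp [almostAnalytic_eq, taylorIm_eq_zero h])
  · exact subset_tsupport τ fun h => hz (by simp [almostAnalytic_eq, coneCutoff, h])

theorem hasCompactSupport_almostAnalytic {f : ℝ → ℂ} (hf : HasCompactSupport f) (N : ℕ) {τ : ℝ → ℝ}
    (hτ : IsCutoff τ) : HasCompactSupport (almostAnalytic f N τ) :=
  (isCompact_coneSet hf.isCompact hτ.2.1.isCompact).of_isClosed_subset (isClosed_tsupport _)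
    (tsupport_almostAnalytic f N τ)

theorem almostAnalytic_ofReal (f : ℝ → ℂ) (N : ℕ) {τ : ℝ → ℝ} (hτ : IsCutoff τ) (t : ℝ) :
    almostAnalytic f N τ t = f t := by
  have h1 : τ 0 = 1 := hτ.2.2.self_of_nhds
  rw [almostAnalytic_eq]
  dsimp only
  rw [coneCutoff, taylorIm, Finset.sum_eq_single 0]
  · simp [h1]
  · intro k _ hk
    simp [hk]
  · simp

/-- The sum telescopes: the `x`-derivative of each term cancels the `y`-derivative of the next, and
only the `x`-derivative of the last one survives. -/
theorem dbar_taylorIm {f : ℝ → ℂ} (hf : ContDiff ℝ (⊤ : ℕ∞) f) (N : ℕ) (z : ℂ) :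
    dbar (taylorIm f N) z =
      1 / 2 * (iteratedDeriv (N + 1) f z.re / (N.factorial : ℂ) * (I * (z.im : ℂ)) ^ N) := by
  have hterm (k : ℕ) : dbar (fun z : ℂ => iteratedDeriv k f z.re / (k.factorial : ℂ) *
      (I * (z.im : ℂ)) ^ k) z = 1 / 2 * (iteratedDeriv (k + 1) f z.re / (k.factorial : ℂ) *
      (I * (z.im : ℂ)) ^ k) - 1 / 2 * (iteratedDeriv k f z.re / (k.factorial : ℂ) *
        (k * (I * z.im) ^ (k - 1))) := by
    have h1 : Differentiable ℝ (iteratedDeriv k f) :=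
      (contDiff_iteratedDeriv hf k).differentiable (by simp)
    have h2 : DifferentiableAt ℝ (fun x => iteratedDeriv k f x / (k.factorial : ℂ)) z.re :=
      (h1 _).div_const _
    have h3 : DifferentiableAt ℝ (fun z : ℂ => iteratedDeriv k f z.re / (k.factorial : ℂ)) z :=
      DifferentiableAt.comp z h2 reCLM.differentiableAt
    have h4 : DifferentiableAt ℝ (fun z : ℂ => (I * (z.im : ℂ)) ^ k) z :=
      (((ofRealCLM.comp imCLM).differentiableAt).const_mul I).pow k
    rw [dbar_mul h3 h4, dbar_comp_re h2, dbar_I_mul_im_pow, deriv_div_const,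
      iteratedDeriv_succ]
    ring
  induction N with
  | zero =>
    have : taylorIm f 0 = fun z : ℂ => iteratedDeriv 0 f z.re / (Nat.factorial 0 : ℂ) *
      (I * (z.im : ℂ)) ^ 0 := by
      ext z; simp [taylorIm]
    rw [this, hterm]
    simp
  | succ N ih =>
    have : taylorIm f (N + 1) = fun z : ℂ => taylorIm f N z + iteratedDeriv (N + 1) f z.re /
      ((N + 1).factorial : ℂ) * (I * (z.im : ℂ)) ^ (N + 1) := by
      ext z; rw [taylorIm, Finset.sum_range_succ, taylorIm]
    have h5 : DifferentiableAt ℝ (fun z : ℂ => iteratedDeriv (N + 1) f z.re /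
      ((N + 1).factorial : ℂ) * (I * (z.im : ℂ)) ^ (N + 1)) z := by
      have h1 : Differentiable ℝ (iteratedDeriv (N + 1) f) :=
        (contDiff_iteratedDeriv hf _).differentiable (by simp)
      have h2 : DifferentiableAt ℝ (fun x => iteratedDeriv (N + 1) f x / ((N + 1).factorial : ℂ))
        z.re := (h1 _).div_const _
      have h3 : DifferentiableAt ℝ
          (fun z : ℂ => iteratedDeriv (N + 1) f z.re / ((N + 1).factorial : ℂ)) z :=
        DifferentiableAt.comp z h2 reCLM.differentiableAt
      exact h3.mul
        ((((ofRealCLM.comp imCLM).differentiableAt).const_mul I).pow _)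
    rw [this, dbar_add ((contDiff_taylorIm hf N).differentiable (by simp) z) h5, ih, hterm]
    have h6 : (N + 1 : ℂ) ≠ 0 := by exact_mod_cast N.succ_ne_zero
    have h7 : (N.factorial : ℂ) ≠ 0 := by exact_mod_cast N.factorial_ne_zero
    rw [Nat.factorial_succ, Nat.add_sub_cancel]
    push_cast
    field_simp
    ring

/-- In the product rule, the derivative of the Taylor sum carries `|im z| ^ N`, while the derivative
of the cut-off vanishes near the axis. The constant does not depend on `f`, as the continuity of the
resulting distributions requires. -/
theorem exists_dbar_almostAnalytic_le {K : Set ℝ} (hK : IsCompact K) (N : ℕ) {τ : ℝ → ℝ}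
    (hτ : IsCutoff τ) : ∃ C : ℝ, 0 ≤ C ∧ ∀ f : ℝ → ℂ, ContDiff ℝ (⊤ : ℕ∞) f → tsupport f ⊆ K →
      ∀ S : ℝ, (∀ k ≤ N + 1, ∀ x, ‖iteratedDeriv k f x‖ ≤ S) →
        ∀ z, ‖dbar (almostAnalytic f N τ) z‖ ≤ C * S * |z.im| ^ N := by
  have hT := contDiff_coneCutoff hτ.1
  have hTd : Continuous (dbar (coneCutoff τ)) := continuous_dbar (hT.of_le (by simp))
  have hcpt := isCompact_coneSet hK hτ.2.1.isCompact
  obtain ⟨D, hD⟩ := hcpt.exists_bound_of_continuousOn hTd.continuousOn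
  obtain ⟨B, hB⟩ := hcpt.exists_bound_of_continuousOn continuous_im.continuousOn
  obtain ⟨A, hA⟩ := hτ.2.1.exists_bound_of_continuous hτ.1.continuous
  obtain ⟨s, hs, hs1⟩ := Metric.eventually_nhds_iff.1 hτ.2.2
  have hA0 : 0 ≤ A := (norm_nonneg _).trans (hA 0)
  refine ⟨A + (∑ k ∈ Finset.range (N + 1), |B| ^ k) * |D| * (s⁻¹) ^ N, by positivity,
    fun f hf hfK S hS z => ?_⟩
  have hS0 : 0 ≤ S := (norm_nonneg _).trans (hS 0 (Nat.zero_le _) 0)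
  rw [almostAnalytic_eq, dbar_mul ((contDiff_taylorIm hf N).differentiable (by simp) z)
    (hT.differentiable (by simp) z), dbar_taylorIm hf]
  have hfac (k : ℕ) : (1 : ℝ) ≤ (k.factorial : ℝ) := by exact_mod_cast k.factorial_pos
  have hterm (k j : ℕ) (hk : k ≤ N + 1) : ‖iteratedDeriv k f z.re / (j.factorial : ℂ) *
      (I * (z.im : ℂ)) ^ j‖ ≤ S * |z.im| ^ j := by
    rw [norm_mul, norm_div, norm_pow, norm_mul, norm_I, one_mul, norm_real, Real.norm_eq_abs,
      Complex.norm_natCast]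
    gcongr
    exact (div_le_self (norm_nonneg _) (hfac j)).trans (hS k hk _)
  have h1 : ‖1 / 2 * (iteratedDeriv (N + 1) f z.re / (N.factorial : ℂ) * (I * (z.im : ℂ)) ^ N) *
      coneCutoff τ z‖ ≤ A * S * |z.im| ^ N := by
    rw [norm_mul, norm_mul]
    have h2 : ‖coneCutoff τ z‖ ≤ A := by
      rw [coneCutoff, norm_real]
      exact hA _
    have h3 := hterm (N + 1) N le_rfl
    have h4 : ‖(1 / 2 : ℂ)‖ ≤ 1 := by norm_num
    calc _ ≤ 1 * (S * |z.im| ^ N) * A := by gcongr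
      _ = _ := by ring
  have h2 : ‖taylorIm f N z * dbar (coneCutoff τ) z‖ ≤
      (∑ k ∈ Finset.range (N + 1), |B| ^ k) * |D| * (s⁻¹) ^ N * S * |z.im| ^ N := by
    have hnn : 0 ≤ (∑ k ∈ Finset.range (N + 1), |B| ^ k) * |D| * (s⁻¹) ^ N * S * |z.im| ^ N := by
      positivity
    by_cases hz : z ∈ coneSet K (tsupport τ)
    · rcases lt_or_ge |z.im| s with h | h
      -- As `⟨x⟩ ≥ 1`, the slope is below `s` too, and the cut-off is locally `1`.
      · have h5 : coneCutoff τ =ᶠ[𝓝 z] fun _ => 1 := by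
          have h6 : ∀ᶠ w : ℂ in 𝓝 z, |w.im| < s :=
            (continuous_im.abs.tendsto z).eventually_lt_const h
          filter_upwards [h6] with w hw
          have h7 := one_le_sqrt_one_add_sq w.re
          rw [coneCutoff, hs1, ofReal_one]
          rw [dist_zero_right, norm_div, Real.norm_eq_abs, Real.norm_of_nonneg (by positivity)]
          exact (div_le_self (abs_nonneg _) h7).trans_lt hw
        have h6 : dbar (coneCutoff τ) z = 0 := by
          simp [dbar, h5.fderiv_eq]
        rw [h6, mul_zero, norm_zero]
        exact hnn
      · have h5 : ‖taylorIm f N z‖ ≤ S * ∑ k ∈ Finset.range (N + 1), |B| ^ k := by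
          rw [taylorIm, Finset.mul_sum]
          refine (norm_sum_le _ _).trans (Finset.sum_le_sum fun k hk => ?_)
          exact (hterm k k (Finset.mem_range.1 hk).le).trans (mul_le_mul_of_nonneg_left
            (pow_le_pow_left₀ (abs_nonneg _) ((hB z hz).trans (le_abs_self B)) _) hS0)
        -- Away from the axis the missing power of `|im z|` costs only the constant `s⁻¹ ^ N`.
        have h6 : 1 ≤ (s⁻¹) ^ N * |z.im| ^ N := by
          rw [← mul_pow]
          apply one_le_pow₀
          rw [inv_mul_eq_div, one_le_div hs]
          exact h
        rw [norm_mul]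
        calc _ ≤ (S * ∑ k ∈ Finset.range (N + 1), |B| ^ k) * |D| := by
              gcongr
              exact (hD z hz).trans (le_abs_self D)
          _ ≤ (S * ∑ k ∈ Finset.range (N + 1), |B| ^ k) * |D| * ((s⁻¹) ^ N * |z.im| ^ N) :=
              le_mul_of_one_le_right (by positivity) h6
          _ = _ := by ring
    · have h5 : taylorIm f N z * dbar (coneCutoff τ) z = 0 := by
        by_cases h6 : z.re ∈ K
        · have h7 : z ∉ tsupport (coneCutoff τ) := fun h => hz ⟨h6, tsupport_coneCutoff h⟩
          rw [dbar_eq_zero_of_notMem h7, mul_zero]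
        · rw [taylorIm_eq_zero fun h => h6 (hfK h), zero_mul]
      rw [h5, norm_zero]
      exact hnn
  refine (norm_add_le _ _).trans ((add_le_add h1 h2).trans (le_of_eq (by ring)))

theorem exists_iteratedDeriv_bound {f : ℝ → ℂ} (hf : ContDiff ℝ (⊤ : ℕ∞) f)
    (hc : HasCompactSupport f) (n : ℕ) : ∃ S : ℝ, ∀ k ≤ n, ∀ x, ‖iteratedDeriv k f x‖ ≤ S := by
  have h (k : ℕ) : ∃ S : ℝ, ∀ x, ‖iteratedDeriv k f x‖ ≤ S := by
    refine HasCompactSupport.exists_bound_of_continuous (hc.mono' fun x hx => ?_)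
      (contDiff_iteratedDeriv hf k).continuous
    by_contra h
    exact hx (iteratedDeriv_eq_zero_of_notMem_tsupport h k)
  choose S hS using h
  refine ⟨∑ k ∈ Finset.range (n + 1), |S k|, fun k hk x => (hS k x).trans ((le_abs_self _).trans ?_)⟩
  exact Finset.single_le_sum (f := fun k => |S k|) (fun _ _ => abs_nonneg _)
    (Finset.mem_range.2 (Nat.lt_succ_of_le hk))

/-- The jump of `k` across the real axis, tested against a smooth function `f`, is given by any
almost analytic extension of `f`. -/
theorem tendsto_jump_almostAnalytic {F : Type*} [NormedAddCommGroup F] [NormedSpace ℂ F]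
    [CompleteSpace F] {f : ℝ → ℂ} (hf : ContDiff ℝ (⊤ : ℕ∞) f) (hc : HasCompactSupport f) {N : ℕ}
    {τ : ℝ → ℝ} (hτ : IsCutoff τ) {k : ℂ → F} {M : ℕ} (hNM : M ≤ N)
    (hk : ∀ p ∈ coneSet (tsupport f) (tsupport τ), ModerateAt k M p) :
    Integrable (fun z => dbar (almostAnalytic f N τ) z • k z) ∧
    (∀ᶠ ε : ℝ in 𝓝[>] 0, Integrable fun t : ℝ => f t • (k (t + ε * I) - k (t - ε * I))) ∧
    Tendsto (fun ε : ℝ => ∫ t : ℝ, f t • (k (t + ε * I) - k (t - ε * I))) (𝓝[>] 0)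
      (𝓝 ((2 * I) • ∫ z, dbar (almostAnalytic f N τ) z • k z)) := by
  have hc' := hasCompactSupport_almostAnalytic hc N hτ
  have h := tendsto_jump (U := almostAnalytic f N τ) (k := k) (M := M)
    ((contDiff_almostAnalytic hf N hτ).of_le (by simp)) hc'
    (fun p hp => hk p (tsupport_almostAnalytic f N τ hp)) (by
      obtain ⟨C, hC0, hC⟩ := exists_dbar_almostAnalytic_le hc.isCompact N hτ
      obtain ⟨S, hS⟩ := exists_iteratedDeriv_bound hf hc (N + 1)
      obtain ⟨B, hB⟩ := hc'.isCompact.exists_bound_of_continuousOn continuous_im.continuousOn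
      have hS0 : 0 ≤ S := (norm_nonneg _).trans (hS 0 (Nat.zero_le _) 0)
      -- The `N - M` surplus powers of `|im z|` are bounded on the compact support.
      refine ⟨C * S * |B| ^ (N - M), fun z => ?_⟩
      by_cases hz : z ∈ tsupport (almostAnalytic f N τ)
      · refine (hC f hf subset_rfl S hS z).trans ?_
        have h1 : |z.im| ≤ |B| := (hB z hz).trans (le_abs_self B)
        calc C * S * |z.im| ^ N = C * S * |z.im| ^ (N - M) * |z.im| ^ M := by
              rw [mul_assoc _ (_ ^ _) (_ ^ _), ← pow_add, Nat.sub_add_cancel hNM]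
          _ ≤ _ := by gcongr
      · rw [dbar_eq_zero_of_notMem hz, norm_zero]
        positivity)
  simpa only [almostAnalytic_ofReal f N hτ] using h

end AlmostAnalytic

/-! ### The functional calculus of an operator with resolvent of moderate growth -/

section Calculus

open Complex MeasureTheory Filter Set

/-- The limit of the jump of `k` across the real axis, tested against `f`, is controlled by finitely
many derivatives of `f`. -/
theorem exists_jump_bound {k : ℂ → ℂ} {M : ℕ} {K : Set ℝ} (hK : IsCompact K)
    (hk : ∀ x ∈ K, ModerateAt k M (x : ℂ)) :
    ∃ C : ℝ, 0 ≤ C ∧ ∀ f : ℝ → ℂ, ContDiff ℝ (⊤ : ℕ∞) f → tsupport f ⊆ K →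
      ∀ S : ℝ, (∀ j ≤ M + 2, ∀ x, ‖iteratedDeriv j f x‖ ≤ S) →
        (∀ᶠ ε : ℝ in 𝓝[>] 0, Integrable fun t : ℝ => f t • (k (t + ε * I) - k (t - ε * I))) ∧
        ∃ L : ℂ, ‖L‖ ≤ C * S ∧ Tendsto
          (fun ε : ℝ => ∫ t : ℝ, f t • (k (t + ε * I) - k (t - ε * I))) (𝓝[>] 0) (𝓝 L) := by
  obtain ⟨τ, hτ, hsub⟩ := exists_cutoff hK (G := {p | ModerateAt k M p})
    fun x hx => (hk x hx).eventually
  have hcpt := isCompact_coneSet hK hτ.2.1.isCompact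
  obtain ⟨δ, hδ, C₂, hC₂, h2⟩ := exists_uniform_moderate hcpt hsub
  -- Order `M + 1` rather than `M` makes `dbar` vanish on the real axis even for `M = 0`, where
  -- nothing is known about `k`. Its derivative bound then involves orders up to `M + 2`.
  obtain ⟨C, hC, h1⟩ := exists_dbar_almostAnalytic_le hK (M + 1) hτ
  obtain ⟨B, hB⟩ := hcpt.exists_bound_of_continuousOn continuous_im.continuousOn
  refine ⟨2 * (C * |B| * C₂ * volume.real (coneSet K (tsupport τ))), by positivity,
    fun f hf hfK S hS => ?_⟩
  have hS0 : 0 ≤ S := (norm_nonneg _).trans (hS 0 (Nat.zero_le _) 0)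
  have hcone : coneSet (tsupport f) (tsupport τ) ⊆ coneSet K (tsupport τ) :=
    fun z hz => ⟨hfK hz.1, hz.2⟩
  have hc : HasCompactSupport f := hK.of_isClosed_subset (isClosed_tsupport f) hfK
  have h3 := tendsto_jump_almostAnalytic hf hc hτ (Nat.le_succ M) fun p hp => hsub (hcone hp)
  refine ⟨h3.2.1, _, ?_, h3.2.2⟩
  rw [smul_eq_mul, norm_mul, norm_mul, norm_I, mul_one, RCLike.norm_ofNat, mul_assoc]
  refine mul_le_mul_of_nonneg_left ?_ zero_le_two
  rw [← setIntegral_eq_integral_of_forall_compl_eq_zero (s := coneSet K (tsupport τ))]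
  · refine (norm_setIntegral_le_of_norm_le_const (C := C * |B| * C₂ * S)
      hcpt.measure_lt_top fun z hz => ?_).trans (le_of_eq (by ring))
    rw [smul_eq_mul, norm_mul]
    have h4 := h1 f hf hfK S hS z
    rcases eq_or_ne z.im 0 with h0 | h0
    · rw [h0, abs_zero, zero_pow (Nat.succ_ne_zero M), mul_zero] at h4
      rw [le_antisymm h4 (norm_nonneg _), zero_mul]
      positivity
    · have h5 := (h2 z hz z (by simpa using hδ) h0).2
      have h6 : |z.im| ≤ |B| := (hB z hz).trans (le_abs_self B)
      calc _ ≤ C * S * |z.im| ^ (M + 1) * ‖k z‖ := by gcongr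
        _ = C * S * |z.im| * (‖k z‖ * |z.im| ^ M) := by ring
        _ ≤ C * S * |B| * C₂ :=
          mul_le_mul (mul_le_mul_of_nonneg_left h6 (by positivity)) h5 (by positivity)
            (by positivity)
        _ = _ := by ring
  · intro z hz
    rw [dbar_eq_zero_of_notMem fun h => hz (hcone (tsupport_almostAnalytic f _ τ h)), zero_smul]

variable {E : Type*} [NormedAddCommGroup E] [InnerProductSpace ℂ E]

/-- Near `p` and off the real axis, the resolvent of `X` exists and is `O(|im z|⁻ᴹ)`. -/
def ResolventModerateAt (X : E →L[ℂ] E) (M : ℕ) (p : ℂ) : Prop :=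
  ∃ C : ℝ, ∀ᶠ z in 𝓝 p, z.im ≠ 0 → IsUnit (X - algebraMap ℂ _ z) ∧
    ‖Ring.inverse (X - algebraMap ℂ _ z)‖ * |z.im| ^ M ≤ C

theorem ResolventModerateAt.eventually {X : E →L[ℂ] E} {M : ℕ} {p : ℂ}
    (h : ResolventModerateAt X M p) : ∀ᶠ q in 𝓝 p, ResolventModerateAt X M q := by
  obtain ⟨C, hC⟩ := h
  exact hC.eventually_nhds.mono fun q hq => ⟨C, hq⟩

theorem ResolventModerateAt.isUnit {X : E →L[ℂ] E} {M : ℕ} {p : ℂ}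
    (h : ResolventModerateAt X M p) (hp : p.im ≠ 0) : IsUnit (X - algebraMap ℂ _ p) := by
  obtain ⟨C, hC⟩ := h
  exact (hC.self_of_nhds hp).1

theorem isUnit_sub_algebraMap_iff {X : E →L[ℂ] E} {p : ℂ} :
    IsUnit (X - algebraMap ℂ _ p) ↔ p ∉ spectrum ℂ X := by
  rw [spectrum.notMem_iff, IsUnit.sub_iff]

/-- Moderate growth excludes non-real spectrum near the support of `f`, and a narrow cone stays in
that neighbourhood. -/
theorem exists_admissible_cutoff {X : E →L[ℂ] E} {M : ℕ} {f : ℝ → ℂ} (hc : HasCompactSupport f)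
    (hX : ∀ x ∈ tsupport f, ResolventModerateAt X M (x : ℂ)) : ∃ τ, IsAdmissibleCutoff X f τ := by
  obtain ⟨τ, hτ, hsub⟩ := exists_cutoff hc.isCompact (G := {p | ResolventModerateAt X M p})
    fun x hx => (hX x hx).eventually
  exact ⟨τ, isAdmissibleCutoff_iff.2 ⟨hτ, fun z hz hne =>
    isUnit_sub_algebraMap_iff.1 (ResolventModerateAt.isUnit (hsub hz) hne)⟩⟩

variable [CompleteSpace E]

theorem differentiableAt_resolvent {X : E →L[ℂ] E} {p : ℂ} (h : IsUnit (X - algebraMap ℂ _ p)) :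
    DifferentiableAt ℂ (fun z => Ring.inverse (X - algebraMap ℂ _ z)) p := by
  have h1 : DifferentiableAt ℂ (Ring.inverse : (E →L[ℂ] E) → _) (X - algebraMap ℂ _ p) :=
    differentiableAt_inverse h
  have h2 : DifferentiableAt ℂ (fun z : ℂ => X - algebraMap ℂ (E →L[ℂ] E) z) p :=
    (differentiableAt_const X).sub (algebraMapCLM ℂ (E →L[ℂ] E)).differentiableAt
  exact DifferentiableAt.comp p h1 h2

theorem ResolventModerateAt.moderateAt {X : E →L[ℂ] E} {M : ℕ} {p : ℂ}
    (h : ResolventModerateAt X M p) :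
    ModerateAt (fun z => Ring.inverse (X - algebraMap ℂ _ z)) M p := by
  obtain ⟨C, hC⟩ := h
  exact ⟨C, hC.mono fun z hz hne => ⟨differentiableAt_resolvent (hz hne).1, (hz hne).2⟩⟩

/-- At a point of the resolvent set the resolvent is locally bounded, so any exponent will do. -/
theorem resolventModerateAt_of_isUnit {X : E →L[ℂ] E} {p : ℂ} (h : IsUnit (X - algebraMap ℂ _ p))
    (M : ℕ) : ResolventModerateAt X M p := by
  have h1 : ContinuousAt (fun z : ℂ => ‖Ring.inverse (X - algebraMap ℂ _ z)‖ * |z.im| ^ M) p :=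
    (differentiableAt_resolvent h).continuousAt.norm.mul
      (continuous_im.abs.pow M).continuousAt
  have h2 : ∀ᶠ z : ℂ in 𝓝 p, IsUnit (X - algebraMap ℂ (E →L[ℂ] E) z) := by
    have h3 : Continuous fun z : ℂ => X - algebraMap ℂ (E →L[ℂ] E) z :=
      continuous_const.sub (algebraMapCLM ℂ (E →L[ℂ] E)).continuous
    exact h3.continuousAt.eventually (Units.isOpen.mem_nhds h)
  refine ⟨‖Ring.inverse (X - algebraMap ℂ _ p)‖ * |p.im| ^ M + 1, ?_⟩
  filter_upwards [h2, h1.eventually_lt_const (lt_add_one _)] with z hz hz' _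
  exact ⟨hz, hz'.le⟩

/-- Real points of the cone are covered by the assumption on `X`, non-real ones lie in the resolvent
set by admissibility. Hence arbitrary admissible cut-offs, not only narrow ones, are allowed. -/
theorem IsAdmissibleCutoff.resolventModerateAt {X : E →L[ℂ] E} {M : ℕ} {f : ℝ → ℂ} {τ : ℝ → ℝ}
    (h : IsAdmissibleCutoff X f τ) (hX : ∀ x ∈ tsupport f, ResolventModerateAt X M (x : ℂ)) :
    ∀ p ∈ coneSet (tsupport f) (tsupport τ), ResolventModerateAt X M p := fun p hp => by
  rcases eq_or_ne p.im 0 with h0 | h0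
  · have : p = (p.re : ℂ) := Complex.ext (by simp) (by simp [h0])
    rw [this]
    exact hX _ hp.1
  · exact resolventModerateAt_of_isUnit
      (isUnit_sub_algebraMap_iff.2 ((isAdmissibleCutoff_iff.1 h).2 p hp h0)) M

/-- The Helffer–Sjöstrand calculus is well defined. -/
theorem exists_isFunctionOf {X : E →L[ℂ] E} {M : ℕ} {f : ℝ → ℂ} (hf : ContDiff ℝ (⊤ : ℕ∞) f)
    (hc : HasCompactSupport f) (hX : ∀ x ∈ tsupport f, ResolventModerateAt X M (x : ℂ)) :
    ∃ B, IsFunctionOf X f B := by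
  obtain ⟨τ₀, hτ₀⟩ := exists_admissible_cutoff hc hX
  have key (N : ℕ) (hN : N ≥ M) (τ : ℝ → ℝ) (hτ : IsAdmissibleCutoff X f τ) :=
    tendsto_jump_almostAnalytic hf hc (isAdmissibleCutoff_iff.1 hτ).1 hN
      (k := fun z => Ring.inverse (X - algebraMap ℂ _ z))
      fun p hp => (hτ.resolventModerateAt hX p hp).moderateAt
  refine ⟨(Real.pi : ℂ)⁻¹ • ∫ z : ℂ, dbar (almostAnalytic f M τ₀) z •
    Ring.inverse (X - algebraMap ℂ _ z), ⟨τ₀, hτ₀⟩, M, fun N hN τ hτ => ⟨(key N hN τ hτ).1, ?_⟩⟩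
  -- Both integrals are, up to the factor `2i`, limits of the same jumps tested against `f`. This is
  -- the independence of `N` and `τ`.
  have h := tendsto_nhds_unique (key M le_rfl τ₀ hτ₀).2.2 (key N hN τ hτ).2.2
  rw [smul_right_injective _ (mul_ne_zero two_ne_zero I_ne_zero) h]

/-! ### The trace of the difference of the functions of two operators -/

/-- `(X - z)⁻¹ - (X₀ - z)⁻¹ = -(X - z)⁻¹ (X - X₀) (X₀ - z)⁻¹` as a trace class operator, where
`D = X - X₀`. -/
def resDiff (X X₀ : E →L[ℂ] E) (D : Nuc E) (z : ℂ) : Nuc E :=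
  -Nuc.lmul E (Ring.inverse (X - algebraMap ℂ _ z))
    (Nuc.rmul E (Ring.inverse (X₀ - algebraMap ℂ _ z)) D)

theorem val_resDiff {X X₀ : E →L[ℂ] E} {D : Nuc E} (hD : Nuc.val E D = X - X₀) {z : ℂ}
    (h : IsUnit (X - algebraMap ℂ _ z)) (h₀ : IsUnit (X₀ - algebraMap ℂ _ z)) :
    Nuc.val E (resDiff X X₀ D z) =
      Ring.inverse (X - algebraMap ℂ _ z) - Ring.inverse (X₀ - algebraMap ℂ _ z) := by
  rw [resDiff, map_neg, Nuc.val_lmul, Nuc.val_rmul, hD]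
  have h1 := Ring.inverse_mul_cancel _ h
  have h2 := Ring.mul_inverse_cancel _ h₀
  set R := Ring.inverse (X - algebraMap ℂ _ z)
  set R₀ := Ring.inverse (X₀ - algebraMap ℂ _ z)
  have h3 : X - X₀ = (X - algebraMap ℂ _ z) - (X₀ - algebraMap ℂ _ z) := by abel
  rw [h3, sub_mul, mul_sub, h2, mul_one, ← mul_assoc, h1, one_mul]
  abel

theorem differentiableAt_resDiff {X X₀ : E →L[ℂ] E} (D : Nuc E) {z : ℂ}
    (h : IsUnit (X - algebraMap ℂ _ z)) (h₀ : IsUnit (X₀ - algebraMap ℂ _ z)) :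
    DifferentiableAt ℂ (resDiff X X₀ D) z := by
  have h5 : DifferentiableAt ℂ (fun z => Nuc.lmul E (Ring.inverse (X - algebraMap ℂ _ z))) z :=
    (Nuc.lmul E).differentiableAt.comp z (differentiableAt_resolvent h)
  have h6 : DifferentiableAt ℂ (fun z => Nuc.rmul E (Ring.inverse (X₀ - algebraMap ℂ _ z))) z :=
    (Nuc.rmul E).differentiableAt.comp z (differentiableAt_resolvent h₀)
  exact (h5.clm_apply (h6.clm_apply (differentiableAt_const D))).neg

theorem norm_resDiff_mul_pow_le {X X₀ : E →L[ℂ] E} (D : Nuc E) {z : ℂ} {M M₀ : ℕ} {y C C₀ : ℝ}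
    (hy : 0 ≤ y) (h : ‖Ring.inverse (X - algebraMap ℂ _ z)‖ * y ^ M ≤ C)
    (h₀ : ‖Ring.inverse (X₀ - algebraMap ℂ _ z)‖ * y ^ M₀ ≤ C₀) :
    ‖resDiff X X₀ D z‖ * y ^ (M + M₀) ≤ |C| * ‖D‖ * |C₀| := by
  have h5 := Nuc.norm_le_mul_mul (T := D) (S := Nuc.lmul E (Ring.inverse (X - algebraMap ℂ _ z))
    (Nuc.rmul E (Ring.inverse (X₀ - algebraMap ℂ _ z)) D))
    (A := Ring.inverse (X - algebraMap ℂ _ z)) (B := Ring.inverse (X₀ - algebraMap ℂ _ z))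
    (by simp [mul_assoc])
  rw [resDiff, norm_neg]
  calc _ ≤ ‖Ring.inverse (X - algebraMap ℂ _ z)‖ * ‖D‖ *
        ‖Ring.inverse (X₀ - algebraMap ℂ _ z)‖ * y ^ (M + M₀) := by gcongr
    _ = (‖Ring.inverse (X - algebraMap ℂ _ z)‖ * y ^ M) * ‖D‖ *
        (‖Ring.inverse (X₀ - algebraMap ℂ _ z)‖ * y ^ M₀) := by ring
    _ ≤ |C| * ‖D‖ * |C₀| := by
      gcongr
      · exact h.trans (le_abs_self C)
      · exact h₀.trans (le_abs_self C₀)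

/-- One resolvent stands on each side of the fixed trace class operator `D`, so the two growth
exponents add. -/
theorem moderateAt_resDiff {X X₀ : E →L[ℂ] E} (D : Nuc E) {M M₀ : ℕ} {p : ℂ}
    (h : ResolventModerateAt X M p) (h₀ : ResolventModerateAt X₀ M₀ p) :
    ModerateAt (resDiff X X₀ D) (M + M₀) p := by
  obtain ⟨C, hC⟩ := h
  obtain ⟨C₀, hC₀⟩ := h₀
  refine ⟨|C| * ‖D‖ * |C₀|, ?_⟩
  filter_upwards [hC, hC₀] with z hz hz₀ hne
  obtain ⟨h1, h2⟩ := hz hne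
  obtain ⟨h3, h4⟩ := hz₀ hne
  exact ⟨differentiableAt_resDiff D h1 h3, norm_resDiff_mul_pow_le D (abs_nonneg _) h2 h4⟩

/-- Identities between resolvents are available only off the real axis; a null set does not affect
the area integrals. -/
theorem ae_im_ne_zero : ∀ᵐ z : ℂ, z.im ≠ 0 := by
  have h5 : {z : ℂ | ¬ z.im ≠ 0} = measurableEquivRealProd ⁻¹' (univ ×ˢ {0}) := by
    ext z
    simp [measurableEquivRealProd_apply]
  rw [ae_iff, h5, volume_preserving_equiv_real_prod.measure_preimage
    (MeasurableSet.univ.prod (measurableSet_singleton _)).nullMeasurableSet,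
    Measure.volume_eq_prod, Measure.prod_prod]
  simp

theorem ModerateAt.clm_comp {F G : Type*} [NormedAddCommGroup F] [NormedSpace ℂ F]
    [NormedAddCommGroup G] [NormedSpace ℂ G] {k : ℂ → F} {M : ℕ} {p : ℂ} (h : ModerateAt k M p)
    (L : F →L[ℂ] G) : ModerateAt (fun z => L (k z)) M p := by
  obtain ⟨C, hC⟩ := h
  refine ⟨‖L‖ * C, hC.mono fun z hz hne => ⟨L.differentiableAt.comp z (hz hne).1, ?_⟩⟩
  calc _ ≤ ‖L‖ * ‖k z‖ * |z.im| ^ M := by gcongr; exact L.le_opNorm _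
    _ = ‖L‖ * (‖k z‖ * |z.im| ^ M) := by ring
    _ ≤ _ := by gcongr; exact (hz hne).2

/-- The trace of `f(X) - f(X₀)`. -/
theorem trace_isFunctionOf_sub {X X₀ : E →L[ℂ] E} {D : Nuc E} (hD : Nuc.val E D = X - X₀) {M M₀ : ℕ}
    {f : ℝ → ℂ} (hf : ContDiff ℝ (⊤ : ℕ∞) f) (hc : HasCompactSupport f) {B B₀ : E →L[ℂ] E}
    (hB : IsFunctionOf X f B) (hB₀ : IsFunctionOf X₀ f B₀) :
    ∃ N₀, ∀ N ≥ N₀, ∀ τ, IsCutoff τ →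
      (∀ p ∈ coneSet (tsupport f) (tsupport τ), ResolventModerateAt X M p) →
      (∀ p ∈ coneSet (tsupport f) (tsupport τ), ResolventModerateAt X₀ M₀ p) →
      IsTraceClass (B - B₀) ∧
        trace (B - B₀) = (Real.pi : ℂ)⁻¹ * ∫ z : ℂ, dbar (almostAnalytic f N τ) z *
          Nuc.tr E (resDiff X X₀ D z) := by
  obtain ⟨-, N₁, h1⟩ := hB
  obtain ⟨-, N₂, h2⟩ := hB₀
  refine ⟨max (max N₁ N₂) (M + M₀), fun N hN τ hτ hX hX₀ => ?_⟩
  have hN1 : N₁ ≤ N := (le_max_left _ _).trans ((le_max_left _ _).trans hN)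
  have hN2 : N₂ ≤ N := (le_max_right _ _).trans ((le_max_left _ _).trans hN)
  obtain ⟨i1, e1⟩ := h1 N hN1 τ (isAdmissibleCutoff_iff.2
    ⟨hτ, fun z hz hne => isUnit_sub_algebraMap_iff.1 ((hX z hz).isUnit hne)⟩)
  obtain ⟨i2, e2⟩ := h2 N hN2 τ (isAdmissibleCutoff_iff.2
    ⟨hτ, fun z hz hne => isUnit_sub_algebraMap_iff.1 ((hX₀ z hz).isUnit hne)⟩)
  have hint := (tendsto_jump_almostAnalytic hf hc hτ ((le_max_right _ _).trans hN)
    fun p hp => moderateAt_resDiff D (hX p hp) (hX₀ p hp)).1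
  -- The integral is taken in trace norm; the embedding into bounded operators commutes with it and
  -- identifies its value as `B - B₀`.
  have hval : Nuc.val E ((Real.pi : ℂ)⁻¹ • ∫ z : ℂ, dbar (almostAnalytic f N τ) z •
      resDiff X X₀ D z) = B - B₀ := by
    rw [map_smul, ← ContinuousLinearMap.integral_comp_comm _ hint, e1, e2, ← smul_sub,
      ← integral_sub i1 i2]
    congr 1
    refine integral_congr_ae (ae_im_ne_zero.mono fun z hz => ?_)
    dsimp only
    by_cases h : z ∈ coneSet (tsupport f) (tsupport τ)
    · rw [map_smul, val_resDiff hD ((hX z h).isUnit hz) ((hX₀ z h).isUnit hz), smul_sub]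
    · rw [dbar_eq_zero_of_notMem fun h' => h (tsupport_almostAnalytic f N τ h')]
      simp
  refine ⟨hval ▸ Nuc.isTraceClass _, ?_⟩
  rw [← hval, ← Nuc.tr_apply, map_smul, ← ContinuousLinearMap.integral_comp_comm _ hint]
  simp only [map_smul, smul_eq_mul]

/-- The trace of `f(X) - f(X₀)` as the limit of a jump across the real axis. -/
theorem tendsto_trace_isFunctionOf_sub {X X₀ : E →L[ℂ] E} {D : Nuc E}
    (hD : Nuc.val E D = X - X₀) {M M₀ : ℕ}
    {f : ℝ → ℂ} (hf : ContDiff ℝ (⊤ : ℕ∞) f) (hc : HasCompactSupport f)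
    (hX : ∀ x ∈ tsupport f, ResolventModerateAt X M (x : ℂ))
    (hX₀ : ∀ x ∈ tsupport f, ResolventModerateAt X₀ M₀ (x : ℂ)) {B B₀ : E →L[ℂ] E}
    (hB : IsFunctionOf X f B) (hB₀ : IsFunctionOf X₀ f B₀) :
    IsTraceClass (B - B₀) ∧
      Tendsto (fun ε : ℝ => ∫ t : ℝ, f t • (Nuc.tr E (resDiff X X₀ D (t + ε * I)) -
        Nuc.tr E (resDiff X X₀ D (t - ε * I)))) (𝓝[>] 0)
        (𝓝 (2 * Real.pi * I * trace (B - B₀))) := by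
  obtain ⟨τ, hτ, hsub⟩ := exists_cutoff hc.isCompact
    (G := {p | ResolventModerateAt X M p ∧ ResolventModerateAt X₀ M₀ p})
    fun x hx => (hX x hx).eventually.and (hX₀ x hx).eventually
  obtain ⟨N₀, h⟩ := trace_isFunctionOf_sub hD (M := M) (M₀ := M₀) hf hc hB hB₀
  obtain ⟨h1, h2⟩ := h (max N₀ (M + M₀)) (le_max_left _ _) τ hτ (fun p hp => (hsub hp).1)
    fun p hp => (hsub hp).2
  refine ⟨h1, ?_⟩
  have h3 := (tendsto_jump_almostAnalytic hf hc hτ (le_max_right N₀ (M + M₀))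
    fun p hp => (moderateAt_resDiff D (hsub hp).1 (hsub hp).2).clm_comp (Nuc.tr E)).2.2
  convert h3 using 2
  rw [h2]
  have := Real.pi_ne_zero
  simp only [smul_eq_mul]
  field_simp

end Calculus

/-! ### Resolvents of unbounded operators -/

section Resolvent

open Complex Filter Set

variable {E : Type*} [NormedAddCommGroup E] [InnerProductSpace ℂ E]

/-- The first resolvent identity: evaluate `R (A - z)` on `S u`. -/
theorem IsResolventAt.sub_eq {A : E →ₗ.[ℂ] E} {z w : ℂ} {R S : E →L[ℂ] E}
    (hR : IsResolventAt A z R) (hS : IsResolventAt A w S) : R - S = (z - w) • (R * S) := by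
  ext u
  obtain ⟨hu, e⟩ := hS.1 u
  have h := hR.2 ⟨S u, hu⟩
  have e2 : A ⟨S u, hu⟩ - z • S u = u - (z - w) • S u := by
    linear_combination (norm := module) e
  simp only [e2, map_sub, map_smul] at h
  simp only [sub_apply, smul_apply]
  rw [sub_eq_iff_eq_add, ← sub_eq_iff_eq_add']
  exact h

/-- `1 - (z - w) (A - w)⁻¹` is invertible when `z ∈ ρ(A)`, with inverse `1 + (z - w) (A - z)⁻¹`. -/
theorem one_sub_smul_mul_eq_one {A : E →ₗ.[ℂ] E} {z w : ℂ} {R S : E →L[ℂ] E}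
    (hR : IsResolventAt A z R) (hS : IsResolventAt A w S) :
    (1 - (z - w) • S) * (1 + (z - w) • R) = 1 ∧ (1 + (z - w) • R) * (1 - (z - w) • S) = 1 := by
  have h1 := hR.sub_eq hS
  have h2 := hS.sub_eq hR
  have h3 : R - S = (z - w) • (S * R) := by
    rw [← neg_sub S R, h2, ← neg_smul, neg_sub]
  constructor
  · calc _ = 1 + (z - w) • (R - S - (z - w) • (S * R)) := by
          simp only [sub_mul, mul_add, one_mul, mul_one, smul_mul_assoc, mul_smul_comm]
          module
      _ = 1 := by rw [h3]; simp
  · calc _ = 1 + (z - w) • (R - S - (z - w) • (R * S)) := by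
          simp only [mul_sub, add_mul, one_mul, mul_one, smul_mul_assoc, mul_smul_comm]
          module
      _ = 1 := by rw [h1]; simp

variable {A : E →ₗ.[ℂ] E} {c : ℝ} {z : ℂ}

theorem isUnit_one_sub_smul (hc : (-c : ℂ) ∈ rho A) (hz : z ∈ rho A) :
    IsUnit (1 - (z + c) • res A (-c)) := by
  have h := one_sub_smul_mul_eq_one (res_spec hz) (res_spec hc)
  rw [sub_neg_eq_add] at h
  exact ⟨⟨_, _, h.1, h.2⟩, rfl⟩

theorem inverse_one_sub_smul (hc : (-c : ℂ) ∈ rho A) (hz : z ∈ rho A) :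
    Ring.inverse (1 - (z + c) • res A (-c)) = 1 + (z + c) • res A z := by
  have h := one_sub_smul_mul_eq_one (res_spec hz) (res_spec hc)
  rw [sub_neg_eq_add] at h
  exact Ring.inverse_unit ⟨_, _, h.1, h.2⟩

/-- The resolvent identity between `z` and `-c`. It reduces all resolvents of the unbounded operator
to functions of the single bounded operator `res A (-c)`. -/
theorem res_eq_mul_inverse (hc : (-c : ℂ) ∈ rho A) (hz : z ∈ rho A) :
    res A z = res A (-c) * Ring.inverse (1 - (z + c) • res A (-c)) := by
  have h := (res_spec hc).sub_eq (res_spec hz)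
  rw [inverse_one_sub_smul hc hz, mul_add, mul_one, mul_smul_comm]
  linear_combination (norm := module) (-1 : ℂ) • h

/-! ### Self-adjoint operators -/

variable [CompleteSpace E]

theorem inner_symm_of_isSelfAdjoint (hA : IsSelfAdjoint A) (x y : A.domain) :
    ⟪A x, (y : E)⟫_ℂ = ⟪(x : E), A y⟫_ℂ := by
  have h := LinearPMap.adjoint_isFormalAdjoint hA.dense_domain
  rw [LinearPMap.isSelfAdjoint_def.1 hA] at h
  exact h x y

/-- By symmetry `⟪u, A u⟫` is real, so the imaginary part of `⟪u, (A - z) u⟫` is `-z.im ‖u‖²`;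
Cauchy–Schwarz does the rest. -/
theorem abs_im_mul_norm_le (hA : IsSelfAdjoint A) (z : ℂ) (u : A.domain) :
    |z.im| * ‖(u : E)‖ ≤ ‖A u - z • (u : E)‖ := by
  have h1 : (⟪(u : E), A u⟫_ℂ).im = 0 := by
    have h2 := inner_conj_symm (𝕜 := ℂ) (u : E) (A u)
    rw [inner_symm_of_isSelfAdjoint hA] at h2
    exact Complex.conj_eq_iff_im.1 h2
  have h2 : (⟪(u : E), A u - z • (u : E)⟫_ℂ).im = -(z.im * ‖(u : E)‖ ^ 2) := by
    rw [inner_sub_right, inner_smul_right, inner_self_eq_norm_sq_to_K, sub_im, h1, mul_im]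
    change 0 - (z.re * ((‖(u : E)‖ : ℂ) ^ 2).im + z.im * ((‖(u : E)‖ : ℂ) ^ 2).re) = _
    rw [← ofReal_pow, ofReal_re, ofReal_im]
    ring
  have h3 : |z.im| * ‖(u : E)‖ ^ 2 ≤ ‖(u : E)‖ * ‖A u - z • (u : E)‖ := by
    calc |z.im| * ‖(u : E)‖ ^ 2 = |(⟪(u : E), A u - z • (u : E)⟫_ℂ).im| := by
          rw [h2, abs_neg, abs_mul, abs_of_nonneg (sq_nonneg ‖(u : E)‖)]
      _ ≤ ‖⟪(u : E), A u - z • (u : E)⟫_ℂ‖ := abs_im_le_norm _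
      _ ≤ _ := norm_inner_le_norm _ _
  rcases eq_or_lt_of_le (norm_nonneg (u : E)) with h | h
  · rw [← h, mul_zero]
    exact norm_nonneg _
  · refine le_of_mul_le_mul_left ?_ h
    calc _ = |z.im| * ‖(u : E)‖ ^ 2 := by ring
      _ ≤ _ := h3

/-- Non-real numbers belong to the resolvent set of a self-adjoint operator. -/
theorem exists_resolvent_of_isSelfAdjoint (hA : IsSelfAdjoint A) (hz : z.im ≠ 0) :
    ∃ R : E →L[ℂ] E, IsResolventAt A z R ∧ ‖R‖ ≤ |z.im|⁻¹ := by
  have hz0 : 0 < |z.im| := abs_pos.2 hz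
  let T : A.domain →ₗ[ℂ] E := A.toFun - z • A.domain.subtype
  have hT : ∀ u, T u = A u - z • (u : E) := fun u => rfl
  have hbound : ∀ u : A.domain, |z.im| * ‖(u : E)‖ ≤ ‖T u‖ := abs_im_mul_norm_le hA z
  have hinj : Function.Injective T := by
    rw [← LinearMap.ker_eq_bot, LinearMap.ker_eq_bot']
    intro u hu
    have h := hbound u
    rw [hu, norm_zero] at h
    have h2 : ‖(u : E)‖ ≤ 0 := by
      by_contra! h3
      exact absurd h (not_le.2 (mul_pos hz0 h3))
    exact Subtype.ext (norm_le_zero_iff.1 h2)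
  -- The lower bound makes preimages of a convergent sequence Cauchy, and the graph of a
  -- self-adjoint operator is closed.
  have hclosed : IsClosed (LinearMap.range T : Set E) := by
    rw [← isSeqClosed_iff_isClosed]
    intro x v hx hv
    choose u hu using hx
    have hcau : CauchySeq fun n => (u n : E) := by
      rw [Metric.cauchySeq_iff']
      intro ε hε
      obtain ⟨N, hN⟩ := Metric.cauchySeq_iff'.1 hv.cauchySeq (ε * |z.im|) (by positivity)
      refine ⟨N, fun n hn => ?_⟩
      have h1 := hN n hn
      have h2 := hbound (u n - u N)
      rw [map_sub, hu, hu, ← dist_eq_norm] at h2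
      rw [dist_eq_norm]
      have h3 : |z.im| * ‖(u n : E) - u N‖ < |z.im| * ε := by
        rw [mul_comm _ ε]
        exact h2.trans_lt h1
      exact lt_of_mul_lt_mul_left h3 hz0.le
    obtain ⟨w, hw⟩ := cauchySeq_tendsto_of_complete hcau
    have hAu : Tendsto (fun n => A (u n)) atTop (𝓝 (v + z • w)) := by
      have : (fun n => A (u n)) = fun n => x n + z • (u n : E) := by
        ext n
        rw [← hu n, hT, sub_add_cancel]
      rw [this]
      exact hv.add (hw.const_smul z)
    have hgraph : (w, v + z • w) ∈ A.graph := by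
      have hcl : IsClosed (A.graph : Set (E × E)) := hA.isClosed
      exact hcl.mem_of_tendsto (hw.prodMk_nhds hAu)
        (Eventually.of_forall fun n => A.mem_graph (u n))
    obtain ⟨y, hy1, hy2⟩ := A.mem_graph_iff.1 hgraph
    simp only at hy1 hy2
    refine ⟨y, ?_⟩
    rw [hT, hy2, hy1, add_sub_cancel_right]
  have hsurj : Function.Surjective T := by
    rw [← LinearMap.range_eq_top]
    have : CompleteSpace (LinearMap.range T) := hclosed.completeSpace_coe
    rw [← Submodule.orthogonal_eq_bot_iff, Submodule.eq_bot_iff]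
    intro w hw
    -- A vector orthogonal to the range lies in the domain of the adjoint, hence of `A`, and is an
    -- eigenvector for `conj z`; the lower bound at `conj z` forces it to vanish.
    have h1 : ∀ u : A.domain, ⟪(starRingEnd ℂ z) • w, (u : E)⟫_ℂ = ⟪w, A u⟫_ℂ := fun u => by
      have h2 : ⟪w, T u⟫_ℂ = 0 :=
        (Submodule.mem_orthogonal' _ _).1 hw _ (LinearMap.mem_range_self T u)
      rw [hT, inner_sub_right, inner_smul_right, sub_eq_zero] at h2
      rw [inner_smul_left, h2, starRingEnd_self_apply]
    have h2 : w ∈ A.adjoint.domain := LinearPMap.mem_adjoint_domain_of_exists w ⟨_, h1⟩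
    have h3 : A.adjoint ⟨w, h2⟩ = (starRingEnd ℂ z) • w :=
      LinearPMap.adjoint_apply_eq hA.dense_domain ⟨w, h2⟩ h1
    obtain ⟨u, hu1, hu2⟩ : ∃ u : A.domain, (u : E) = w ∧ A u = (starRingEnd ℂ z) • w := by
      have h4 : (w, (starRingEnd ℂ z) • w) ∈ A.adjoint.graph := by
        rw [← h3]
        exact A.adjoint.mem_graph ⟨w, h2⟩
      rw [LinearPMap.isSelfAdjoint_def.1 hA] at h4
      exact A.mem_graph_iff.1 h4
    have h5 := abs_im_mul_norm_le hA (starRingEnd ℂ z) u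
    rw [hu2, hu1, sub_self, norm_zero, conj_im, abs_neg] at h5
    have h6 : ‖w‖ ≤ 0 := by
      by_contra! h
      exact absurd h5 (not_le.2 (mul_pos hz0 h))
    exact norm_le_zero_iff.1 h6
  let e := LinearEquiv.ofBijective T ⟨hinj, hsurj⟩
  let R : E →L[ℂ] E := (A.domain.subtype ∘ₗ e.symm.toLinearMap).mkContinuous |z.im|⁻¹ fun v => by
    have h := hbound (e.symm v)
    have h2 : T (e.symm v) = v := e.apply_symm_apply v
    rw [h2] at h
    rw [inv_mul_eq_div, le_div_iff₀ hz0, mul_comm]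
    exact h
  refine ⟨R, ⟨fun u => ⟨(e.symm u).2, e.apply_symm_apply u⟩, fun u => ?_⟩,
    LinearMap.mkContinuous_norm_le _ (by positivity) _⟩
  exact congrArg Subtype.val (e.symm_apply_apply u)

theorem mem_rho_of_isSelfAdjoint (hA : IsSelfAdjoint A) (hz : z.im ≠ 0) : z ∈ rho A :=
  let ⟨R, hR, _⟩ := exists_resolvent_of_isSelfAdjoint hA hz
  ⟨R, hR⟩

theorem norm_res_le_of_isSelfAdjoint (hA : IsSelfAdjoint A) (hz : z.im ≠ 0) :
    ‖res A z‖ ≤ |z.im|⁻¹ := by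
  obtain ⟨R, hR, h⟩ := exists_resolvent_of_isSelfAdjoint hA hz
  rwa [(res_spec ⟨R, hR⟩).unique hR]

end Resolvent

/-! ### The map `ν ↦ ν⁻ᵐ` on a sector -/

section Sector

open Complex Filter Set

/-- The open sector `|arg ν| < π / (2 m)`. -/
def sector (m : ℕ) : Set ℂ := {ν | ν ≠ 0 ∧ |arg ν| < Real.pi / (2 * m)}

/-- A branch of `w ↦ w ^ (-1 / m)`. -/
def invRoot (m : ℕ) (w : ℂ) : ℂ := w⁻¹ ^ ((m : ℂ)⁻¹)

variable {m : ℕ}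

/-- The principal root inverts the power as long as `|arg ν| < π / m`, which is twice the opening of
the sector. -/
theorem cpow_inv_of_mem_sector (hm : 1 ≤ m) {ν : ℂ} (hν : ν ∈ sector m) :
    (ν ^ m) ^ ((m : ℂ)⁻¹) = ν := by
  have h1 : (1 : ℝ) ≤ m := by exact_mod_cast hm
  have h2 : Real.pi / (2 * m) < Real.pi / m :=
    div_lt_div_of_pos_left Real.pi_pos (by linarith) (by linarith)
  have h3 := abs_lt.1 (hν.2.trans h2)
  exact pow_cpow_nat_inv (by omega) h3.1 h3.2.le

theorem sector_pow_injOn (hm : 1 ≤ m) : InjOn (fun ν : ℂ => ν ^ m) (sector m) :=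
  fun ν hν μ hμ h => by
    rw [← cpow_inv_of_mem_sector hm hν, ← cpow_inv_of_mem_sector hm hμ]
    exact congrArg (· ^ ((m : ℂ)⁻¹)) h

theorem invRoot_inv_pow (hm : 1 ≤ m) {ν : ℂ} (hν : ν ∈ sector m) : invRoot m (ν ^ m)⁻¹ = ν := by
  rw [invRoot, inv_inv, cpow_inv_of_mem_sector hm hν]

theorem inv_pow_invRoot (hm : 1 ≤ m) (w : ℂ) : (invRoot m w ^ m)⁻¹ = w := by
  rw [invRoot, cpow_nat_inv_pow _ (by omega), inv_inv]

theorem ofReal_mem_sector (hm : 1 ≤ m) {t : ℝ} (ht : 0 < t) : (t : ℂ) ∈ sector m := by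
  refine ⟨ofReal_ne_zero.2 ht.ne', ?_⟩
  rw [arg_ofReal_of_nonneg ht.le, abs_zero]
  have h1 : (0 : ℝ) < m := by exact_mod_cast hm
  have := Real.pi_pos
  positivity

theorem re_pos_of_mem_sector (hm : 1 ≤ m) {ν : ℂ} (hν : ν ∈ sector m) : 0 < ν.re := by
  have h1 : (1 : ℝ) ≤ m := by exact_mod_cast hm
  have h2 : |arg ν| < Real.pi / 2 := hν.2.trans_le
    (div_le_div_of_nonneg_left Real.pi_pos.le two_pos (by linarith))
  rcases abs_arg_lt_pi_div_two_iff.1 h2 with h | h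
  · exact h
  · exact absurd h hν.1

theorem isOpen_sector (hm : 1 ≤ m) : IsOpen (sector m) := by
  rw [isOpen_iff_mem_nhds]
  intro ν hν
  have h1 : ContinuousAt (fun z => |arg z|) ν :=
    (continuousAt_arg (Or.inl (re_pos_of_mem_sector hm hν))).abs
  filter_upwards [h1.eventually_lt_const hν.2, isOpen_ne.mem_nhds hν.1] with z hz hz'
  exact ⟨hz', hz⟩

theorem inv_re_pos {w : ℂ} (hw : 0 < w.re) : 0 < (w⁻¹).re := by
  rw [inv_re]
  refine div_pos hw (normSq_pos.2 ?_)
  rintro rfl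
  simp at hw

/-- Inversion preserves the right half plane, and the principal root divides the argument by `m`. -/
theorem invRoot_mem_sector (hm : 1 ≤ m) {w : ℂ} (hw : 0 < w.re) : invRoot m w ∈ sector m := by
  have h1 : (0 : ℝ) < m := by exact_mod_cast hm
  have h0 : w⁻¹ ≠ 0 := by
    intro h
    have := inv_re_pos hw
    simp [h] at this
  have h2 : |arg w⁻¹| < Real.pi / 2 := abs_arg_lt_pi_div_two_iff.2 (Or.inl (inv_re_pos hw))
  have h3 : invRoot m w = exp (log w⁻¹ * (m : ℂ)⁻¹) := cpow_def_of_ne_zero h0 _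
  have h4 : (log w⁻¹ * (m : ℂ)⁻¹).im = arg w⁻¹ / m := by
    rw [← ofReal_natCast, ← ofReal_inv, im_mul_ofReal, log_im, div_eq_mul_inv]
  have h5 : |arg w⁻¹ / m| < Real.pi / (2 * m) := by
    rw [abs_div, abs_of_pos h1, div_lt_div_iff₀ h1 (by positivity)]
    nlinarith
  have h6 : Real.pi / (2 * m) ≤ Real.pi := by
    have h8 : (1 : ℝ) ≤ m := by exact_mod_cast hm
    exact div_le_self Real.pi_pos.le (by linarith)
  have h7 := abs_lt.1 (h5.trans_le h6)
  refine ⟨by rw [h3]; exact exp_ne_zero _, ?_⟩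
  rw [h3, arg_exp, h4, (toIocMod_eq_self _).2 ⟨h7.1, by linarith [h7.2]⟩]
  exact h5

theorem continuousAt_invRoot {w : ℂ} (hw : 0 < w.re) : ContinuousAt (invRoot m) w := by
  have h0 : w ≠ 0 := by
    rintro rfl
    simp at hw
  exact ContinuousAt.comp (g := fun x : ℂ => x ^ ((m : ℂ)⁻¹))
    (continuousAt_cpow_const (Or.inl (inv_re_pos hw))) (continuousAt_inv₀ h0)

/-- Induction on the imaginary part of a product. Through it a power of `|im w|` is controlled by
the same power of `|im ν|` for `w = ν⁻ᵐ`. -/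
theorem abs_im_pow_succ_le (ν : ℂ) (k : ℕ) :
    |(ν ^ (k + 1)).im| ≤ (k + 1) * ‖ν‖ ^ k * |ν.im| := by
  induction k with
  | zero => simp
  | succ k ih =>
    rw [pow_succ, mul_im]
    have h1 : |(ν ^ (k + 1)).re| ≤ ‖ν‖ ^ (k + 1) := by
      rw [← norm_pow]
      exact abs_re_le_norm _
    calc _ ≤ |(ν ^ (k + 1)).re| * |ν.im| + |(ν ^ (k + 1)).im| * |ν.re| := by
          rw [← abs_mul, ← abs_mul]
          exact abs_add_le _ _
      _ ≤ ‖ν‖ ^ (k + 1) * |ν.im| + (k + 1) * ‖ν‖ ^ k * |ν.im| * ‖ν‖ := by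
          gcongr
          exact abs_re_le_norm _
      _ = _ := by push_cast; ring

theorem abs_im_inv_pow_le (hm : 1 ≤ m) (ν : ℂ) :
    |((ν ^ m)⁻¹).im| ≤ m * ‖ν‖ ^ (m - 1) / normSq (ν ^ m) * |ν.im| := by
  obtain ⟨k, rfl⟩ : ∃ k, m = k + 1 := ⟨m - 1, by omega⟩
  rw [inv_im, abs_div, abs_neg, abs_of_nonneg (normSq_nonneg _), div_mul_eq_mul_div]
  have := abs_im_pow_succ_le ν k
  have h2 := normSq_nonneg (ν ^ (k + 1))
  push_cast
  gcongr

theorem hasDerivAt_inv_pow (hm : 1 ≤ m) {ν : ℂ} (hν : ν ≠ 0) :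
    HasDerivAt (fun ν : ℂ => (ν ^ m)⁻¹) (-(m * (ν ^ (m + 1))⁻¹)) ν := by
  have h := (hasDerivAt_pow m ν).inv (pow_ne_zero m hν)
  obtain ⟨k, rfl⟩ : ∃ k, m = k + 1 := ⟨m - 1, by omega⟩
  convert! h using 1
  simp only [Nat.add_sub_cancel]
  field_simp
  ring

end Sector

/-! ### Geometric sums of operators -/

section GeomSums

open Filter Set

/-- `∑ j < m, (1 - Y ^ j) / (1 - Y)`. -/
def geomDefect {𝓡 : Type*} [Ring 𝓡] (m : ℕ) (Y : 𝓡) : 𝓡 :=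
  ∑ j ∈ Finset.range m, ∑ i ∈ Finset.range j, Y ^ i

/-- `∑ j < m, Y ^ j`. -/
def geomSum {𝓡 : Type*} [Ring 𝓡] (m : ℕ) (Y : 𝓡) : 𝓡 := ∑ j ∈ Finset.range m, Y ^ j

theorem geomSum_mul {𝓡 : Type*} [Ring 𝓡] (m : ℕ) (Y : 𝓡) : geomSum m Y * (1 - Y) = 1 - Y ^ m :=
  geom_sum_mul_neg Y m

theorem mul_geomSum {𝓡 : Type*} [Ring 𝓡] (m : ℕ) (Y : 𝓡) : (1 - Y) * geomSum m Y = 1 - Y ^ m :=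
  mul_neg_geom_sum Y m

theorem geomDefect_mul {𝓡 : Type*} [Ring 𝓡] (m : ℕ) (Y : 𝓡) :
    geomDefect m Y * (1 - Y) = m - geomSum m Y := by
  rw [geomDefect, Finset.sum_mul]
  simp only [geom_sum_mul_neg, Finset.sum_sub_distrib, geomSum]
  simp

/-- Partial fractions: as `P (1 - Y) = m - Q` with `P`, `Q` the defect and the geometric sum,
dividing `Q + P (1 - Y) = m` by `Q (1 - Y)` gives the formula. -/
theorem natCast_mul_inverse_eq {𝓡 : Type*} [Ring 𝓡] {m : ℕ} {Y : 𝓡} (ha : IsUnit (1 - Y))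
    (hQ : IsUnit (geomSum m Y)) :
    (m : 𝓡) * (Ring.inverse (geomSum m Y) * Ring.inverse (1 - Y)) =
      Ring.inverse (1 - Y) + geomDefect m Y * Ring.inverse (geomSum m Y) := by
  have hu := hQ.mul ha
  have h1 := Ring.inverse_mul_cancel _ ha
  have h2 := Ring.inverse_mul_cancel _ hQ
  apply hu.mul_right_cancel
  calc _ = (m : 𝓡) * (Ring.inverse (geomSum m Y) *
        (Ring.inverse (1 - Y) * (geomSum m Y * (1 - Y)))) := by simp only [mul_assoc]
    _ = (m : 𝓡) := by
      rw [geomSum_mul, ← mul_geomSum, ← mul_assoc (Ring.inverse (1 - Y)), h1, one_mul, h2, mul_one]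
    _ = geomSum m Y + (m - geomSum m Y) := by abel
    _ = Ring.inverse (1 - Y) * (geomSum m Y * (1 - Y)) + geomDefect m Y *
        (Ring.inverse (geomSum m Y) * (geomSum m Y * (1 - Y))) := by
      rw [← mul_assoc (Ring.inverse (geomSum m Y)), h2, one_mul, geomDefect_mul, geomSum_mul,
        ← mul_geomSum, ← mul_assoc, h1, one_mul]
    _ = _ := by simp only [mul_assoc, add_mul]

/-- From `1 / (1 - x) = 1 + x / (1 - x)` at `x = Yᵐ`. The scalar `m` drops out of differences of two
operators, and what remains carries the factor `Yᵐ` on which the trace class hypotheses act. -/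
theorem natCast_mul_inverse_eq_add {𝓡 : Type*} [Ring 𝓡] {m : ℕ} {Y : 𝓡} (ha : IsUnit (1 - Y))
    (hQ : IsUnit (geomSum m Y)) :
    (m : 𝓡) * (Ring.inverse (geomSum m Y) * Ring.inverse (1 - Y)) =
      m + Y ^ m * (Ring.inverse (1 - Y) + geomDefect m Y * Ring.inverse (geomSum m Y)) := by
  have hu := hQ.mul ha
  have h1 := Ring.inverse_mul_cancel _ ha
  have h2 := Ring.inverse_mul_cancel _ hQ
  have h3 : Ring.inverse (geomSum m Y) * Ring.inverse (1 - Y) * (1 - Y ^ m) = 1 := by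
    rw [← mul_geomSum, mul_assoc, ← mul_assoc (Ring.inverse (1 - Y)), h1, one_mul, h2]
  rw [← natCast_mul_inverse_eq ha hQ]
  apply hu.mul_right_cancel
  rw [geomSum_mul]
  set S := Ring.inverse (geomSum m Y) * Ring.inverse (1 - Y)
  have hc : Y ^ m * (m : 𝓡) = m * Y ^ m := (Nat.cast_commute m _).symm.eq
  calc _ = (m : 𝓡) * (S * (1 - Y ^ m)) := by rw [mul_assoc]
    _ = m * (1 - Y ^ m) + m * Y ^ m * (S * (1 - Y ^ m)) := by rw [h3]; noncomm_ring
    _ = _ := by rw [← hc]; noncomm_ring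

variable {E : Type*} [NormedAddCommGroup E] [InnerProductSpace ℂ E]

/-- Up to the scalar `-ν⁻ᵐ`, the operator is `1 - (ν R)ᵐ`, which factors as `1 - ν R` times the
geometric sum. -/
theorem isUnit_pow_sub {m : ℕ} {R : E →L[ℂ] E} {ν : ℂ} (hν : ν ≠ 0)
    (ha : IsUnit (1 - ν • R)) (hQ : IsUnit (geomSum m (ν • R))) :
    IsUnit (R ^ m - algebraMap ℂ _ (ν ^ m)⁻¹) ∧
      Ring.inverse (R ^ m - algebraMap ℂ _ (ν ^ m)⁻¹) =
        -(ν ^ m) • (Ring.inverse (geomSum m (ν • R)) * Ring.inverse (1 - ν • R)) := by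
  have hνm : ν ^ m ≠ 0 := pow_ne_zero _ hν
  have e : R ^ m - algebraMap ℂ _ (ν ^ m)⁻¹ =
      (-(ν ^ m)⁻¹) • ((1 - ν • R) * geomSum m (ν • R)) := by
    rw [mul_geomSum, smul_pow, Algebra.algebraMap_eq_smul_one, smul_sub, smul_smul, neg_mul,
      inv_mul_cancel₀ hνm]
    module
  have hu := ha.mul hQ
  have h1 := Ring.inverse_mul_cancel _ ha
  have h2 := Ring.inverse_mul_cancel _ hQ
  have hunit : IsUnit (R ^ m - algebraMap ℂ _ (ν ^ m)⁻¹) := by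
    rw [e]
    exact hu.smul (Units.mk0 (-(ν ^ m)⁻¹) (neg_ne_zero.2 (inv_ne_zero hνm)))
  refine ⟨hunit, hunit.mul_right_cancel ?_⟩
  rw [Ring.inverse_mul_cancel _ hunit, e, smul_mul_smul_comm, neg_mul_neg, mul_inv_cancel₀ hνm,
    one_smul, mul_assoc, ← mul_assoc (Ring.inverse (1 - ν • R)), h1, one_mul, h2]

variable [CompleteSpace E]

/-- By spectral mapping, failure puts an `m`-th root of unity `r ≠ 1` into the spectrum of `ν R`.
Then `1 - (ν / r) R` is not invertible, so `ν / r` lies in the sector; it has the same `m`-th power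
as `ν`, and injectivity of the power there gives `r = 1`. -/
theorem isUnit_geomSum {m : ℕ} (hm : 1 ≤ m) {R : E →L[ℂ] E}
    (hR : ∀ ν ∉ sector m, IsUnit (1 - ν • R)) {ν : ℂ} (hν : ν ∈ sector m) :
    IsUnit (geomSum m (ν • R)) := by
  -- Over the zero space the spectrum is empty, while the spectral mapping theorem below needs it
  -- nonempty.
  rcases subsingleton_or_nontrivial (E →L[ℂ] E) with h | h
  · exact isUnit_of_subsingleton _
  by_contra hnot
  let p : Polynomial ℂ := ∑ j ∈ Finset.range m, Polynomial.X ^ j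
  have hp : Polynomial.aeval (ν • R) p = geomSum m (ν • R) := by simp [p, geomSum]
  have h0 : (0 : ℂ) ∈ spectrum ℂ (Polynomial.aeval (ν • R) p) := by
    rw [hp]
    by_contra h1
    exact hnot (spectrum.zero_notMem_iff ℂ |>.1 h1)
  rw [spectrum.map_polynomial_aeval_of_nonempty _ _ (spectrum.nonempty _)] at h0
  obtain ⟨r, hr, hr0⟩ := h0
  have hev : Polynomial.eval r p = ∑ j ∈ Finset.range m, r ^ j := by
    simp [p, Polynomial.eval_finsetSum]
  simp only [hev] at hr0
  have hm0 : (m : ℂ) ≠ 0 := by exact_mod_cast (by omega : m ≠ 0)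
  have hr1 : r ≠ 1 := by
    rintro rfl
    simp at hr0
    omega
  have hrm : r ^ m = 1 := by
    have := geom_sum_mul r m
    rw [hr0, zero_mul] at this
    exact (sub_eq_zero.1 this.symm)
  have hrn : r ≠ 0 := by
    rintro rfl
    rw [zero_pow (by omega)] at hrm
    exact zero_ne_one hrm
  have hns : ¬ IsUnit (1 - (ν / r) • R) := by
    intro hu
    refine (spectrum.mem_iff.1 hr) ?_
    have e : algebraMap ℂ (E →L[ℂ] E) r - ν • R = r • (1 - (ν / r) • R) := by
      rw [smul_sub, smul_smul, mul_div_cancel₀ _ hrn, Algebra.algebraMap_eq_smul_one]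
    rw [e]
    exact hu.smul (Units.mk0 r hrn)
  have hmem : ν / r ∈ sector m := by
    by_contra h1
    exact hns (hR _ h1)
  have heq := sector_pow_injOn hm hmem hν (by simp [div_pow, hrm])
  rw [div_eq_iff hrn] at heq
  exact hr1 (mul_left_cancel₀ hν.1 (by rw [← heq, mul_one]))

end GeomSums

/-! ### Resolvent bounds for the powers of the resolvent -/

section PowerBounds

open Complex Filter Set

variable {E : Type*} [NormedAddCommGroup E] [InnerProductSpace ℂ E]

/-- Near the real point `t` and off the real axis, the resolvent of `A` is `O(|im z|⁻ᴹ)`. -/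
def HasModerateResolventAt (A : E →ₗ.[ℂ] E) (M : ℕ) (t : ℝ) : Prop :=
  ∃ C : ℝ, ∀ᶠ z in 𝓝 (t : ℂ), z.im ≠ 0 → z ∈ rho A ∧ ‖res A z‖ * |z.im| ^ M ≤ C

/-- Locally `⟨re z⟩ ^ n` is bounded, and for `|im z| < 1` the real exponent may be rounded up; the
extra `1` accounts for the separate factor `|im z|⁻¹`. -/
theorem PolynomialResolventBound.exists_moderate {A : E →ₗ.[ℂ] E} {I : Set ℝ} (hI : IsOpen I)
    (h : PolynomialResolventBound A I) : ∃ M : ℕ, ∀ t ∈ I, HasModerateResolventAt A M t := by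
  obtain ⟨a, ha, n, hn, C, hC, h⟩ := h
  refine ⟨⌈n⌉₊ + 1, fun t ht => ?_⟩
  have h1 : ∀ᶠ z : ℂ in 𝓝 (t : ℂ), z.re ∈ I :=
    (continuous_re.tendsto (t : ℂ)).eventually (by simpa using hI.mem_nhds ht)
  have h2 : ∀ᶠ z : ℂ in 𝓝 (t : ℂ), |z.im| < min a 1 :=
    (continuous_im.abs.tendsto (t : ℂ)).eventually_lt_const (by simpa using ha)
  have h3 : ContinuousAt (fun z : ℂ => √(1 + z.re ^ 2) ^ n) t :=
    ContinuousAt.rpow_const (by fun_prop) (Or.inr hn.le)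
  refine ⟨C * (√(1 + (t : ℂ).re ^ 2) ^ n + 1), ?_⟩
  filter_upwards [h1, h2, h3.eventually_lt_const (lt_add_one _)] with z hz1 hz2 hz3 hne
  have hpos : 0 < |z.im| := abs_pos.2 hne
  obtain ⟨h4, h5⟩ := h z hz1 hpos (hz2.trans_le (min_le_left _ _))
  refine ⟨h4, ?_⟩
  have h6 : |z.im| ^ ⌈n⌉₊ ≤ |z.im| ^ n := by
    rw [← Real.rpow_natCast]
    exact Real.rpow_le_rpow_of_exponent_ge hpos (hz2.trans_le (min_le_right _ _)).le (Nat.le_ceil n)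
  calc ‖res A z‖ * |z.im| ^ (⌈n⌉₊ + 1)
      ≤ C * |z.im|⁻¹ * (√(1 + z.re ^ 2) / |z.im|) ^ n * |z.im| ^ (⌈n⌉₊ + 1) := by gcongr
    _ = C * √(1 + z.re ^ 2) ^ n * (|z.im| ^ ⌈n⌉₊ / |z.im| ^ n) := by
      rw [Real.div_rpow (Real.sqrt_nonneg _) hpos.le, pow_succ]
      field_simp
      ring
    _ ≤ C * √(1 + z.re ^ 2) ^ n * 1 := by
      gcongr
      exact div_le_one_of_le₀ h6 (by positivity)
    _ ≤ _ := by rw [mul_one]; gcongr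

/-- Here `1 - ν R` can fail to be invertible only if `ν - c` is in the spectrum. All `ν` off the
sector are covered, since the points `ν / r` with `r` a root of unity are needed later. -/
theorem isUnit_of_spec_subset {A : E →ₗ.[ℂ] E} {c : ℝ} {m : ℕ} (hc : (-c : ℂ) ∈ rho A)
    (hsec : ∀ z ∈ spec A, z + c ∈ sector m) : ∀ ν ∉ sector m, IsUnit (1 - ν • res A (-c)) :=
  fun ν hν => by
    have h1 : ν - c ∈ rho A := by
      by_contra h
      exact hν (by simpa using hsec _ h)
    simpa using isUnit_one_sub_smul hc h1

variable [CompleteSpace E]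

theorem moderate_of_isSelfAdjoint {A : E →ₗ.[ℂ] E} (hA : IsSelfAdjoint A) (t : ℝ) :
    HasModerateResolventAt A 1 t := by
  refine ⟨1, Eventually.of_forall fun z hz => ⟨mem_rho_of_isSelfAdjoint hA hz, ?_⟩⟩
  rw [pow_one, ← le_div_iff₀ (abs_pos.2 hz), one_div]
  exact norm_res_le_of_isSelfAdjoint hA hz

theorem continuous_geomSum {m : ℕ} {R : E →L[ℂ] E} :
    Continuous fun ν : ℂ => geomSum m (ν • R) := by
  unfold geomSum
  fun_prop

theorem continuous_geomDefect {m : ℕ} {R : E →L[ℂ] E} :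
    Continuous fun ν : ℂ => geomDefect m (ν • R) := by
  unfold geomDefect
  fun_prop

theorem continuousAt_ringInverse {X : Type*} [TopologicalSpace X] {f : X → E →L[ℂ] E} {x : X}
    (hf : ContinuousAt f x) (hu : IsUnit (f x)) : ContinuousAt (fun y => Ring.inverse (f y)) x := by
  obtain ⟨u, hu⟩ := hu
  have h := NormedRing.inverse_continuousAt u
  rw [hu] at h
  exact ContinuousAt.comp h hf

/-- Factoring expresses the resolvent of `Rᵐ` as `-νᵐ Q(ν R)⁻¹ (1 + ν (A - z)⁻¹)` with `ν = z + c`.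
The factor `Q(ν R)⁻¹` is bounded near the positive axis, so the exponent `M` is inherited. -/
theorem exists_resolvent_pow_bound {A : E →ₗ.[ℂ] E} {c : ℝ} {m : ℕ} (hm : 1 ≤ m)
    (hc : (-c : ℂ) ∈ rho A) (hsec : ∀ z ∈ spec A, z + c ∈ sector m) {t : ℝ} (ht : 0 < t + c)
    {M : ℕ} (h : HasModerateResolventAt A M t) :
    ∃ C : ℝ, ∀ᶠ z in 𝓝 (t : ℂ), z.im ≠ 0 →
      IsUnit (res A (-c) ^ m - algebraMap ℂ _ ((z + c) ^ m)⁻¹) ∧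
      ‖Ring.inverse (res A (-c) ^ m - algebraMap ℂ _ ((z + c) ^ m)⁻¹)‖ * |z.im| ^ M ≤ C := by
  obtain ⟨C, hC⟩ := h
  have htc : (t : ℂ) + c ∈ sector m := by
    rw [← ofReal_add]
    exact ofReal_mem_sector hm ht
  have hshift : ContinuousAt (fun z : ℂ => z + c) t := by fun_prop
  have hev : ∀ᶠ z : ℂ in 𝓝 (t : ℂ), z + c ∈ sector m :=
    hshift.eventually ((isOpen_sector hm).mem_nhds htc)
  have hR := isUnit_of_spec_subset hc hsec
  let g : ℂ → ℝ := fun z => ‖z + c‖ ^ m * (‖Ring.inverse (geomSum m ((z + c) • res A (-c)))‖ *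
    (|z.im| ^ M + ‖z + c‖ * C))
  have hg : ContinuousAt g t := by
    have h1 : ContinuousAt (fun z : ℂ => Ring.inverse (geomSum m ((z + c) • res A (-c)))) t :=
      continuousAt_ringInverse (f := fun z : ℂ => geomSum m ((z + c) • res A (-c)))
        (ContinuousAt.comp (g := fun ν : ℂ => geomSum m (ν • res A (-c)))
          continuous_geomSum.continuousAt hshift) (isUnit_geomSum hm hR htc)
    have h2 : ContinuousAt (fun z : ℂ => |z.im| ^ M + ‖z + c‖ * C) t := by fun_prop
    have h3 : ContinuousAt (fun z : ℂ => ‖z + c‖ ^ m) t := by fun_prop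
    exact h3.mul (h1.norm.mul h2)
  refine ⟨g t + 1, ?_⟩
  filter_upwards [hC, hev, hg.eventually_lt_const (lt_add_one _)] with z hz1 hz2 hz3 hne
  obtain ⟨h1, h2⟩ := hz1 hne
  obtain ⟨h3, h4⟩ := isUnit_pow_sub hz2.1 (isUnit_one_sub_smul hc h1) (isUnit_geomSum hm hR hz2)
  refine ⟨h3, le_trans ?_ hz3.le⟩
  rw [h4, inverse_one_sub_smul hc h1, norm_smul, norm_neg, norm_pow]
  have h5 : ‖1 + (z + c) • res A z‖ ≤ 1 + ‖z + c‖ * ‖res A z‖ := by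
    refine (norm_add_le _ _).trans ?_
    rw [norm_smul]
    gcongr
    exact ContinuousLinearMap.norm_id_le
  calc _ ≤ ‖z + c‖ ^ m * (‖Ring.inverse (geomSum m ((z + c) • res A (-c)))‖ *
        (1 + ‖z + c‖ * ‖res A z‖)) * |z.im| ^ M := by
        gcongr
        exact (norm_mul_le _ _).trans (by gcongr)
    _ = ‖z + c‖ ^ m * (‖Ring.inverse (geomSum m ((z + c) • res A (-c)))‖ *
        (|z.im| ^ M + ‖z + c‖ * (‖res A z‖ * |z.im| ^ M))) := by ring
    _ ≤ g z := by simp only [g]; gcongr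

-- Substitute `z = invRoot m w - c`. Near the real point one has `|im w| ≤ (L t + 1) |im z|`, so a
-- bound in powers of `im z` becomes one in powers of `im w`.
omit [CompleteSpace E] in
theorem resolventModerateAt_of_comp {X : E →L[ℂ] E} {c : ℝ} {m : ℕ} (hm : 1 ≤ m) {t : ℝ}
    (ht : 0 < t + c) {M : ℕ} (h : ∃ C : ℝ, ∀ᶠ z in 𝓝 (t : ℂ), z.im ≠ 0 →
      IsUnit (X - algebraMap ℂ _ ((z + c) ^ m)⁻¹) ∧
      ‖Ring.inverse (X - algebraMap ℂ _ ((z + c) ^ m)⁻¹)‖ * |z.im| ^ M ≤ C) :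
    ResolventModerateAt X M ((((t + c) ^ m)⁻¹ : ℝ) : ℂ) := by
  obtain ⟨C, hC⟩ := h
  set q : ℂ := ((((t + c) ^ m)⁻¹ : ℝ) : ℂ) with hq
  have hqre : 0 < q.re := by
    rw [hq, ofReal_re]
    positivity
  have hqt : invRoot m q - c = t := by
    have := invRoot_inv_pow hm (ofReal_mem_sector hm ht)
    rw [hq]
    push_cast at this ⊢
    rw [this]
    ring
  have hφ : Tendsto (fun w => invRoot m w - c) (𝓝 q) (𝓝 (t : ℂ)) := by
    rw [← hqt]
    exact (continuousAt_invRoot hqre).sub_const _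
  let L : ℂ → ℝ := fun z => m * ‖z + c‖ ^ (m - 1) / normSq ((z + c) ^ m)
  have hL : ContinuousAt L t := by
    have h1 : normSq (((t : ℂ) + c) ^ m) ≠ 0 := by
      rw [← ofReal_add]
      exact (normSq_pos.2 (pow_ne_zero _ (ofReal_ne_zero.2 ht.ne'))).ne'
    have h2 : Continuous fun z : ℂ => normSq ((z + c) ^ m) := continuous_normSq.comp (by fun_prop)
    exact ContinuousAt.div (by fun_prop) h2.continuousAt h1
  have hL1 : 0 ≤ L t + 1 := by
    have : 0 ≤ L t := div_nonneg (by positivity) (normSq_nonneg _)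
    linarith
  refine ⟨(L t + 1) ^ M * C, ?_⟩
  filter_upwards [hφ.eventually hC, hφ.eventually (hL.eventually_lt_const (lt_add_one _))]
    with w hw1 hw2 hne
  simp only [sub_add_cancel, inv_pow_invRoot hm] at hw1
  have him : |w.im| ≤ L (invRoot m w - c) * |(invRoot m w - c).im| := by
    have h1 := abs_im_inv_pow_le hm (invRoot m w)
    rw [inv_pow_invRoot hm] at h1
    simpa [L] using h1
  have hne' : (invRoot m w - c).im ≠ 0 := by
    intro h0
    rw [h0, abs_zero, mul_zero] at him
    exact hne (abs_eq_zero.1 (le_antisymm him (abs_nonneg _)))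
  obtain ⟨h1, h2⟩ := hw1 hne'
  refine ⟨h1, ?_⟩
  calc _ ≤ ‖Ring.inverse (X - algebraMap ℂ _ w)‖ *
        ((L t + 1) * |(invRoot m w - c).im|) ^ M := by
        gcongr
        exact him.trans (by gcongr)
    _ = (L t + 1) ^ M * (‖Ring.inverse (X - algebraMap ℂ _ w)‖ *
        |(invRoot m w - c).im| ^ M) := by rw [mul_pow]; ring
    _ ≤ _ := by gcongr

end PowerBounds

/-! ### The function `σ_m` as a trace class valued function -/

section SigmaNuc

open Complex Filter Set

variable {E : Type*} [NormedAddCommGroup E] [InnerProductSpace ℂ E]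

/-- Telescoping, with `R₀` commuting past `R₀ᵐ`. It keeps `R₀ᵐ (R - R₀)` as the only source of trace
class terms. -/
theorem pow_mul_pow_sub_pow_succ (m j : ℕ) (R R₀ : E →L[ℂ] E) :
    R₀ ^ m * (R ^ (j + 1) - R₀ ^ (j + 1)) =
      R₀ ^ m * (R - R₀) * R ^ j + R₀ * (R₀ ^ m * (R ^ j - R₀ ^ j)) := by
  have h1 : R₀ * (R₀ ^ m * (R ^ j - R₀ ^ j)) = R₀ ^ m * (R₀ * (R ^ j - R₀ ^ j)) := by
    rw [← mul_assoc, ← mul_assoc, ← pow_succ', ← pow_succ]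
  rw [h1, pow_succ' R, pow_succ' R₀]
  noncomm_ring

variable [CompleteSpace E]

/-- The operators `R₀ᵐ (Rʲ - R₀ʲ)`, starting from `T = R₀ᵐ (R - R₀)`. -/
def powDiff (R R₀ : E →L[ℂ] E) (T : Nuc E) : ℕ → Nuc E
  | 0 => 0
  | j + 1 => Nuc.rmul E (R ^ j) T + Nuc.lmul E R₀ (powDiff R R₀ T j)

theorem val_powDiff {m : ℕ} {R R₀ : E →L[ℂ] E} {T : Nuc E}
    (hT : Nuc.val E T = R₀ ^ m * (R - R₀)) (j : ℕ) :
    Nuc.val E (powDiff R R₀ T j) = R₀ ^ m * (R ^ j - R₀ ^ j) := by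
  induction j with
  | zero => simp [powDiff]
  | succ j ih => rw [powDiff, map_add, Nuc.val_rmul, Nuc.val_lmul, ih, hT, pow_mul_pow_sub_pow_succ]

/-- `Rᵐ (1 - ν R)⁻¹ - R₀ᵐ (1 - ν R₀)⁻¹`, where `D = Rᵐ - R₀ᵐ` and `T = R₀ᵐ (R - R₀)`. -/
def sigmaNuc (R R₀ : E →L[ℂ] E) (D T : Nuc E) (ν : ℂ) : Nuc E :=
  Nuc.rmul E (Ring.inverse (1 - ν • R)) D +
    ν • Nuc.lmul E (Ring.inverse (1 - ν • R₀)) (Nuc.rmul E (Ring.inverse (1 - ν • R)) T)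

theorem commute_ringInverse {𝓡 : Type*} [Ring 𝓡] {a b : 𝓡} (h : Commute a b) (ha : IsUnit a) :
    Commute (Ring.inverse a) b := by
  obtain ⟨u, rfl⟩ := ha
  rw [Ring.inverse_unit]
  exact h.units_inv_left

/-- With `a`, `a₀` the two inverses, the difference is `(Rᵐ - R₀ᵐ) a + R₀ᵐ (a - a₀)`, and `a - a₀ =
ν a₀ (R - R₀) a`. Commuting `a₀` with `R₀ᵐ` exposes both trace class operators. -/
theorem val_sigmaNuc {m : ℕ} {R R₀ : E →L[ℂ] E} {D T : Nuc E} (hD : Nuc.val E D = R ^ m - R₀ ^ m)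
    (hT : Nuc.val E T = R₀ ^ m * (R - R₀)) {ν : ℂ} (h : IsUnit (1 - ν • R))
    (h₀ : IsUnit (1 - ν • R₀)) :
    Nuc.val E (sigmaNuc R R₀ D T ν) =
      R ^ m * Ring.inverse (1 - ν • R) - R₀ ^ m * Ring.inverse (1 - ν • R₀) := by
  rw [sigmaNuc, map_add, map_smul, Nuc.val_lmul, Nuc.val_rmul, Nuc.val_rmul, hD, hT]
  have h1 := Ring.mul_inverse_cancel _ h
  have h2 := Ring.inverse_mul_cancel _ h₀
  have h3 : Commute (Ring.inverse (1 - ν • R₀)) (R₀ ^ m) := by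
    refine commute_ringInverse ?_ h₀
    exact (Commute.one_left _).sub_left (((Commute.refl R₀).pow_right m).smul_left ν)
  set a := Ring.inverse (1 - ν • R)
  set a₀ := Ring.inverse (1 - ν • R₀)
  have h4 : ν • (a₀ * (R₀ ^ m * (R - R₀) * a)) = R₀ ^ m * (a - a₀) := by
    have h5 : ν • (R - R₀) = (1 - ν • R₀) - (1 - ν • R) := by module
    calc _ = a₀ * R₀ ^ m * (ν • (R - R₀)) * a := by
          simp only [mul_assoc, smul_mul_assoc, mul_smul_comm]
      _ = R₀ ^ m * (a₀ * (1 - ν • R₀) * a - a₀ * ((1 - ν • R) * a)) := by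
          rw [h5, h3.eq]
          simp only [mul_assoc, sub_mul, mul_sub]
      _ = _ := by rw [h1, h2, one_mul, mul_one]
  rw [h4]
  noncomm_ring

theorem sigmaOp_eq {A A₀ : E →ₗ.[ℂ] E} {c : ℝ} {m : ℕ} (hm : 1 ≤ m) (hc : (-c : ℂ) ∈ rho A)
    (hc₀ : (-c : ℂ) ∈ rho A₀) {D T : Nuc E}
    (hD : Nuc.val E D = res A (-c) ^ m - res A₀ (-c) ^ m)
    (hT : Nuc.val E T = res A₀ (-c) ^ m * (res A (-c) - res A₀ (-c))) {z : ℂ} (hz : z ∈ rho A)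
    (hz₀ : z ∈ rho A₀) :
    sigmaOp A A₀ c m z = Nuc.val E (sigmaNuc (res A (-c)) (res A₀ (-c)) D T (z + c)) := by
  rw [val_sigmaNuc hD hT (isUnit_one_sub_smul hc hz) (isUnit_one_sub_smul hc₀ hz₀), sigmaOp,
    res_eq_mul_inverse hc hz, res_eq_mul_inverse hc₀ hz₀, ← mul_assoc, ← mul_assoc, ← pow_succ,
    ← pow_succ, Nat.sub_add_cancel hm]

theorem continuousAt_sigmaNuc {R R₀ : E →L[ℂ] E} {D T : Nuc E} {ν : ℂ} (h : IsUnit (1 - ν • R))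
    (h₀ : IsUnit (1 - ν • R₀)) : ContinuousAt (sigmaNuc R R₀ D T) ν := by
  have h1 : ContinuousAt (fun ν : ℂ => Ring.inverse (1 - ν • R)) ν :=
    continuousAt_ringInverse (f := fun ν : ℂ => 1 - ν • R) (by fun_prop) h
  have h2 : ContinuousAt (fun ν : ℂ => Ring.inverse (1 - ν • R₀)) ν :=
    continuousAt_ringInverse (f := fun ν : ℂ => 1 - ν • R₀) (by fun_prop) h₀
  unfold sigmaNuc
  fun_prop

/-- `(ν R)ᵐ G(ν R) - (ν R₀)ᵐ G(ν R₀)` for `G(x) = (m - ∑ j < m, xʲ) / (1 - xᵐ)`. -/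
def defectNuc (m : ℕ) (R R₀ : E →L[ℂ] E) (D T : Nuc E) (ν : ℂ) : Nuc E :=
  ν ^ m • Nuc.rmul E (geomDefect m (ν • R) * Ring.inverse (geomSum m (ν • R))) D +
    Nuc.rmul E (Ring.inverse (geomSum m (ν • R)))
      (∑ j ∈ Finset.range m, ∑ i ∈ Finset.range j, ν ^ (m + i) • powDiff R R₀ T i) -
    Nuc.lmul E (geomDefect m (ν • R₀) * Ring.inverse (geomSum m (ν • R₀)))
      (Nuc.rmul E (Ring.inverse (geomSum m (ν • R)))
        (∑ j ∈ Finset.range m, ν ^ (m + j) • powDiff R R₀ T j))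

theorem continuousAt_defectNuc {m : ℕ} {R R₀ : E →L[ℂ] E} {D T : Nuc E} {ν : ℂ}
    (h : IsUnit (geomSum m (ν • R))) (h₀ : IsUnit (geomSum m (ν • R₀))) :
    ContinuousAt (defectNuc m R R₀ D T) ν := by
  have h1 : ContinuousAt (fun ν : ℂ => Ring.inverse (geomSum m (ν • R))) ν :=
    continuousAt_ringInverse (f := fun ν : ℂ => geomSum m (ν • R))
      continuous_geomSum.continuousAt h
  have h2 : ContinuousAt (fun ν : ℂ => Ring.inverse (geomSum m (ν • R₀))) ν :=
    continuousAt_ringInverse (f := fun ν : ℂ => geomSum m (ν • R₀))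
      continuous_geomSum.continuousAt h₀
  have h3 := (continuous_geomDefect (m := m) (R := R)).continuousAt (x := ν)
  have h4 := (continuous_geomDefect (m := m) (R := R₀)).continuousAt (x := ν)
  unfold defectNuc
  fun_prop

/-- The difference of `Yᵐ P Q⁻¹` at `Y` and `Y₀` is taken factor by factor: first `Yᵐ`, then `P`,
then `Q⁻¹` by `Q⁻¹ - Q₀⁻¹ = -Q₀⁻¹ (Q - Q₀) Q⁻¹`. The last two differences keep `Y₀ᵐ` on the left. -/
theorem val_defectNuc {m : ℕ} {R R₀ : E →L[ℂ] E} {D T : Nuc E}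
    (hD : Nuc.val E D = R ^ m - R₀ ^ m) (hT : Nuc.val E T = R₀ ^ m * (R - R₀)) {ν : ℂ}
    (h : IsUnit (geomSum m (ν • R))) (h₀ : IsUnit (geomSum m (ν • R₀))) :
    Nuc.val E (defectNuc m R R₀ D T ν) =
      (ν • R) ^ m * (geomDefect m (ν • R) * Ring.inverse (geomSum m (ν • R))) -
      (ν • R₀) ^ m * (geomDefect m (ν • R₀) * Ring.inverse (geomSum m (ν • R₀))) := by
  have hterm (i : ℕ) : Nuc.val E (ν ^ (m + i) • powDiff R R₀ T i) =
      (ν • R₀) ^ m * ((ν • R) ^ i - (ν • R₀) ^ i) := by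
    rw [map_smul, val_powDiff hT, smul_pow, smul_pow, smul_pow, ← smul_sub, smul_mul_smul_comm,
      pow_add]
  have hsum1 : Nuc.val E (∑ j ∈ Finset.range m, ∑ i ∈ Finset.range j,
      ν ^ (m + i) • powDiff R R₀ T i) =
      (ν • R₀) ^ m * (geomDefect m (ν • R) - geomDefect m (ν • R₀)) := by
    simp only [map_sum, hterm, geomDefect, ← Finset.sum_sub_distrib, Finset.mul_sum]
  have hsum2 : Nuc.val E (∑ j ∈ Finset.range m, ν ^ (m + j) • powDiff R R₀ T j) =
      (ν • R₀) ^ m * (geomSum m (ν • R) - geomSum m (ν • R₀)) := by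
    simp only [map_sum, hterm, geomSum, ← Finset.sum_sub_distrib, Finset.mul_sum]
  have hD' : ν ^ m • Nuc.val E D = (ν • R) ^ m - (ν • R₀) ^ m := by
    rw [hD, smul_pow, smul_pow, smul_sub]
  rw [defectNuc, map_sub, map_add, map_smul, Nuc.val_rmul, Nuc.val_rmul, Nuc.val_lmul,
    Nuc.val_rmul, hsum1, hsum2, ← smul_mul_assoc, hD']
  generalize ν • R = Y at *
  generalize ν • R₀ = Y₀ at *
  have h1 := Ring.mul_inverse_cancel _ h
  have h2 := Ring.inverse_mul_cancel _ h₀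
  have hcp : Commute (geomDefect m Y₀) (Y₀ ^ m) :=
    Commute.sum_left _ _ _ fun j _ => Commute.sum_left _ _ _ fun i _ =>
      (Commute.refl Y₀).pow_pow _ _
  have hcq : Commute (geomSum m Y₀) (Y₀ ^ m) :=
    Commute.sum_left _ _ _ fun j _ => (Commute.refl Y₀).pow_pow _ _
  have hcqi := commute_ringInverse hcq h₀
  set Qi := Ring.inverse (geomSum m Y)
  set Qi₀ := Ring.inverse (geomSum m Y₀)
  have h3 : geomDefect m Y₀ * Qi₀ * (Y₀ ^ m * (geomSum m Y - geomSum m Y₀) * Qi) =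
      Y₀ ^ m * (geomDefect m Y₀ * (Qi₀ - Qi)) := by
    calc _ = geomDefect m Y₀ * (Qi₀ * Y₀ ^ m) * ((geomSum m Y - geomSum m Y₀) * Qi) := by
          simp only [mul_assoc]
      _ = (geomDefect m Y₀ * Y₀ ^ m) * (Qi₀ * (geomSum m Y * Qi) - Qi₀ * geomSum m Y₀ * Qi) := by
          rw [hcqi.eq]
          simp only [mul_assoc, sub_mul, mul_sub]
      _ = _ := by rw [h1, h2, hcp.eq, one_mul, mul_one, mul_assoc]
  rw [h3]
  noncomm_ring

/-- In the variable `ν = w ^ (-1 / m)`, the difference of the resolvents of `Rᵐ` and `R₀ᵐ` at `w`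
is `σ_m` up to a function which is regular on the sector. -/
theorem smul_resDiff_eq {m : ℕ} (hm : 1 ≤ m) {R R₀ : E →L[ℂ] E} {D T : Nuc E}
    (hD : Nuc.val E D = R ^ m - R₀ ^ m) (hT : Nuc.val E T = R₀ ^ m * (R - R₀)) {ν : ℂ}
    (hν : ν ≠ 0) (ha : IsUnit (1 - ν • R)) (ha₀ : IsUnit (1 - ν • R₀))
    (h : IsUnit (geomSum m (ν • R))) (h₀ : IsUnit (geomSum m (ν • R₀))) :
    (-(m * (ν ^ (m + 1))⁻¹)) • resDiff (R ^ m) (R₀ ^ m) D (ν ^ m)⁻¹ =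
      ν ^ (m - 1) • sigmaNuc R R₀ D T ν + ν⁻¹ • defectNuc m R R₀ D T ν := by
  obtain ⟨u1, e1⟩ := isUnit_pow_sub hν ha h
  obtain ⟨u2, e2⟩ := isUnit_pow_sub hν ha₀ h₀
  apply Nuc.val_injective
  have h3 := natCast_mul_inverse_eq_add ha h
  have h4 := natCast_mul_inverse_eq_add ha₀ h₀
  have hpow : ν ^ (m - 1) = ν⁻¹ * ν ^ m := by
    obtain ⟨k, rfl⟩ : ∃ k, m = k + 1 := ⟨m - 1, by omega⟩
    rw [Nat.add_sub_cancel, pow_succ]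
    field_simp
  -- The derivative of `ν⁻ᵐ` times the prefactor of the resolvent of the power leaves `m / ν`, the
  -- `m` being the one in the partial fractions.
  have hco : -(m * (ν ^ (m + 1))⁻¹) * -(ν ^ m) = ν⁻¹ * m := by
    rw [pow_succ]
    field_simp
  have hnat (S : E →L[ℂ] E) : (ν⁻¹ * (m : ℂ)) • S = ν⁻¹ • ((m : E →L[ℂ] E) * S) := by
    rw [mul_smul, Nat.cast_smul_eq_nsmul ℂ m S, nsmul_eq_mul]
  rw [map_smul, val_resDiff hD u1 u2, e1, e2, ← smul_sub, smul_smul, hco, smul_sub, hnat, hnat, h3,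
    h4, map_add, map_smul, map_smul, val_sigmaNuc hD hT ha ha₀, val_defectNuc hD hT h h₀, hpow,
    mul_smul, smul_sub (ν ^ m), ← smul_mul_assoc (ν ^ m), ← smul_mul_assoc (ν ^ m), ← smul_pow,
    ← smul_pow, mul_add, mul_add]
  module

end SigmaNuc

/-! ### Test functions and distributions on an interval -/

section Distributions

open Filter Set MeasureTheory TopologicalSpace

variable {I J : Opens ℝ}

theorem norm_iteratedDeriv_le_supSeminorm {K : Compacts ℝ} (N : ℕ) (f : 𝓓_{K}(ℝ, ℝ)) {j : ℕ}
    (hj : j ≤ N) (x : ℝ) : ‖iteratedDeriv j f x‖ ≤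
      ((Finset.range (N + 1)).sup (ContDiffMapSupportedIn.seminorm ℝ ℝ ℝ ⊤ K)) f := by
  rw [← norm_iteratedFDeriv_eq_norm_iteratedDeriv]
  refine (ContDiffMapSupportedIn.norm_iteratedFDeriv_apply_le_seminorm_top ℝ).trans ?_
  have : ContDiffMapSupportedIn.seminorm ℝ ℝ ℝ ⊤ K j ≤
      (Finset.range (N + 1)).sup (ContDiffMapSupportedIn.seminorm ℝ ℝ ℝ ⊤ K) :=
    Finset.le_sup (f := ContDiffMapSupportedIn.seminorm ℝ ℝ ℝ ⊤ K)
      (Finset.mem_range.2 (by omega))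
  exact this f

/-- In the inductive limit topology continuity is tested on each space of functions supported in a
fixed compact set, where finitely many seminorms suffice. -/
theorem continuous_of_forall_compact_bound (Λ : 𝓓(I, ℝ) →ₗ[ℝ] ℂ)
    (h : ∀ K : Set ℝ, IsCompact K → K ⊆ I → ∃ (N : ℕ) (C : ℝ), 0 ≤ C ∧ ∀ f : 𝓓(I, ℝ),
      tsupport f ⊆ K → ∀ S : ℝ, (∀ j ≤ N, ∀ x, ‖iteratedDeriv j f x‖ ≤ S) → ‖Λ f‖ ≤ C * S) :
    Continuous Λ := by
  rw [TestFunction.continuous_iff_continuous_comp]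
  intro K hK
  obtain ⟨N, C, hC, h⟩ := h K K.isCompact hK
  exact (ContDiffMapSupportedIn.mkCLMtoNormedSpace ℝ (fun f => Λ (TestFunction.ofSupportedIn hK f))
    (fun f g => Λ.map_add (TestFunction.ofSupportedIn hK f) (TestFunction.ofSupportedIn hK g))
    (fun c f => Λ.map_smul c (TestFunction.ofSupportedIn hK f))
    ⟨Finset.range (N + 1), C, hC, fun f => h _ f.tsupport_subset _ fun j hj x =>
      norm_iteratedDeriv_le_supSeminorm N f hj x⟩).continuous

theorem continuous_testFunction_of_forall_compact_bound (Λ : 𝓓(I, ℝ) →ₗ[ℝ] 𝓓(J, ℝ))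
    (h : ∀ K : Set ℝ, IsCompact K → K ⊆ I → ∃ K' : Set ℝ, IsCompact K' ∧ K' ⊆ J ∧
      (∀ f : 𝓓(I, ℝ), tsupport f ⊆ K → ∀ x ∉ K', Λ f x = 0) ∧
      ∀ i : ℕ, ∃ (N : ℕ) (C : ℝ), 0 ≤ C ∧ ∀ f : 𝓓(I, ℝ), tsupport f ⊆ K →
        ∀ S : ℝ, (∀ j ≤ N, ∀ x, ‖iteratedDeriv j f x‖ ≤ S) →
          ∀ x ∈ K', ‖iteratedDeriv i (Λ f) x‖ ≤ C * S) :
    Continuous Λ := by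
  rw [TestFunction.continuous_iff_continuous_comp]
  intro K hK
  obtain ⟨K', hK', hJ, hs, h⟩ := h K K.isCompact hK
  let Φ := ContDiffMapSupportedIn.mkCLM ℝ (n₁ := ⊤) (n₂ := ⊤) (K₁ := K) (K₂ := ⟨K', hK'⟩)
    (fun f => Λ (TestFunction.ofSupportedIn hK f))
    (fun f g x => congrArg (fun u : 𝓓(J, ℝ) => u x) (Λ.map_add
      (TestFunction.ofSupportedIn hK f) (TestFunction.ofSupportedIn hK g)))
    (fun c f x => congrArg (fun u : 𝓓(J, ℝ) => u x)
      (Λ.map_smul c (TestFunction.ofSupportedIn hK f)))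
    (fun f => (Λ (TestFunction.ofSupportedIn hK f)).contDiff)
    (fun f x hx => hs _ f.tsupport_subset x hx) (fun i _ => by
      obtain ⟨N, C, hC, h⟩ := h i
      refine ⟨Finset.range (N + 1), C, hC, fun f x hx => ?_⟩
      rw [norm_iteratedFDeriv_eq_norm_iteratedDeriv]
      exact h (TestFunction.ofSupportedIn hK f) f.tsupport_subset _
        (fun j hj x => norm_iteratedDeriv_le_supSeminorm N f hj x) x hx)
  exact (TestFunction.continuous_ofSupportedIn (Ω := J) (K := ⟨K', hK'⟩) hJ).comp Φ.continuous

theorem norm_iteratedDeriv_ofReal_comp {f : ℝ → ℝ} (hf : ContDiff ℝ (⊤ : ℕ∞) f) (j : ℕ) (x : ℝ) :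
    ‖iteratedDeriv j (fun y => (f y : ℂ)) x‖ = ‖iteratedDeriv j f x‖ := by
  rw [← norm_iteratedFDeriv_eq_norm_iteratedDeriv, ← norm_iteratedFDeriv_eq_norm_iteratedDeriv]
  exact Complex.ofRealLI.norm_iteratedFDeriv_comp_left (hf.contDiffAt) (by exact_mod_cast le_top)

theorem TestFunction.contDiff_ofReal (f : 𝓓(I, ℝ)) :
    ContDiff ℝ (⊤ : ℕ∞) fun x => (f x : ℂ) :=
  Complex.ofRealCLM.contDiff.comp f.contDiff

theorem tsupport_ofReal_comp (f : ℝ → ℝ) : tsupport (fun x => (f x : ℂ)) = tsupport f := by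
  rw [tsupport, tsupport]
  congr 1
  ext x
  simp

theorem TestFunction.hasCompactSupport_ofReal (f : 𝓓(I, ℝ)) :
    HasCompactSupport fun x => (f x : ℂ) := by
  rw [HasCompactSupport, tsupport_ofReal_comp]
  exact f.hasCompactSupport

/-- The jump across the real axis of a holomorphic function of moderate growth is a
distribution. -/
theorem exists_jump_distribution {k : ℂ → ℂ} {M : ℕ} (hk : ∀ x ∈ J, ModerateAt k M (x : ℂ)) :
    ∃ T : 𝓓'(J, ℂ), ∀ f : 𝓓(J, ℝ), Tendsto (fun ε : ℝ => ∫ t : ℝ, (f t : ℂ) •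
      (k (t + ε * Complex.I) - k (t - ε * Complex.I))) (𝓝[>] 0) (𝓝 (T f)) := by
  have h1 (f : 𝓓(J, ℝ)) := exists_jump_bound f.hasCompactSupport.isCompact
    fun x hx => hk x (f.tsupport_subset hx)
  have h2 (f : 𝓓(J, ℝ)) : (∀ᶠ ε : ℝ in 𝓝[>] 0, Integrable fun t : ℝ =>
      (f t : ℂ) • (k (t + ε * Complex.I) - k (t - ε * Complex.I))) ∧
      ∃ L : ℂ, Tendsto (fun ε : ℝ => ∫ t : ℝ, (f t : ℂ) •
        (k (t + ε * Complex.I) - k (t - ε * Complex.I))) (𝓝[>] 0) (𝓝 L) := by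
    obtain ⟨S, hS⟩ := exists_iteratedDeriv_bound (TestFunction.contDiff_ofReal f)
      (TestFunction.hasCompactSupport_ofReal f) (M + 2)
    obtain ⟨C, -, h⟩ := h1 f
    obtain ⟨h3, L, -, h4⟩ := h _ (TestFunction.contDiff_ofReal f)
      (tsupport_ofReal_comp f).subset S hS
    exact ⟨h3, L, h4⟩
  choose hint L hL using h2
  let Λ : 𝓓(J, ℝ) →ₗ[ℝ] ℂ :=
    { toFun := L
      map_add' f g := by
        refine tendsto_nhds_unique (hL (f + g)) (((hL f).add (hL g)).congr' ?_)
        filter_upwards [hint f, hint g] with ε h1 h2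
        rw [← integral_add h1 h2]
        simp [add_mul]
      map_smul' r f := by
        refine tendsto_nhds_unique (hL (r • f)) (((hL f).const_smul r).congr fun ε => ?_)
        rw [← integral_smul]
        simp [mul_assoc] }
  have hΛ : Continuous Λ := by
    refine continuous_of_forall_compact_bound Λ fun K hK hKJ => ?_
    obtain ⟨C, hC, h⟩ := exists_jump_bound hK fun x hx => hk x (hKJ hx)
    refine ⟨M + 2, C, hC, fun f hf S hS => ?_⟩
    obtain ⟨-, L', h1, h2⟩ := h _ (TestFunction.contDiff_ofReal f)
      ((tsupport_ofReal_comp f).subset.trans hf) S fun j hj x => by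
        rw [norm_iteratedDeriv_ofReal_comp f.contDiff]; exact hS j hj x
    rwa [tendsto_nhds_unique h2 (hL f)] at h1
  exact ⟨⟨Λ, hΛ⟩, hL⟩

end Distributions

/-! ### Change of variables and primitives of distributions on an interval -/

section Operations

open Filter Set MeasureTheory TopologicalSpace

variable {I J : Opens ℝ}

/-- Differentiating `(f ∘ ρ) w` gives `(f' ∘ ρ) (ρ' w) + (f ∘ ρ) w'`, two expressions of the same
kind. Quantifying over the weight inside the induction avoids the formula for higher derivatives of
a composition. -/
theorem exists_iteratedDeriv_comp_mul_bound {ρ : ℝ → ℝ} (hρ : ContDiffOn ℝ (⊤ : ℕ∞) ρ J)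
    {K : Set ℝ} (hK : IsCompact K) (hKJ : K ⊆ J) (i : ℕ) :
    ∀ w : ℝ → ℝ, ContDiffOn ℝ (⊤ : ℕ∞) w J → ∃ C : ℝ, 0 ≤ C ∧ ∀ f : ℝ → ℝ,
      ContDiff ℝ (⊤ : ℕ∞) f → ∀ S : ℝ, (∀ j ≤ i, ∀ x, ‖iteratedDeriv j f x‖ ≤ S) →
        ∀ x ∈ K, ‖iteratedDeriv i (fun x => f (ρ x) * w x) x‖ ≤ C * S := by
  have hd {w : ℝ → ℝ} (hw : ContDiffOn ℝ (⊤ : ℕ∞) w J) : ContDiffOn ℝ (⊤ : ℕ∞) (deriv w) J :=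
    hw.deriv_of_isOpen J.isOpen (by simp)
  have hda {w : ℝ → ℝ} (hw : ContDiffOn ℝ (⊤ : ℕ∞) w J) {x : ℝ} (hx : x ∈ J) :
      DifferentiableAt ℝ w x :=
    (hw.contDiffAt (J.isOpen.mem_nhds hx)).differentiableAt (by simp)
  induction i with
  | zero =>
    intro w hw
    obtain ⟨C, hC⟩ := hK.exists_bound_of_continuousOn (hw.continuousOn.mono hKJ)
    refine ⟨|C|, abs_nonneg C, fun f _ S hS x hx => ?_⟩
    have h1 := hS 0 le_rfl (ρ x)
    rw [iteratedDeriv_zero] at h1 ⊢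
    rw [norm_mul, mul_comm]
    exact mul_le_mul ((hC x hx).trans (le_abs_self C)) h1 (norm_nonneg _) (abs_nonneg C)
  | succ i ih =>
    intro w hw
    obtain ⟨C₁, hC₁, h1⟩ := ih (fun x => deriv ρ x * w x) ((hd hρ).mul hw)
    obtain ⟨C₂, hC₂, h2⟩ := ih (deriv w) (hd hw)
    refine ⟨C₁ + C₂, by positivity, fun f hf S hS x hx => ?_⟩
    have hf' : ContDiff ℝ (⊤ : ℕ∞) (deriv f) := (contDiff_infty_iff_deriv.1 hf).2
    have hxJ : (J : Set ℝ) ∈ 𝓝 x := J.isOpen.mem_nhds (hKJ hx)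
    have he : deriv (fun x => f (ρ x) * w x) =ᶠ[𝓝 x]
        fun x => deriv f (ρ x) * (deriv ρ x * w x) + f (ρ x) * deriv w x := by
      filter_upwards [hxJ] with y hy
      have hfy : HasDerivAt f (deriv f (ρ y)) (ρ y) :=
        (hf.differentiable (by simp) _).hasDerivAt
      refine ((hfy.comp y (hda hρ hy).hasDerivAt).mul (hda hw hy).hasDerivAt).deriv.trans ?_
      simp only [Function.comp_apply]
      ring
    have hsm {u v : ℝ → ℝ} (hu : ContDiff ℝ (⊤ : ℕ∞) u) (hv : ContDiffOn ℝ (⊤ : ℕ∞) v J) :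
        ContDiffAt ℝ i (fun x => u (ρ x) * v x) x :=
      (((hu.comp_contDiffOn hρ).mul hv).contDiffAt hxJ).of_le (by exact_mod_cast le_top)
    rw [iteratedDeriv_succ', he.iteratedDeriv_eq,
      iteratedDeriv_fun_add (hsm hf' ((hd hρ).mul hw)) (hsm hf (hd hw)), add_mul]
    refine (norm_add_le _ _).trans (add_le_add (h1 _ hf' S (fun j hj y => ?_) x hx)
      (h2 f hf S (fun j hj y => hS j (by omega) y) x hx))
    rw [← iteratedDeriv_succ']
    exact hS (j + 1) (by omega) y

/-- The operator `f ↦ (f ∘ ρ) • w` between spaces of test functions, for a diffeomorphism `ρ` with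
inverse `κ`. -/
theorem exists_comp_mul_testFunction {ρ w κ : ℝ → ℝ} (hρ : ContDiffOn ℝ (⊤ : ℕ∞) ρ J)
    (hw : ContDiffOn ℝ (⊤ : ℕ∞) w J) (hκ : ContinuousOn κ I) (hκJ : MapsTo κ I J)
    (hκρ : ∀ x ∈ J, κ (ρ x) = x) :
    ∃ Φ : 𝓓(I, ℝ) →L[ℝ] 𝓓(J, ℝ), ∀ f, ∀ x ∈ J, Φ f x = f (ρ x) * w x := by
  classical
  -- Extension by zero is smooth since the support stays in the compact subset `κ '' tsupport f` of
  -- `J`.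
  let A (f : 𝓓(I, ℝ)) (x : ℝ) : ℝ := if x ∈ J then f (ρ x) * w x else 0
  have hcpt {K : Set ℝ} (hK : IsCompact K) (hKI : K ⊆ I) : IsCompact (κ '' K) :=
    hK.image_of_continuousOn (hκ.mono hKI)
  have hKJ {K : Set ℝ} (hKI : K ⊆ I) : κ '' K ⊆ J := (hκJ.mono_left hKI).image_subset
  have hzero {K : Set ℝ} (f : 𝓓(I, ℝ)) (hf : tsupport f ⊆ K) (x : ℝ) (hx : x ∉ κ '' K) :
      A f x = 0 := by
    by_cases hxJ : x ∈ J
    · have : f (ρ x) = 0 := by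
        by_contra h
        exact hx ⟨ρ x, hf (subset_tsupport f h), hκρ x hxJ⟩
      simp [A, this]
    · exact if_neg hxJ
  have hsupp (f : 𝓓(I, ℝ)) : tsupport (A f) ⊆ κ '' tsupport f :=
    closure_minimal (fun x hx => by_contra fun h => hx (hzero f subset_rfl x h))
      (hcpt f.hasCompactSupport.isCompact f.tsupport_subset).isClosed
  have heq (f : 𝓓(I, ℝ)) {x : ℝ} (hx : x ∈ J) : A f =ᶠ[𝓝 x] fun x => f (ρ x) * w x := by
    filter_upwards [J.isOpen.mem_nhds hx] with y hy using if_pos hy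
  have hsmooth (f : 𝓓(I, ℝ)) : ContDiff ℝ (⊤ : ℕ∞) (A f) := by
    rw [contDiff_iff_contDiffAt]
    intro x
    by_cases hx : x ∈ J
    · exact (((f.contDiff.comp_contDiffOn hρ).mul hw).contDiffAt
        (J.isOpen.mem_nhds hx)).congr_of_eventuallyEq (heq f hx)
    · have : A f =ᶠ[𝓝 x] fun _ => 0 := notMem_tsupport_iff_eventuallyEq.1
        fun h => hx (hKJ f.tsupport_subset (hsupp f h))
      exact contDiffAt_const.congr_of_eventuallyEq this
  let Λ : 𝓓(I, ℝ) →ₗ[ℝ] 𝓓(J, ℝ) :=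
    { toFun f := ⟨A f, hsmooth f,
        (hcpt f.hasCompactSupport.isCompact f.tsupport_subset).of_isClosed_subset
          (isClosed_tsupport _) (hsupp f), (hsupp f).trans (hKJ f.tsupport_subset)⟩
      map_add' f g := by
        ext x
        change A (f + g) x = A f x + A g x
        by_cases hx : x ∈ J <;> simp [A, hx, add_mul]
      map_smul' r f := by
        ext x
        change A (r • f) x = r * A f x
        by_cases hx : x ∈ J <;> simp [A, hx, mul_assoc] }
  refine ⟨⟨Λ, continuous_testFunction_of_forall_compact_bound Λ fun K hK hKI =>
    ⟨κ '' K, hcpt hK hKI, hKJ hKI, hzero, fun i => ?_⟩⟩, fun f x hx => if_pos hx⟩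
  obtain ⟨C, hC, h⟩ := exists_iteratedDeriv_comp_mul_bound hρ (hcpt hK hKI) (hKJ hKI) i w hw
  refine ⟨i, C, hC, fun f _ S hS x hx => ?_⟩
  have := h f f.contDiff S hS x hx
  rwa [← (heq f (hKJ hKI hx)).iteratedDeriv_eq] at this

theorem testFunction_lineDeriv_apply (f : 𝓓(I, ℝ)) (x : ℝ) : (∂_{(1 : ℝ)} f) x = deriv f x := by
  rw [TestFunction.lineDerivOp_eq_lineDerivCLM ℝ, TestFunction.lineDerivCLM_apply_of_le (by simp)]
  simp [lineDeriv, deriv_comp_const_add]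

theorem exists_testFunction_integral_eq_one (hJ : (J : Set ℝ).Nonempty) :
    ∃ ψ : 𝓓(J, ℝ), ∫ x, ψ x = 1 := by
  obtain ⟨p, hp⟩ := hJ
  obtain ⟨r, hr, hrJ⟩ := Metric.isOpen_iff.1 J.isOpen p hp
  let φ : ContDiffBump p := ⟨r / 4, r / 2, by positivity, by linarith⟩
  refine ⟨⟨φ.normed volume, φ.contDiff_normed, φ.hasCompactSupport_normed, ?_⟩,
    φ.integral_normed⟩
  rw [φ.tsupport_normed_eq]
  exact (Metric.closedBall_subset_ball (by simp [φ, hr])).trans hrJ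

theorem hasDerivAt_integral_Iic {u : ℝ → ℝ} (hu : Continuous u) (hi : Integrable u) (x : ℝ) :
    HasDerivAt (fun x => ∫ y in Iic x, u y) (u x) x := by
  have h1 : (fun x => ∫ y in Iic x, u y) = fun x => (∫ y in (0 : ℝ)..x, u y) + ∫ y in Iic 0, u y := by
    ext x
    rw [← intervalIntegral.integral_Iic_sub_Iic hi.integrableOn hi.integrableOn, sub_add_cancel]
  rw [h1]
  exact (intervalIntegral.integral_hasDerivAt_right (hu.intervalIntegrable _ _)
    hu.stronglyMeasurable.stronglyMeasurableAtFilter hu.continuousAt).add_const _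

/-- On an interval, a continuous right inverse, modulo a fixed test function, of the derivative of
test functions. -/
theorem exists_primitive_testFunction (hJ : (J : Set ℝ).OrdConnected) :
    ∃ P : 𝓓(J, ℝ) →L[ℝ] 𝓓(J, ℝ), ∀ g, P (∂_{(1 : ℝ)} g) = g := by
  rcases (J : Set ℝ).eq_empty_or_nonempty with he | hne
  · refine ⟨0, fun g => ?_⟩
    ext x
    have : x ∉ tsupport g := fun h => by simpa [he] using g.tsupport_subset h
    simp [image_eq_zero_of_notMem_tsupport this]
  obtain ⟨ψ, hψ⟩ := exists_testFunction_integral_eq_one hne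
  have hint (f : 𝓓(J, ℝ)) : Integrable f :=
    f.continuous.integrable_of_hasCompactSupport f.hasCompactSupport
  -- Subtracting a multiple of `ψ` makes the integral zero, so the primitive has compact support.
  -- Derivatives of test functions already have integral zero and are unchanged.
  let u (f : 𝓓(J, ℝ)) : 𝓓(J, ℝ) := f - (∫ x, f x) • ψ
  have hu (f : 𝓓(J, ℝ)) (x : ℝ) : u f x = f x - (∫ x, f x) * ψ x := by simp [u]
  have hu0 (f : 𝓓(J, ℝ)) : ∫ x, u f x = 0 := by
    simp_rw [hu]
    rw [integral_sub (hint f) ((hint ψ).const_mul _), integral_const_mul, hψ, mul_one, sub_self]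
  let A (f : 𝓓(J, ℝ)) (x : ℝ) : ℝ := ∫ y in Iic x, u f y
  have hA (f : 𝓓(J, ℝ)) (x : ℝ) : HasDerivAt (A f) (u f x) x :=
    hasDerivAt_integral_Iic (u f).continuous (hint _) x
  have hdA (f : 𝓓(J, ℝ)) : deriv (A f) = u f := funext fun x => (hA f x).deriv
  have hsmooth (f : 𝓓(J, ℝ)) : ContDiff ℝ (⊤ : ℕ∞) (A f) := by
    rw [contDiff_infty_iff_deriv]
    exact ⟨fun x => (hA f x).differentiableAt, by rw [hdA]; exact (u f).contDiff⟩
  -- This is where `J` has to be an interval: the primitive fills the gaps between the parts of the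
  -- support.
  have hbox {K : Set ℝ} (hK : IsCompact K) (hKJ : K ⊆ J) :
      ∃ a b : ℝ, Icc a b ⊆ J ∧ K ⊆ Icc a b ∧ tsupport ψ ⊆ Icc a b := by
    have hne' : (K ∪ tsupport ψ).Nonempty := by
      refine Nonempty.inr (nonempty_iff_ne_empty.2 fun h => ?_)
      have : (ψ : ℝ → ℝ) = 0 := tsupport_eq_empty_iff.1 h
      simp [this] at hψ
    have hc : IsCompact (K ∪ tsupport ψ) := hK.union ψ.hasCompactSupport.isCompact
    have hsub : K ∪ tsupport ψ ⊆ J := union_subset hKJ ψ.tsupport_subset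
    obtain ⟨a, ha, ha'⟩ := hc.exists_isLeast hne'
    obtain ⟨b, hb, hb'⟩ := hc.exists_isGreatest hne'
    exact ⟨a, b, hJ.out (hsub ha) (hsub hb), fun x hx => ⟨ha' (Or.inl hx), hb' (Or.inl hx)⟩,
      fun x hx => ⟨ha' (Or.inr hx), hb' (Or.inr hx)⟩⟩
  have huzero (f : 𝓓(J, ℝ)) {a b : ℝ} (hf : tsupport f ⊆ Icc a b) (h : tsupport ψ ⊆ Icc a b)
      (x : ℝ) (hx : x ∉ Icc a b) : u f x = 0 := by
    rw [hu, image_eq_zero_of_notMem_tsupport fun h' => hx (hf h'),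
      image_eq_zero_of_notMem_tsupport fun h' => hx (h h')]
    ring
  have hzero (f : 𝓓(J, ℝ)) {a b : ℝ} (hf : tsupport f ⊆ Icc a b) (h : tsupport ψ ⊆ Icc a b)
      (x : ℝ) (hx : x ∉ Icc a b) : A f x = 0 := by
    rw [mem_Icc, not_and_or, not_le, not_le] at hx
    rcases hx with hx | hx
    · refine setIntegral_eq_zero_of_forall_eq_zero fun y hy => huzero f hf h y fun h' => ?_
      exact absurd (h'.1.trans hy) (not_le.2 hx)
    · rw [← hu0 f]
      refine setIntegral_eq_integral_of_forall_compl_eq_zero fun y hy => huzero f hf h y fun h' => ?_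
      exact hy (h'.2.trans hx.le)
  have hsupp (f : 𝓓(J, ℝ)) : HasCompactSupport (A f) ∧ tsupport (A f) ⊆ J := by
    obtain ⟨a, b, h1, h2, h3⟩ := hbox f.hasCompactSupport.isCompact f.tsupport_subset
    have : tsupport (A f) ⊆ Icc a b :=
      closure_minimal (fun x hx => by_contra fun h => hx (hzero f h2 h3 x h)) isClosed_Icc
    exact ⟨isCompact_Icc.of_isClosed_subset (isClosed_tsupport _) this, this.trans h1⟩
  let Λ : 𝓓(J, ℝ) →ₗ[ℝ] 𝓓(J, ℝ) :=
    { toFun f := ⟨A f, hsmooth f, (hsupp f).1, (hsupp f).2⟩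
      map_add' f g := by
        have hfg (y : ℝ) : u (f + g) y = u f y + u g y := by
          have h1 (y : ℝ) : (f + g) y = f y + g y := rfl
          simp only [hu, h1, integral_add (hint f) (hint g)]
          ring
        ext x
        change ∫ y in Iic x, u (f + g) y = (∫ y in Iic x, u f y) + ∫ y in Iic x, u g y
        rw [← integral_add (hint _).integrableOn (hint _).integrableOn]
        simp only [hfg]
      map_smul' r f := by
        have hrf (y : ℝ) : u (r • f) y = r * u f y := by
          have h1 (y : ℝ) : (r • f) y = r * f y := rfl
          simp only [hu, h1, integral_const_mul]
          ring
        ext x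
        change ∫ y in Iic x, u (r • f) y = r * ∫ y in Iic x, u f y
        simp only [hrf, integral_const_mul] }
  refine ⟨⟨Λ, continuous_testFunction_of_forall_compact_bound Λ fun K hK hKJ => ?_⟩, fun g => ?_⟩
  · obtain ⟨a, b, h1, h2, h3⟩ := hbox hK hKJ
    refine ⟨Icc a b, isCompact_Icc, h1, fun f hf => hzero f (hf.trans h2) h3, fun i => ?_⟩
    have hψ' (i : ℕ) : ∃ C : ℝ, ∀ x, ‖iteratedDeriv i ψ x‖ ≤ C := by
      obtain ⟨S, hS⟩ := exists_iteratedDeriv_bound (TestFunction.contDiff_ofReal ψ)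
        (TestFunction.hasCompactSupport_ofReal ψ) i
      exact ⟨S, fun x => by rw [← norm_iteratedDeriv_ofReal_comp ψ.contDiff]; exact hS i le_rfl x⟩
    have hI (f : 𝓓(J, ℝ)) (hf : tsupport f ⊆ K) (S : ℝ) (hS : ∀ x, ‖f x‖ ≤ S) :
        |∫ x, f x| ≤ S * volume.real (Icc a b) := by
      rw [← setIntegral_eq_integral_of_forall_compl_eq_zero (s := Icc a b) (f := f) fun x hx =>
        image_eq_zero_of_notMem_tsupport fun h' => hx (h2 (hf h'))]
      exact norm_setIntegral_le_of_norm_le_const measure_Icc_lt_top fun x _ => hS x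
    set v := volume.real (Icc a b) with hv
    have hv0 : 0 ≤ v := measureReal_nonneg
    have hub (i : ℕ) : ∃ C : ℝ, 0 ≤ C ∧ ∀ f : 𝓓(J, ℝ), tsupport f ⊆ K → ∀ S : ℝ,
        (∀ j ≤ i, ∀ x, ‖iteratedDeriv j f x‖ ≤ S) → ∀ x, ‖iteratedDeriv i (u f) x‖ ≤ C * S := by
      obtain ⟨C, hC⟩ := hψ' i
      have hC0 : 0 ≤ C := (norm_nonneg _).trans (hC 0)
      refine ⟨1 + v * C, by positivity, fun f hf S hS x => ?_⟩
      have h4 : (u f : ℝ → ℝ) = fun x => f x - (∫ x, f x) * ψ x := funext (hu f)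
      have hsm (f : 𝓓(J, ℝ)) : ContDiffAt ℝ i f x :=
        f.contDiff.contDiffAt.of_le (by exact_mod_cast le_top)
      rw [h4, iteratedDeriv_fun_sub (hsm f) (contDiffAt_const.mul (hsm ψ)),
        iteratedDeriv_const_mul_field]
      refine (norm_sub_le _ _).trans ?_
      rw [norm_mul, add_mul, one_mul, mul_right_comm, mul_comm v]
      exact add_le_add (hS i le_rfl x) (mul_le_mul (hI f hf S fun y => by
        simpa using hS 0 (Nat.zero_le _) y) (hC x) (norm_nonneg _)
        (mul_nonneg ((norm_nonneg _).trans (hS i le_rfl x)) hv0))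
    -- The primitive itself is bounded by the length of the box, and its derivatives are those of
    -- `u`.
    rcases i with _ | i
    · obtain ⟨C, hC, h⟩ := hub 0
      refine ⟨0, C * v, by positivity, fun f hf S hS x hx => ?_⟩
      have h5 := h f hf S hS
      simp only [iteratedDeriv_zero] at h5 ⊢
      change ‖∫ y in Iic x, u f y‖ ≤ _
      have h6 : ∫ y in Iic x, u f y = ∫ y in Iic x ∩ Icc a b, u f y :=
        (setIntegral_eq_of_subset_of_forall_sdiff_eq_zero measurableSet_Iic inter_subset_left
          fun y hy => huzero f (hf.trans h2) h3 y fun h' => hy.2 ⟨hy.1, h'⟩)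
      have hlt : volume (Iic x ∩ Icc a b) < ⊤ :=
        (measure_mono inter_subset_right).trans_lt measure_Icc_lt_top
      rw [h6, mul_right_comm]
      refine (norm_setIntegral_le_of_norm_le_const hlt fun y _ => h5 y).trans ?_
      exact mul_le_mul_of_nonneg_left (measureReal_mono inter_subset_right measure_Icc_lt_top.ne)
        ((norm_nonneg _).trans (h5 x))
    · obtain ⟨C, hC, h⟩ := hub i
      refine ⟨i, C, hC, fun f hf S hS x _ => ?_⟩
      rw [iteratedDeriv_succ']
      change ‖iteratedDeriv i (deriv (A f)) x‖ ≤ _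
      rw [hdA]
      exact h f hf S hS x
  · have hg : ((∂_{(1 : ℝ)} g : 𝓓(J, ℝ)) : ℝ → ℝ) = deriv g := funext (testFunction_lineDeriv_apply g)
    have hg0 : ∫ x, deriv g x = 0 := by
      refine integral_eq_zero_of_hasDerivAt_of_integrable (f := g) (fun x => ?_)
        (hg ▸ hint (∂_{(1 : ℝ)} g)) (hint g)
      exact (g.contDiff.differentiable (by simp) x).hasDerivAt
    ext x
    change ∫ y in Iic x, u (∂_{(1 : ℝ)} g) y = g x
    simp only [hu, hg0, zero_mul, sub_zero, testFunction_lineDeriv_apply]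
    exact g.hasCompactSupport.integral_Iic_deriv_eq (g.contDiff.of_le (by simp)) x

end Operations

/-! ### Conformal change of variables in the Helffer–Sjöstrand formula -/

section Conformal

open Complex Filter Set MeasureTheory ComplexConjugate

/-- The real derivative of `w` is multiplication by `w'`; in the chain rule only the antiholomorphic
part of the derivative of `V` survives `dbar`, scaled by `conj w'`. -/
theorem dbar_comp_of_hasDerivAt {V w : ℂ → ℂ} {w' z : ℂ} (hV : DifferentiableAt ℝ V (w z))
    (hw : HasDerivAt w w' z) : dbar (V ∘ w) z = conj w' * dbar V (w z) := by
  have h1 : fderiv ℝ (V ∘ w) z = (fderiv ℝ V (w z)).comp (w' • (1 : ℂ →L[ℝ] ℂ)) :=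
    (hV.hasFDerivAt.comp z hw.complexToReal_fderiv).fderiv
  have h2 (a b : ℝ) : fderiv ℝ V (w z) (a + b * I) =
      a * fderiv ℝ V (w z) 1 + b * fderiv ℝ V (w z) I := by
    have : (a + b * I : ℂ) = a • (1 : ℂ) + b • I := by simp
    rw [this, map_add, map_smul, map_smul, real_smul, real_smul]
  have h3 : w' * I = ((-w'.im : ℝ) : ℂ) + (w'.re : ℝ) * I := by
    apply Complex.ext <;> simp
  have h4 : (conj w' : ℂ) = (w'.re : ℂ) - w'.im * I := by
    apply Complex.ext <;> simp
  have h5 : fderiv ℝ V (w z) w' = w'.re * fderiv ℝ V (w z) 1 + w'.im * fderiv ℝ V (w z) I := by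
    rw [← h2, re_add_im]
  have h6 (x : ℂ) : (w' • (1 : ℂ →L[ℝ] ℂ)) x = w' * x := rfl
  simp only [dbar, h1, ContinuousLinearMap.comp_apply, h6, mul_one]
  rw [h3, h2, h5, h4]
  push_cast
  linear_combination (1 / 2 * w'.im * fderiv ℝ V (w z) I) * I_sq

theorem det_smul_one (c : ℂ) : (c • (1 : ℂ →L[ℝ] ℂ)).det = normSq c := by
  have h1 : ((c • (1 : ℂ →L[ℝ] ℂ) : ℂ →L[ℝ] ℂ) : ℂ →ₗ[ℝ] ℂ) = LinearMap.mul ℝ ℂ c := by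
    ext
    simp
  rw [ContinuousLinearMap.det, h1, ← Algebra.norm_complex_apply]
  rfl

/-- The Jacobian of a conformal map is `conj w' * w'`: the first factor is absorbed by `dbar U`, the
second stays with `h`. Extending `V ∘ w` by zero off `S` is harmless because its support is the
compact set `r '' tsupport V`. -/
theorem exists_comp_conformal {S : Set ℂ} (hS : IsOpen S) {w w' r V : ℂ → ℂ}
    (hw : ∀ z ∈ S, HasDerivAt w (w' z) z) (hinj : InjOn w S) (hV : ContDiff ℝ 1 V)
    (hVc : HasCompactSupport V) (hr : ContinuousOn r (tsupport V)) (hrS : MapsTo r (tsupport V) S)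
    (hwr : ∀ q ∈ tsupport V, w (r q) = q) :
    ∃ U : ℂ → ℂ, ContDiff ℝ 1 U ∧ HasCompactSupport U ∧ tsupport U ⊆ r '' tsupport V ∧
      (∀ z ∈ S, U z = V (w z)) ∧ (∀ z ∈ S, dbar U z = conj (w' z) * dbar V (w z)) ∧
      ∀ h : ℂ → ℂ, ∫ q, dbar V q * h q = ∫ z, dbar U z * (w' z * h (w z)) := by
  classical
  let U (z : ℂ) : ℂ := if z ∈ S then V (w z) else 0
  have hK : IsCompact (r '' tsupport V) := hVc.isCompact.image_of_continuousOn hr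
  have hsub : r '' tsupport V ⊆ S := hrS.image_subset
  have hsupp : tsupport U ⊆ r '' tsupport V := by
    refine closure_minimal (fun z hz => ?_) hK.isClosed
    by_cases hzS : z ∈ S
    · have h1 : w z ∈ tsupport V := subset_tsupport V (by simpa [U, hzS] using hz)
      exact ⟨w z, h1, hinj (hrS h1) hzS (hwr _ h1)⟩
    · exact absurd (if_neg hzS) hz
  have heq {z : ℂ} (hz : z ∈ S) : U =ᶠ[𝓝 z] V ∘ w := by
    filter_upwards [hS.mem_nhds hz] with y hy using if_pos hy
  have hwc : ContDiffOn ℝ 1 w S :=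
    (DifferentiableOn.contDiffOn (n := 1)
      (fun z hz => (hw z hz).differentiableAt.differentiableWithinAt) hS).restrict_scalars ℝ
  have hdbar (z : ℂ) (hz : z ∈ S) : dbar U z = conj (w' z) * dbar V (w z) := by
    rw [← dbar_comp_of_hasDerivAt (hV.differentiable (by simp) _) (hw z hz), dbar, dbar,
      (heq hz).fderiv_eq]
  refine ⟨U, ?_, hK.of_isClosed_subset (isClosed_tsupport U) hsupp, hsupp, fun z hz => if_pos hz,
    hdbar, fun h => ?_⟩
  · rw [contDiff_iff_contDiffAt]
    intro z
    by_cases hz : z ∈ S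
    · exact ((hV.comp_contDiffOn hwc).contDiffAt (hS.mem_nhds hz)).congr_of_eventuallyEq (heq hz)
    · exact contDiffAt_const.congr_of_eventuallyEq
        (notMem_tsupport_iff_eventuallyEq.1 fun h => hz (hsub (hsupp h)))
  · have h1 : ∫ q, dbar V q * h q = ∫ q in w '' S, dbar V q * h q := by
      refine (setIntegral_eq_integral_of_forall_compl_eq_zero fun q hq => ?_).symm
      rw [dbar_eq_zero_of_notMem fun hq' => hq ⟨r q, hrS hq', hwr q hq'⟩, zero_mul]
    have h2 : ∫ z, dbar U z * (w' z * h (w z)) = ∫ z in S, dbar U z * (w' z * h (w z)) := by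
      refine (setIntegral_eq_integral_of_forall_compl_eq_zero fun z hz => ?_).symm
      rw [dbar_eq_zero_of_notMem fun hz' => hz (hsub (hsupp hz')), zero_mul]
    rw [h1, h2, integral_image_eq_integral_abs_det_fderiv_smul volume hS.measurableSet
      (fun z hz => (hw z hz).complexToReal_fderiv.hasFDerivWithinAt) hinj]
    refine setIntegral_congr_fun hS.measurableSet fun z hz => ?_
    simp only [det_smul_one, abs_of_nonneg (normSq_nonneg _), real_smul, hdbar z hz]
    rw [normSq_eq_conj_mul_self]
    ring

end Conformal

/-! ### The jump of `σ_m` across the real axis -/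

section Jump

open Complex Filter Set MeasureTheory ComplexConjugate

theorem exists_pos_forall_add_mul_I_mem {K : Set ℝ} (hK : IsCompact K) {G : Set ℂ}
    (hG : ∀ x ∈ K, G ∈ 𝓝 (x : ℂ)) :
    ∃ δ > 0, ∀ t ∈ K, ∀ ε : ℝ, |ε| < δ → (t + ε * I : ℂ) ∈ G := by
  obtain ⟨δ, hδ, hsub⟩ := (hK.image continuous_ofReal).exists_thickening_subset_open
    (isOpen_interior (s := G)) (by
      rintro _ ⟨x, hx, rfl⟩
      exact mem_interior_iff_mem_nhds.2 (hG x hx))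
  refine ⟨δ, hδ, fun t ht ε hε => interior_subset (hsub ?_)⟩
  exact Metric.mem_thickening_iff.2 ⟨t, mem_image_of_mem _ ht, by simpa [dist_eq] using hε⟩

/-- A function continuous across the axis has no jump; it is bounded on a compact strip around the
support of `f`, so dominated convergence applies. -/
theorem tendsto_jump_of_continuousAt {f : ℝ → ℂ} {k : ℂ → ℂ} (hf : Continuous f)
    (hc : HasCompactSupport f) (hk : ∀ t ∈ tsupport f, ∀ᶠ z in 𝓝 (t : ℂ), ContinuousAt k z) :
    (∀ᶠ ε : ℝ in 𝓝[>] 0, Integrable fun t : ℝ => f t • (k (t + ε * I) - k (t - ε * I))) ∧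
    Tendsto (fun ε : ℝ => ∫ t : ℝ, f t • (k (t + ε * I) - k (t - ε * I))) (𝓝[>] 0) (𝓝 0) := by
  obtain ⟨δ, hδ, h⟩ := exists_pos_forall_add_mul_I_mem hc.isCompact hk
  have hcpt : IsCompact ((fun p : ℝ × ℝ => (p.1 + p.2 * I : ℂ)) ''
      (tsupport f ×ˢ Icc (-(δ / 2)) (δ / 2))) :=
    (hc.isCompact.prod isCompact_Icc).image (by fun_prop)
  obtain ⟨C, hC⟩ := hcpt.exists_bound_of_continuousOn (f := k) (by
    rintro _ ⟨⟨t, s⟩, ⟨ht, hs⟩, rfl⟩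
    exact (h t ht s ((abs_le.2 hs).trans_lt (by linarith))).continuousWithinAt)
  have hsmall : ∀ᶠ ε : ℝ in 𝓝[>] 0, |ε| ≤ δ / 2 := by
    filter_upwards [Ioo_mem_nhdsGT (half_pos hδ)] with ε hε
    exact abs_le.2 ⟨by linarith [hε.1], hε.2.le⟩
  have hsub (t ε : ℝ) : (t - ε * I : ℂ) = t + (-ε : ℝ) * I := by push_cast; ring
  have hcont {ε : ℝ} (hε : |ε| ≤ δ / 2) :
      Continuous fun t : ℝ => f t • (k (t + ε * I) - k (t - ε * I)) := by
    rw [← continuousOn_univ]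
    refine continuousOn_smul_of_tsupport hf (fun z hz => image_eq_zero_of_notMem_tsupport hz)
      fun t ht _ => ?_
    have h1 : ContinuousAt k (t + ε * I) := h t ht ε (hε.trans_lt (by linarith))
    have h2 : ContinuousAt k (t - ε * I) := by
      rw [hsub]
      exact h t ht (-ε) (by rw [abs_neg]; exact hε.trans_lt (by linarith))
    exact (ContinuousAt.comp (f := fun t : ℝ => (t + ε * I : ℂ)) h1 (by fun_prop)).sub
      (ContinuousAt.comp (f := fun t : ℝ => (t - ε * I : ℂ)) h2 (by fun_prop))
  have hbound {ε : ℝ} (hε : |ε| ≤ δ / 2) (t : ℝ) :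
      ‖f t • (k (t + ε * I) - k (t - ε * I))‖ ≤ ‖f t‖ * (C + C) := by
    by_cases ht : t ∈ tsupport f
    · rw [norm_smul]
      refine mul_le_mul_of_nonneg_left ((norm_sub_le _ _).trans (add_le_add ?_ ?_)) (norm_nonneg _)
      · exact hC _ ⟨(t, ε), ⟨ht, abs_le.1 hε⟩, rfl⟩
      · rw [hsub]
        exact hC _ ⟨(t, -ε), ⟨ht, abs_le.1 (by rwa [abs_neg])⟩, rfl⟩
    · simp [image_eq_zero_of_notMem_tsupport ht]
  have hfi : Integrable fun t => ‖f t‖ * (C + C) :=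
    (hf.integrable_of_hasCompactSupport hc).norm.mul_const _
  refine ⟨hsmall.mono fun ε hε => hfi.mono' (hcont hε).aestronglyMeasurable
    (Eventually.of_forall (hbound hε)), ?_⟩
  have hlim := tendsto_integral_filter_of_dominated_convergence (μ := volume) (l := 𝓝[>] (0 : ℝ))
    (F := fun (ε : ℝ) (t : ℝ) => f t • (k (t + ε * I) - k (t - ε * I))) (f := fun _ => (0 : ℂ))
    (fun t => ‖f t‖ * (C + C)) (hsmall.mono fun ε hε => (hcont hε).aestronglyMeasurable)
    (hsmall.mono fun ε hε => Eventually.of_forall (hbound hε)) hfi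
    (Eventually.of_forall fun t => ?_)
  · simpa using hlim
  · by_cases ht : t ∈ tsupport f
    · have h1 : ContinuousAt k (t : ℂ) := (hk t ht).self_of_nhds
      have h2 : Tendsto (fun ε : ℝ => (t + ε * I : ℂ)) (𝓝[>] 0) (𝓝 (t : ℂ)) := by
        refine tendsto_nhdsWithin_of_tendsto_nhds ?_
        have : Continuous fun ε : ℝ => (t + ε * I : ℂ) := by fun_prop
        simpa using this.tendsto 0
      have h3 : Tendsto (fun ε : ℝ => (t - ε * I : ℂ)) (𝓝[>] 0) (𝓝 (t : ℂ)) := by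
        refine tendsto_nhdsWithin_of_tendsto_nhds ?_
        have : Continuous fun ε : ℝ => (t - ε * I : ℂ) := by fun_prop
        simpa using this.tendsto 0
      simpa using ((h1.tendsto.comp h2).sub (h1.tendsto.comp h3)).const_smul (f t)
    · simp [image_eq_zero_of_notMem_tsupport ht]

theorem ModerateAt.mono {F : Type*} [NormedAddCommGroup F] [NormedSpace ℂ F] {k : ℂ → F} {M N : ℕ}
    {p : ℂ} (h : ModerateAt k M p) (hMN : M ≤ N) : ModerateAt k N p := by
  obtain ⟨C, hC⟩ := h
  have h1 : ∀ᶠ z : ℂ in 𝓝 p, |z.im| < |p.im| + 1 :=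
    (continuous_im.abs.tendsto p).eventually_lt_const (lt_add_one _)
  refine ⟨|C| * (|p.im| + 1) ^ (N - M), ?_⟩
  filter_upwards [hC, h1] with z hz hz1 hne
  obtain ⟨h2, h3⟩ := hz hne
  refine ⟨h2, ?_⟩
  rw [← Nat.add_sub_cancel' hMN, pow_add, ← mul_assoc, Nat.add_sub_cancel_left]
  gcongr
  exact h3.trans (le_abs_self C)

variable {E : Type*} [NormedAddCommGroup E] [InnerProductSpace ℂ E] [CompleteSpace E]

/-- `w'(z) ((X - w(z))⁻¹ - (X₀ - w(z))⁻¹)` for `w(z) = (z + c)⁻ᵐ`. -/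
def resDiffComp (X X₀ : E →L[ℂ] E) (D : Nuc E) (c : ℝ) (m : ℕ) (z : ℂ) : Nuc E :=
  (-(m * ((z + c) ^ (m + 1))⁻¹)) • resDiff X X₀ D ((z + c) ^ m)⁻¹

theorem hasDerivAt_shift_inv_pow {c : ℝ} {m : ℕ} (hm : 1 ≤ m) {z : ℂ} (hz : z + c ≠ 0) :
    HasDerivAt (fun z : ℂ => ((z + c) ^ m)⁻¹) (-(m * ((z + c) ^ (m + 1))⁻¹)) z :=
  (hasDerivAt_inv_pow hm hz).comp_add_const z (c : ℂ)

theorem eventually_add_mem_sector {c t : ℝ} {m : ℕ} (hm : 1 ≤ m) (ht : 0 < t + c) :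
    ∀ᶠ z : ℂ in 𝓝 (t : ℂ), z + c ∈ sector m := by
  have h1 : ContinuousAt (fun z : ℂ => z + c) t := by fun_prop
  refine h1.eventually_mem ((isOpen_sector hm).mem_nhds ?_)
  rw [← ofReal_add]
  exact ofReal_mem_sector hm ht

/-- The derivative of `(z + c)⁻ᵐ` is locally bounded near `t`, so the growth is that of the two
resolvents written in the variable `z`. -/
theorem moderateAt_resDiffComp {X X₀ : E →L[ℂ] E} (D : Nuc E) {c t : ℝ} {m M M₀ : ℕ} (hm : 1 ≤ m)
    (ht : 0 < t + c)
    (h : ∃ C : ℝ, ∀ᶠ z in 𝓝 (t : ℂ), z.im ≠ 0 →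
      IsUnit (X - algebraMap ℂ _ ((z + c) ^ m)⁻¹) ∧
      ‖Ring.inverse (X - algebraMap ℂ _ ((z + c) ^ m)⁻¹)‖ * |z.im| ^ M ≤ C)
    (h₀ : ∃ C : ℝ, ∀ᶠ z in 𝓝 (t : ℂ), z.im ≠ 0 →
      IsUnit (X₀ - algebraMap ℂ _ ((z + c) ^ m)⁻¹) ∧
      ‖Ring.inverse (X₀ - algebraMap ℂ _ ((z + c) ^ m)⁻¹)‖ * |z.im| ^ M₀ ≤ C) :
    ModerateAt (resDiffComp X X₀ D c m) (M + M₀) t := by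
  obtain ⟨C, hC⟩ := h
  obtain ⟨C₀, hC₀⟩ := h₀
  have htc : (t : ℂ) + c ≠ 0 := by
    rw [← ofReal_add]
    exact ofReal_ne_zero.2 ht.ne'
  have hw' {z : ℂ} (hz : z + c ≠ 0) :
      DifferentiableAt ℂ (fun z : ℂ => -(m * ((z + c) ^ (m + 1))⁻¹ : ℂ)) z :=
    (((differentiableAt_id.add_const (c : ℂ)).pow (m + 1)).inv (pow_ne_zero _ hz)).const_mul
      (m : ℂ) |>.neg
  set L : ℝ := ‖(-(m * (((t : ℂ) + c) ^ (m + 1))⁻¹ : ℂ))‖ + 1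
  refine ⟨L * (|C| * ‖D‖ * |C₀|), ?_⟩
  filter_upwards [hC, hC₀, eventually_add_mem_sector hm ht,
    (hw' htc).continuousAt.norm.eventually_lt_const (lt_add_one _)] with z hz hz₀ hs hL hne
  obtain ⟨h1, h2⟩ := hz hne
  obtain ⟨h3, h4⟩ := hz₀ hne
  have h5 : DifferentiableAt ℂ (resDiff X X₀ D ∘ fun z : ℂ => ((z + c) ^ m)⁻¹) z :=
    DifferentiableAt.comp (g := resDiff X X₀ D) (f := fun z : ℂ => ((z + c) ^ m)⁻¹) z
      (differentiableAt_resDiff D h1 h3) (hasDerivAt_shift_inv_pow hm hs.1).differentiableAt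
  refine ⟨(hw' hs.1).smul h5, ?_⟩
  rw [resDiffComp, norm_smul, mul_assoc]
  exact mul_le_mul hL.le (norm_resDiff_mul_pow_le D (abs_nonneg _) h2 h4) (by positivity)
    (by positivity)

/-- The trace of `F(X) - F(X₀)` as a jump across the real axis in the variable `z` for which the spectral parameter is
`(z + c)⁻ᵐ`. -/
theorem tendsto_jump_resDiffComp {X X₀ : E →L[ℂ] E} {D : Nuc E}
    (hD : Nuc.val E D = X - X₀) {c : ℝ} {m M M₀ : ℕ} (hm : 1 ≤ m) {F f : ℝ → ℂ}
    (hF : ContDiff ℝ (⊤ : ℕ∞) F) (hFc : HasCompactSupport F)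
    (hf : ∀ t, 0 < t + c → f t = F ((t + c) ^ m)⁻¹) (hf' : ∀ t, t + c ≤ 0 → f t = 0)
    (h : ∀ x ∈ tsupport F, ∃ t : ℝ, 0 < t + c ∧ x = ((t + c) ^ m)⁻¹ ∧
      (∃ C : ℝ, ∀ᶠ z in 𝓝 (t : ℂ), z.im ≠ 0 →
        IsUnit (X - algebraMap ℂ _ ((z + c) ^ m)⁻¹) ∧
        ‖Ring.inverse (X - algebraMap ℂ _ ((z + c) ^ m)⁻¹)‖ * |z.im| ^ M ≤ C) ∧
      (∃ C : ℝ, ∀ᶠ z in 𝓝 (t : ℂ), z.im ≠ 0 →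
        IsUnit (X₀ - algebraMap ℂ _ ((z + c) ^ m)⁻¹) ∧
        ‖Ring.inverse (X₀ - algebraMap ℂ _ ((z + c) ^ m)⁻¹)‖ * |z.im| ^ M₀ ≤ C))
    {B B₀ : E →L[ℂ] E} (hB : IsFunctionOf X F B) (hB₀ : IsFunctionOf X₀ F B₀) :
    (∀ᶠ ε : ℝ in 𝓝[>] 0, Integrable fun t : ℝ => f t •
      (Nuc.tr E (resDiffComp X X₀ D c m (t + ε * I)) -
        Nuc.tr E (resDiffComp X X₀ D c m (t - ε * I)))) ∧
    Tendsto (fun ε : ℝ => ∫ t : ℝ, f t • (Nuc.tr E (resDiffComp X X₀ D c m (t + ε * I)) -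
        Nuc.tr E (resDiffComp X X₀ D c m (t - ε * I)))) (𝓝[>] 0)
      (𝓝 (2 * Real.pi * I * trace (B - B₀))) := by
  obtain ⟨N₀, hN₀⟩ := trace_isFunctionOf_sub hD (M := M) (M₀ := M₀) hF hFc hB hB₀
  set N := max N₀ (M + M₀)
  set k : ℂ → ℂ := fun z => Nuc.tr E (resDiffComp X X₀ D c m z)
  let S : Set ℂ := {z | z + c ∈ sector m}
  let r (q : ℂ) : ℂ := invRoot m q - c
  let w (z : ℂ) : ℂ := ((z + c) ^ m)⁻¹
  have hS : IsOpen S := (isOpen_sector hm).preimage (by fun_prop)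
  have hrw {t : ℝ} (ht : 0 < t + c) : r ((((t + c) ^ m)⁻¹ : ℝ) : ℂ) = t := by
    have := invRoot_inv_pow hm (ofReal_mem_sector hm ht)
    push_cast at this
    simp [r, this]
  have hrc {q : ℂ} (hq : 0 < q.re) : ContinuousAt r q := (continuousAt_invRoot hq).sub_const _
  -- The cone is taken so narrow that it lies in the right half plane, that both resolvents are
  -- moderate on it in the variable `q`, and that `k` is moderate at the corresponding points `r q`.
  obtain ⟨τ, hτ, hsub⟩ := exists_cutoff hFc.isCompact (G := {q | 0 < q.re ∧
      ResolventModerateAt X M q ∧ ResolventModerateAt X₀ M₀ q ∧ ModerateAt k N (r q)}) (by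
    intro x hx
    obtain ⟨t, ht, rfl, h1, h2⟩ := h x hx
    have hpos : 0 < ((((t + c) ^ m)⁻¹ : ℝ) : ℂ).re := by rw [ofReal_re]; positivity
    have h3 : ModerateAt k N (r ((((t + c) ^ m)⁻¹ : ℝ) : ℂ)) := by
      rw [hrw ht]
      exact ((moderateAt_resDiffComp D hm ht h1 h2).clm_comp (Nuc.tr E)).mono (le_max_right _ _)
    exact (continuous_re.continuousAt.eventually_const_lt hpos).and
      ((resolventModerateAt_of_comp hm ht h1).eventually.and
      ((resolventModerateAt_of_comp hm ht h2).eventually.and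
      ((hrc hpos).eventually h3.eventually))))
  have hV := contDiff_almostAnalytic hF N hτ
  have hVc := hasCompactSupport_almostAnalytic hFc N hτ
  have hVs (q : ℂ) (hq : q ∈ tsupport (almostAnalytic F N τ)) :=
    hsub (tsupport_almostAnalytic F N τ hq)
  obtain ⟨U, hU, hUc, hUs, hUeq, hUd, hUi⟩ := exists_comp_conformal hS (w := w) (r := r)
    (w' := fun z => -(m * ((z + c) ^ (m + 1))⁻¹)) (fun z hz => hasDerivAt_shift_inv_pow hm hz.1)
    (fun z hz z' hz' he => add_right_cancel (sector_pow_injOn hm hz hz' (inv_injective he)))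
    (hV.of_le (by simp)) hVc (fun q hq => (hrc (hVs q hq).1).continuousWithinAt)
    (fun q hq => by simpa [S, r] using invRoot_mem_sector hm (hVs q hq).1)
    (fun q _ => by simp [w, r, inv_pow_invRoot hm])
  have hUS : tsupport U ⊆ S := by
    rintro _ hz
    obtain ⟨q, hq, rfl⟩ := hUs hz
    simpa [S, r] using invRoot_mem_sector hm (hVs q hq).1
  have hUf (t : ℝ) : U t = f t := by
    rcases lt_or_ge 0 (t + c) with ht | ht
    · rw [hUeq _ (by simpa [S] using ofReal_mem_sector hm ht), hf t ht,
        ← almostAnalytic_ofReal F N hτ]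
      simp [w]
    · rw [hf' t ht]
      refine image_eq_zero_of_notMem_tsupport fun hz => ?_
      have := re_pos_of_mem_sector hm (hUS hz)
      simp only [add_re, ofReal_re] at this
      linarith
  -- The composite `U` is not itself of the form `almostAnalytic`, but `|im w| ≤ L |im z|` on its
  -- support preserves the order of vanishing on the axis. This is all that `tendsto_jump` requires.
  have hdbar : ∃ C, ∀ z, ‖dbar U z‖ ≤ C * |z.im| ^ N := by
    obtain ⟨C, hC0, hC⟩ := exists_dbar_almostAnalytic_le hFc.isCompact N hτ
    obtain ⟨T, hT⟩ := exists_iteratedDeriv_bound hF hFc (N + 1)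
    have hT0 : 0 ≤ T := (norm_nonneg _).trans (hT 0 (Nat.zero_le _) 0)
    have hcont : ContinuousOn (fun z : ℂ => ‖(-(m * ((z + c) ^ (m + 1))⁻¹) : ℂ)‖) (tsupport U) := by
      refine ContinuousOn.norm (ContinuousOn.neg (continuousOn_const.mul (ContinuousOn.inv₀
        (by fun_prop) fun z hz => pow_ne_zero _ (hUS hz).1)))
    have hcont' : ContinuousOn
        (fun z : ℂ => m * ‖z + c‖ ^ (m - 1) / normSq ((z + c) ^ m)) (tsupport U) := by
      refine ContinuousOn.div (by fun_prop) (continuous_normSq.comp (by fun_prop)).continuousOn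
        fun z hz => (normSq_pos.2 (pow_ne_zero _ (hUS hz).1)).ne'
    obtain ⟨L₁, hL₁⟩ := hUc.isCompact.exists_bound_of_continuousOn hcont
    obtain ⟨L₂, hL₂⟩ := hUc.isCompact.exists_bound_of_continuousOn hcont'
    refine ⟨|L₁| * (C * T * |L₂| ^ N), fun z => ?_⟩
    by_cases hz : z ∈ tsupport U
    · rw [hUd z (hUS hz), norm_mul, RCLike.norm_conj, mul_assoc]
      have h1 := hL₁ z hz
      rw [norm_norm] at h1
      refine mul_le_mul (h1.trans (le_abs_self _)) ?_ (norm_nonneg _) (abs_nonneg _)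
      refine (hC F hF subset_rfl T hT _).trans ?_
      rw [mul_assoc (C * T), ← mul_pow]
      refine mul_le_mul_of_nonneg_left (pow_le_pow_left₀ (abs_nonneg _) ?_ N) (by positivity)
      refine (abs_im_inv_pow_le hm (z + c)).trans ?_
      rw [add_im, ofReal_im, add_zero]
      exact mul_le_mul_of_nonneg_right ((le_abs_self _).trans ((hL₂ z hz).trans (le_abs_self _)))
        (abs_nonneg _)
    · rw [dbar_eq_zero_of_notMem hz, norm_zero]
      positivity
  obtain ⟨-, h2, h3⟩ := tendsto_jump (k := k) (M := N) hU hUc (by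
    rintro _ hz
    obtain ⟨q, hq, rfl⟩ := hUs hz
    exact (hVs q hq).2.2.2) hdbar
  simp only [hUf] at h2 h3
  refine ⟨h2, ?_⟩
  convert h3 using 2
  rw [(hN₀ N (le_max_left _ _) τ hτ (fun p hp => (hsub hp).2.1) fun p hp => (hsub hp).2.2.1).2,
    hUi]
  have hpi := ofReal_ne_zero.2 Real.pi_ne_zero
  have : ∀ z, dbar U z • k z = dbar U z * (-(m * ((z + c) ^ (m + 1))⁻¹) *
      Nuc.tr E (resDiff X X₀ D (w z))) := fun z => by
    simp [k, resDiffComp, w]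
  have key (Y : ℂ) : 2 * (Real.pi : ℂ) * I * ((Real.pi : ℂ)⁻¹ * Y) = 2 * I * Y := by field_simp
  simp only [this, smul_eq_mul]
  exact key _

end Jump

/-! ### The spectral shift function and its derivative -/

section SpectralShift

open Complex Filter Set MeasureTheory TopologicalSpace

/-! ### The change of variables `t ↦ (t + c)⁻ᵐ` between intervals and its effect on test functions.
-/

section Intervals

variable {I J : Opens ℝ} {c : ℝ} {m : ℕ}

theorem rpow_inv_inv_pow (hm : 1 ≤ m) {t : ℝ} (ht : 0 < t + c) :
    (((t + c) ^ m)⁻¹)⁻¹ ^ ((m : ℝ)⁻¹) - c = t := by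
  rw [inv_inv, Real.pow_rpow_inv_natCast ht.le (by omega), add_sub_cancel_right]

theorem inv_pow_rpow_inv (hm : 1 ≤ m) {x : ℝ} (hx : 0 < x) :
    ((x⁻¹ ^ ((m : ℝ)⁻¹)) ^ m)⁻¹ = x := by
  rw [Real.rpow_inv_natCast_pow (inv_pos.2 hx).le (by omega), inv_inv]

theorem contDiffOn_rpow_inv : ContDiffOn ℝ (⊤ : ℕ∞) (fun x : ℝ => x⁻¹ ^ ((m : ℝ)⁻¹)) (Ioi 0) :=
  fun _ hx => ((contDiffAt_inv ℝ (ne_of_gt hx)).rpow_const_of_ne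
    (inv_pos.2 hx).ne').contDiffWithinAt

theorem continuousOn_shift_inv_pow (hIc : (I : Set ℝ) ⊆ Ioi (-c)) :
    ContinuousOn (fun t : ℝ => ((t + c) ^ m)⁻¹) I :=
  ContinuousOn.inv₀ (by fun_prop) fun t ht => by
    have := hIc ht
    rw [mem_Ioi] at this
    exact pow_ne_zero _ (by linarith)

theorem add_pos_of_mem (hIc : (I : Set ℝ) ⊆ Ioi (-c)) {t : ℝ} (ht : t ∈ I) : 0 < t + c := by
  have := hIc ht
  rw [mem_Ioi] at this
  linarith

theorem image_shift_inv_pow_subset (hIc : (I : Set ℝ) ⊆ Ioi (-c))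
    (hJ : (J : Set ℝ) = (fun t : ℝ => ((t + c) ^ m)⁻¹) '' (I : Set ℝ)) : (J : Set ℝ) ⊆ Ioi 0 := by
  rw [hJ]
  rintro _ ⟨t, ht, rfl⟩
  have := add_pos_of_mem hIc ht
  exact inv_pos.2 (pow_pos this m)

theorem mem_of_rpow_inv (hm : 1 ≤ m) (hIc : (I : Set ℝ) ⊆ Ioi (-c))
    (hJ : (J : Set ℝ) = (fun t : ℝ => ((t + c) ^ m)⁻¹) '' (I : Set ℝ)) {x : ℝ} (hx : x ∈ J) :
    x⁻¹ ^ ((m : ℝ)⁻¹) - c ∈ I ∧ ((x⁻¹ ^ ((m : ℝ)⁻¹) - c + c) ^ m)⁻¹ = x := by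
  refine ⟨?_, ?_⟩
  · obtain ⟨t, ht, rfl⟩ : x ∈ (fun t : ℝ => ((t + c) ^ m)⁻¹) '' (I : Set ℝ) := hJ ▸ hx
    rw [rpow_inv_inv_pow hm (add_pos_of_mem hIc ht)]
    exact ht
  · rw [sub_add_cancel, inv_pow_rpow_inv hm (image_shift_inv_pow_subset hIc hJ hx)]

/-- The image is open as the preimage of `I` under the continuous inverse `x ↦ x⁻¹ᐟᵐ - c`, and an
interval as a continuous image of one. -/
theorem exists_image_shift_inv_pow (hm : 1 ≤ m) (hI : (I : Set ℝ).OrdConnected)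
    (hIc : (I : Set ℝ) ⊆ Ioi (-c)) :
    ∃ J : Opens ℝ, (J : Set ℝ) = (fun t : ℝ => ((t + c) ^ m)⁻¹) '' (I : Set ℝ) ∧
      (J : Set ℝ).OrdConnected := by
  have himage : (fun t : ℝ => ((t + c) ^ m)⁻¹) '' (I : Set ℝ) =
      Ioi 0 ∩ (fun x : ℝ => x⁻¹ ^ ((m : ℝ)⁻¹) - c) ⁻¹' I := by
    ext x
    constructor
    · rintro ⟨t, ht, rfl⟩
      have h := add_pos_of_mem hIc ht
      refine ⟨inv_pos.2 (pow_pos h m), ?_⟩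
      simp only [mem_preimage]
      rw [rpow_inv_inv_pow hm h]
      exact ht
    · rintro ⟨h1, h2⟩
      refine ⟨_, h2, ?_⟩
      simp only [sub_add_cancel]
      exact inv_pow_rpow_inv hm h1
  refine ⟨⟨(fun t : ℝ => ((t + c) ^ m)⁻¹) '' (I : Set ℝ), ?_⟩, rfl, ?_⟩
  · rw [himage]
    exact (contDiffOn_rpow_inv.continuousOn.sub continuousOn_const).isOpen_inter_preimage isOpen_Ioi
      I.isOpen
  · exact (hI.isPreconnected.image _ (continuousOn_shift_inv_pow hIc)).ordConnected

/-- Pull-back of test functions along `x ↦ x⁻¹ᐟᵐ - c`, with a weight. -/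
theorem exists_pullback_testFunction (hm : 1 ≤ m) (hIc : (I : Set ℝ) ⊆ Ioi (-c))
    (hJ : (J : Set ℝ) = (fun t : ℝ => ((t + c) ^ m)⁻¹) '' (I : Set ℝ)) {w : ℝ → ℝ}
    (hw : ContDiffOn ℝ (⊤ : ℕ∞) w J) :
    ∃ Φ : 𝓓(I, ℝ) →L[ℝ] 𝓓(J, ℝ), ∀ f, ∀ t ∈ I,
      Φ f ((t + c) ^ m)⁻¹ = f t * w ((t + c) ^ m)⁻¹ := by
  obtain ⟨Φ, hΦ⟩ := exists_comp_mul_testFunction (I := I) (J := J)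
    (ρ := fun x : ℝ => x⁻¹ ^ ((m : ℝ)⁻¹) - c) (κ := fun t : ℝ => ((t + c) ^ m)⁻¹)
    ((contDiffOn_rpow_inv.mono (image_shift_inv_pow_subset hIc hJ)).sub contDiffOn_const) hw
    (continuousOn_shift_inv_pow hIc) (fun t ht => hJ ▸ mem_image_of_mem _ ht)
    fun x hx => (mem_of_rpow_inv hm hIc hJ hx).2
  refine ⟨Φ, fun f t ht => ?_⟩
  have htJ : ((t + c) ^ m)⁻¹ ∈ J := by
    change _ ∈ (J : Set ℝ)
    exact hJ ▸ mem_image_of_mem _ ht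
  rw [hΦ f _ htJ, rpow_inv_inv_pow hm (add_pos_of_mem hIc ht)]

theorem testFunction_ext_of_image
    (hJ : (J : Set ℝ) = (fun t : ℝ => ((t + c) ^ m)⁻¹) '' (I : Set ℝ)) {g g' : 𝓓(J, ℝ)}
    (h : ∀ t ∈ I, g ((t + c) ^ m)⁻¹ = g' ((t + c) ^ m)⁻¹) : g = g' := by
  ext x
  by_cases hx : x ∈ (J : Set ℝ)
  · rw [hJ] at hx
    obtain ⟨t, ht, rfl⟩ := hx
    exact h t ht
  · rw [image_eq_zero_of_notMem_tsupport fun h' => hx (g.tsupport_subset h'),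
      image_eq_zero_of_notMem_tsupport fun h' => hx (g'.tsupport_subset h')]

/-- The chain rule. Since `t ↦ (t + c)⁻ᵐ` decreases, its sign cancels the one in the definition of
the derivative of a distribution. -/
theorem deriv_eq_of_forall_image (hm : 1 ≤ m) (hIc : (I : Set ℝ) ⊆ Ioi (-c)) {f : 𝓓(I, ℝ)}
    {F : 𝓓(J, ℝ)} (h : ∀ t ∈ I, F ((t + c) ^ m)⁻¹ = f t) {t : ℝ} (ht : t ∈ I) :
    (-(∂_{(1 : ℝ)} f)) t =
      (∂_{(1 : ℝ)} F) (((t + c) ^ m)⁻¹) * (m * ((t + c) ^ (m + 1))⁻¹) := by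
  change -((∂_{(1 : ℝ)} f) t) = _
  have htc := (add_pos_of_mem hIc ht).ne'
  have h1 : HasDerivAt (fun t : ℝ => ((t + c) ^ m)⁻¹) (-(m * ((t + c) ^ (m + 1))⁻¹)) t := by
    have h2 := (((hasDerivAt_id t).add_const c).pow m).inv (pow_ne_zero m htc)
    obtain ⟨k, rfl⟩ : ∃ k, m = k + 1 := ⟨m - 1, by omega⟩
    refine h2.congr_deriv ?_
    simp only [Nat.add_sub_cancel, id, Pi.pow_apply]
    field_simp
    ring
  have h2 : HasDerivAt F (deriv F ((t + c) ^ m)⁻¹) ((t + c) ^ m)⁻¹ :=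
    (F.contDiff.differentiable (by simp) _).hasDerivAt
  have h3 : f =ᶠ[𝓝 t] F ∘ fun t : ℝ => ((t + c) ^ m)⁻¹ := by
    filter_upwards [I.isOpen.mem_nhds ht] with s hs using (h s hs).symm
  rw [testFunction_lineDeriv_apply, testFunction_lineDeriv_apply, h3.deriv_eq, (h2.comp t h1).deriv]
  ring

end Intervals

variable {E : Type*} [NormedAddCommGroup E] [InnerProductSpace ℂ E] [CompleteSpace E]
  {I J : Opens ℝ} {c : ℝ} {m M M₀ : ℕ}

/-- Existence of a spectral shift function of a pair of bounded operators. -/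
theorem exists_isSSF (hJ : (J : Set ℝ).OrdConnected) {X X₀ : E →L[ℂ] E}
    (hD : IsTraceClass (X - X₀)) (hX : ∀ x ∈ J, ResolventModerateAt X M (x : ℂ))
    (hX₀ : ∀ x ∈ J, ResolventModerateAt X₀ M₀ (x : ℂ)) : ∃ η : 𝓓'(J, ℂ), IsSSF J X X₀ η := by
  obtain ⟨T, hT⟩ := exists_jump_distribution (J := J) fun x hx =>
    (moderateAt_resDiff (Nuc.mk _ hD) (hX x hx) (hX₀ x hx)).clm_comp (Nuc.tr E)
  obtain ⟨P, hP⟩ := exists_primitive_testFunction hJ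
  -- Only the values on derivatives are prescribed. As `P (∂ g) = g`, the functional `(2πi)⁻¹ T ∘ P`
  -- takes the right ones.
  let L : ℂ →L[ℝ] ℂ := (2 * Real.pi * I)⁻¹ • (1 : ℂ →L[ℝ] ℂ)
  refine ⟨⟨L ∘ₗ T.toLinearMap ∘ₗ (P : 𝓓(J, ℝ) →ₗ[ℝ] 𝓓(J, ℝ)),
    L.continuous.comp (T.cont.comp P.continuous)⟩, fun g => ?_⟩
  have hs : tsupport (fun x => (g x : ℂ)) ⊆ J := (tsupport_ofReal_comp g).subset.trans
    g.tsupport_subset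
  obtain ⟨B, hB⟩ := exists_isFunctionOf (TestFunction.contDiff_ofReal g)
    (TestFunction.hasCompactSupport_ofReal g) fun x hx => hX x (hs hx)
  obtain ⟨B₀, hB₀⟩ := exists_isFunctionOf (TestFunction.contDiff_ofReal g)
    (TestFunction.hasCompactSupport_ofReal g) fun x hx => hX₀ x (hs hx)
  obtain ⟨h1, h2⟩ := tendsto_trace_isFunctionOf_sub (Nuc.val_mk _ hD)
    (TestFunction.contDiff_ofReal g) (TestFunction.hasCompactSupport_ofReal g)
    (fun x hx => hX x (hs hx)) (fun x hx => hX₀ x (hs hx)) hB hB₀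
  refine ⟨B, B₀, hB, hB₀, h1, ?_⟩
  change (2 * Real.pi * I)⁻¹ * T (P (∂_{(1 : ℝ)} g)) = trace (B - B₀)
  rw [hP, tendsto_nhds_unique (hT g) h2,
    inv_mul_cancel_left₀ (by simp [Real.pi_ne_zero])]

theorem exists_isRelSSF (hm : 1 ≤ m) (hI : (I : Set ℝ).OrdConnected)
    (hIc : (I : Set ℝ) ⊆ Ioi (-c)) {H H₀ : E →ₗ.[ℂ] E}
    (hD : IsTraceClass (res H (-c) ^ m - res H₀ (-c) ^ m))
    (hX : ∀ t ∈ I, ResolventModerateAt (res H (-c) ^ m) M ((((t + c) ^ m)⁻¹ : ℝ) : ℂ))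
    (hX₀ : ∀ t ∈ I, ResolventModerateAt (res H₀ (-c) ^ m) M₀ ((((t + c) ^ m)⁻¹ : ℝ) : ℂ)) :
    ∃ ξ : 𝓓'(I, ℂ), IsRelSSF I H H₀ c m ξ := by
  obtain ⟨J, hJ, hJo⟩ := exists_image_shift_inv_pow hm hI hIc
  have hmem (x : ℝ) (hx : x ∈ J) : ∃ t ∈ I, ((t + c) ^ m)⁻¹ = x := by
    have hx' : x ∈ (J : Set ℝ) := hx
    rwa [hJ] at hx'
  obtain ⟨η, hη⟩ := exists_isSSF hJo hD
    (fun x hx => by obtain ⟨t, ht, rfl⟩ := hmem x hx; exact hX t ht)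
    (fun x hx => by obtain ⟨t, ht, rfl⟩ := hmem x hx; exact hX₀ t ht)
  have hm0 : (m : ℝ) ≠ 0 := by exact_mod_cast (by omega : m ≠ 0)
  obtain ⟨Φ, hΦ⟩ := exists_pullback_testFunction hm hIc hJ
    -- The inverse of the weight `m (t + c)⁻ᵐ⁻¹`, written in the variable `x = (t + c)⁻ᵐ`.
    (w := fun x => (m * ((x⁻¹ ^ ((m : ℝ)⁻¹)) ^ (m + 1))⁻¹)⁻¹) (by
      have hsub := image_shift_inv_pow_subset hIc hJ
      have hpos (x : ℝ) (hx : x ∈ (J : Set ℝ)) : (x⁻¹ ^ ((m : ℝ)⁻¹)) ^ (m + 1) ≠ 0 :=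
        (pow_pos (Real.rpow_pos_of_pos (inv_pos.2 (hsub hx)) _) _).ne'
      exact ContDiffOn.inv (contDiffOn_const.mul
        (((contDiffOn_rpow_inv.mono hsub).pow (m + 1)).inv hpos))
        fun x hx => mul_ne_zero hm0 (inv_ne_zero (hpos x hx)))
  refine ⟨⟨η.toLinearMap ∘ₗ (Φ : 𝓓(I, ℝ) →ₗ[ℝ] 𝓓(J, ℝ)), η.cont.comp Φ.continuous⟩, J, hJ, η, hη,
    fun f g hfg => ?_⟩
  change η (Φ f) = η g
  congr 1
  refine testFunction_ext_of_image hJ fun t ht => ?_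
  have htc := add_pos_of_mem hIc ht
  have h1 := rpow_inv_inv_pow hm htc
  rw [hΦ f t ht, hfg t ht, eq_add_of_sub_eq h1, mul_assoc, mul_inv_cancel₀, mul_one]
  exact mul_ne_zero hm0 (inv_ne_zero (pow_pos htc _).ne')

end SpectralShift

/-! ### The derivative of the spectral shift function -/

section SigmaJump

open Complex Filter Set MeasureTheory TopologicalSpace

variable {E : Type*} [NormedAddCommGroup E] [InnerProductSpace ℂ E] [CompleteSpace E]
  {I J : Opens ℝ} {H H₀ : E →ₗ.[ℂ] E} {c : ℝ} {m M M₀ : ℕ} {D T : Nuc E}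

theorem sigma_eq (hm : 1 ≤ m) (hc : (-c : ℂ) ∈ rho H) (hc₀ : (-c : ℂ) ∈ rho H₀)
    (hD : Nuc.val E D = res H (-c) ^ m - res H₀ (-c) ^ m)
    (hT : Nuc.val E T = res H₀ (-c) ^ m * (res H (-c) - res H₀ (-c))) {z : ℂ} (hz : z ∈ rho H)
    (hz₀ : z ∈ rho H₀) :
    sigma H H₀ c m z =
      (z + c) ^ (m - 1) * Nuc.tr E (sigmaNuc (res H (-c)) (res H₀ (-c)) D T (z + c)) := by
  rw [sigma, sigmaOp_eq hm hc hc₀ hD hT hz hz₀, Nuc.tr_apply]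

/-- The trace of `smul_resDiff_eq` at `ν = z + c`. The second summand is continuous across the
positive axis and disappears from jumps. -/
theorem tr_resDiffComp_eq (hm : 1 ≤ m) (hc : (-c : ℂ) ∈ rho H) (hc₀ : (-c : ℂ) ∈ rho H₀)
    (hsec : ∀ z ∈ spec H, z + c ∈ sector m) (hsec₀ : ∀ z ∈ spec H₀, z + c ∈ sector m)
    (hD : Nuc.val E D = res H (-c) ^ m - res H₀ (-c) ^ m)
    (hT : Nuc.val E T = res H₀ (-c) ^ m * (res H (-c) - res H₀ (-c))) {z : ℂ} (hz : z ∈ rho H)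
    (hz₀ : z ∈ rho H₀) (hs : z + c ∈ sector m) :
    Nuc.tr E (resDiffComp (res H (-c) ^ m) (res H₀ (-c) ^ m) D c m z) = sigma H H₀ c m z +
      (z + c)⁻¹ * Nuc.tr E (defectNuc m (res H (-c)) (res H₀ (-c)) D T (z + c)) := by
  rw [sigma_eq hm hc hc₀ hD hT hz hz₀, resDiffComp, smul_resDiff_eq hm hD hT hs.1
    (isUnit_one_sub_smul hc hz) (isUnit_one_sub_smul hc₀ hz₀)
    (isUnit_geomSum hm (isUnit_of_spec_subset hc hsec) hs)
    (isUnit_geomSum hm (isUnit_of_spec_subset hc₀ hsec₀) hs), map_add, map_smul, map_smul,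
    smul_eq_mul, smul_eq_mul]

/-- On the resolvent sets `σ_m` is the trace of an operator depending continuously on `z` in trace
norm. With `p = ±iε` this yields local integrability on `I`. -/
theorem continuousOn_sigma_line (hm : 1 ≤ m) (hc : (-c : ℂ) ∈ rho H) (hc₀ : (-c : ℂ) ∈ rho H₀)
    (hD : Nuc.val E D = res H (-c) ^ m - res H₀ (-c) ^ m)
    (hT : Nuc.val E T = res H₀ (-c) ^ m * (res H (-c) - res H₀ (-c))) {p : ℂ}
    {s : Set ℝ} (hs : ∀ t ∈ s, (t + p : ℂ) ∈ rho H ∧ (t + p : ℂ) ∈ rho H₀) :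
    ContinuousOn (fun t : ℝ => sigma H H₀ c m (t + p)) s := by
  have h : ContinuousOn (fun t : ℝ => ((t + p) + c : ℂ) ^ (m - 1) *
      Nuc.tr E (sigmaNuc (res H (-c)) (res H₀ (-c)) D T (t + p + c))) s := by
    refine ContinuousOn.mul (by fun_prop) ((Nuc.tr E).continuous.comp_continuousOn fun t ht => ?_)
    exact (ContinuousAt.comp (f := fun t : ℝ => (t + p + c : ℂ))
      (continuousAt_sigmaNuc (isUnit_one_sub_smul hc (hs t ht).1)
        (isUnit_one_sub_smul hc₀ (hs t ht).2)) (by fun_prop)).continuousWithinAt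
  exact h.congr fun t ht => sigma_eq hm hc hc₀ hD hT (hs t ht).1 (hs t ht).2

/-- The trace is the jump of `w'(z) Tr ((X - w)⁻¹ - (X₀ - w)⁻¹)` by `tendsto_jump_resDiffComp`;
subtracting the defect, which has no jump, leaves that of `σ_m`. -/
theorem tendsto_jump_sigma (hm : 1 ≤ m) (hc : (-c : ℂ) ∈ rho H) (hc₀ : (-c : ℂ) ∈ rho H₀)
    (hsec : ∀ z ∈ spec H, z + c ∈ sector m) (hsec₀ : ∀ z ∈ spec H₀, z + c ∈ sector m)
    (hD : Nuc.val E D = res H (-c) ^ m - res H₀ (-c) ^ m)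
    (hT : Nuc.val E T = res H₀ (-c) ^ m * (res H (-c) - res H₀ (-c)))
    (hIc : (I : Set ℝ) ⊆ Ioi (-c))
    (hJ : (J : Set ℝ) = (fun t : ℝ => ((t + c) ^ m)⁻¹) '' (I : Set ℝ))
    (hM : ∀ t ∈ I, HasModerateResolventAt H M t) (hM₀ : ∀ t ∈ I, HasModerateResolventAt H₀ M₀ t)
    {f : 𝓓(I, ℝ)} {F : 𝓓(J, ℝ)} (hF : ∀ t ∈ I, F ((t + c) ^ m)⁻¹ = f t) {B B₀ : E →L[ℂ] E}
    (hB : IsFunctionOf (res H (-c) ^ m) (fun x => (F x : ℂ)) B)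
    (hB₀ : IsFunctionOf (res H₀ (-c) ^ m) (fun x => (F x : ℂ)) B₀) :
    Tendsto (fun ε : ℝ => (2 * Real.pi * Complex.I)⁻¹ *
      ∫ t : ℝ, (f t : ℂ) * (sigma H H₀ c m (t + ε * Complex.I) -
        sigma H H₀ c m (t - ε * Complex.I))) (𝓝[>] 0) (𝓝 (trace (B - B₀))) := by
  have hfs : tsupport (fun x => (f x : ℂ)) ⊆ I := (tsupport_ofReal_comp f).subset.trans
    f.tsupport_subset
  have hcpt := TestFunction.hasCompactSupport_ofReal f
  have hf0 (t : ℝ) (ht : t ∉ I) : f t = 0 :=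
    image_eq_zero_of_notMem_tsupport fun h => ht (f.tsupport_subset h)
  let k (z : ℂ) : ℂ := Nuc.tr E (resDiffComp (res H (-c) ^ m) (res H₀ (-c) ^ m) D c m z)
  let d (z : ℂ) : ℂ :=
    (z + c)⁻¹ * Nuc.tr E (defectNuc m (res H (-c)) (res H₀ (-c)) D T (z + c))
  obtain ⟨hk1, hk2⟩ := tendsto_jump_resDiffComp hD hm (f := fun t => (f t : ℂ)) (c := c)
    (TestFunction.contDiff_ofReal F) (TestFunction.hasCompactSupport_ofReal F) (fun t ht => by
      by_cases htI : t ∈ I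
      · rw [hF t htI]
      -- By injectivity on `(-c, ∞)`, a point outside `I` cannot be sent into `J`, so both sides
      -- vanish.
      · rw [hf0 t htI, image_eq_zero_of_notMem_tsupport (f := F)]
        intro h
        have h1 := F.tsupport_subset h
        rw [hJ] at h1
        obtain ⟨s, hs, he⟩ := h1
        have h2 := rpow_inv_inv_pow hm (add_pos_of_mem hIc hs)
        simp only at he
        rw [he, rpow_inv_inv_pow hm ht] at h2
        exact htI (h2 ▸ hs)) (fun t ht => by
      rw [hf0 t fun h => absurd (add_pos_of_mem hIc h) (not_lt.2 ht), ofReal_zero]) (by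
      intro x hx
      rw [tsupport_ofReal_comp] at hx
      have h1 := F.tsupport_subset hx
      rw [hJ] at h1
      obtain ⟨t, ht, rfl⟩ := h1
      have htc := add_pos_of_mem hIc ht
      exact ⟨t, htc, rfl, exists_resolvent_pow_bound hm hc hsec htc (hM t ht),
        exists_resolvent_pow_bound hm hc₀ hsec₀ htc (hM₀ t ht)⟩) hB hB₀
  obtain ⟨hd1, hd2⟩ := tendsto_jump_of_continuousAt (k := d)
    (TestFunction.contDiff_ofReal f).continuous hcpt fun t ht => by
      filter_upwards [eventually_add_mem_sector hm (add_pos_of_mem hIc (hfs ht))] with z hz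
      have h1 : ContinuousAt (fun z : ℂ => z + c) z := by fun_prop
      have h2 : ContinuousAt (defectNuc m (res H (-c)) (res H₀ (-c)) D T) (z + c) :=
        continuousAt_defectNuc (isUnit_geomSum hm (isUnit_of_spec_subset hc hsec) hz)
          (isUnit_geomSum hm (isUnit_of_spec_subset hc₀ hsec₀) hz)
      have h3 := ContinuousAt.comp (f := fun z : ℂ => z + c) h2 h1
      exact (h1.inv₀ hz.1).mul ((Nuc.tr E).continuous.continuousAt.comp h3)
  -- A uniform height below which the identity between `k`, `σ_m` and `d` holds above the support of
  -- `f`.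
  obtain ⟨δ, hδ, hδ'⟩ := exists_pos_forall_add_mul_I_mem hcpt.isCompact
    (G := {z | z.im ≠ 0 → z ∈ rho H ∧ z ∈ rho H₀ ∧ z + c ∈ sector m}) fun t ht => by
      obtain ⟨C, hC⟩ := hM t (hfs ht)
      obtain ⟨C₀, hC₀⟩ := hM₀ t (hfs ht)
      filter_upwards [hC, hC₀, eventually_add_mem_sector hm (add_pos_of_mem hIc (hfs ht))]
        with z h1 h2 h3 hne
      exact ⟨(h1 hne).1, (h2 hne).1, h3⟩
  have hkd {t ε : ℝ} (ht : t ∈ tsupport fun x => (f x : ℂ)) (hε : |ε| < δ) (hne : ε ≠ 0) :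
      k (t + ε * Complex.I) = sigma H H₀ c m (t + ε * Complex.I) + d (t + ε * Complex.I) := by
    obtain ⟨h1, h2, h3⟩ := hδ' t ht ε hε (by simpa using hne)
    exact tr_resDiffComp_eq hm hc hc₀ hsec hsec₀ hD hT h1 h2 h3
  have hlim := (hk2.sub hd2).const_mul (2 * Real.pi * Complex.I)⁻¹
  rw [sub_zero, inv_mul_cancel_left₀ (by simp [Real.pi_ne_zero])] at hlim
  refine hlim.congr' ?_
  filter_upwards [hk1, hd1, Ioo_mem_nhdsGT hδ] with ε h1 h2 hε
  rw [← integral_sub h1 h2]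
  congr 2 with t
  by_cases ht : t ∈ tsupport fun x => (f x : ℂ)
  · have e1 := hkd ht (abs_lt.2 ⟨by linarith [hε.1], hε.2⟩) hε.1.ne'
    have e2 := hkd (ε := -ε) ht (abs_lt.2 ⟨by linarith [hε.2], by linarith [hε.1]⟩)
      (neg_ne_zero.2 hε.1.ne')
    rw [ofReal_neg, neg_mul, ← sub_eq_add_neg] at e2
    simp only [k] at e1 e2
    rw [e1, e2, smul_eq_mul, smul_eq_mul]
    ring
  · have : (f t : ℂ) = 0 := image_eq_zero_of_notMem_tsupport (f := fun x => (f x : ℂ)) ht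
    simp [this]

end SigmaJump

end SSF

end

/-! ### Assembly of the theorem. -/

theorem mainTheorem7 {E : Type*} [NormedAddCommGroup E] [InnerProductSpace ℂ E] [CompleteSpace E]
    [TopologicalSpace.SeparableSpace E]
    (H₀ : E →ₗ.[ℂ] E) (hH₀ : IsSelfAdjoint H₀) (hbelow : SSF.IsBoundedBelow H₀)
    (V : E →L[ℂ] E) (H : E →ₗ.[ℂ] E) (hH : H = SSF.addBounded H₀ V)
    (c : ℝ) (m : ℕ) (hm : 1 ≤ m)
    (hspec₀ : ∀ z ∈ SSF.spec H₀, 0 < (z + c).re)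
    (hspec : ∀ z ∈ SSF.spec H, z + c ≠ 0 ∧ |Complex.arg (z + c)| < Real.pi / (2 * m))
    (I : TopologicalSpace.Opens ℝ) (hI : (I : Set ℝ).OrdConnected)
    (hIc : (I : Set ℝ) ⊆ Set.Ioi (-c))
    (hyp1 : SSF.FinitelyManyNonrealEigenvalues H (I : Set ℝ))
    (hyp2 : SSF.PolynomialResolventBound H (I : Set ℝ))
    (hyp3 : SSF.IsTraceClass (SSF.res H (-c) ^ m - SSF.res H₀ (-c) ^ m))
    (htr : SSF.IsTraceClass (SSF.res H₀ (-c) ^ m * (SSF.res H (-c) - SSF.res H₀ (-c)))) :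
    (∃ ξ : 𝓓'(I, ℂ), SSF.IsRelSSF I H H₀ c m ξ) ∧
    (∀ z ∈ SSF.rho H ∩ SSF.rho H₀, SSF.IsTraceClass (SSF.sigmaOp H H₀ c m z)) ∧
    (∀ᶠ ε : ℝ in 𝓝[>] 0, MeasureTheory.LocallyIntegrableOn
      (fun t : ℝ => SSF.sigma H H₀ c m (t + ε * Complex.I) -
        SSF.sigma H H₀ c m (t - ε * Complex.I)) (I : Set ℝ)) ∧
    ∀ ξ : 𝓓'(I, ℂ), SSF.IsRelSSF I H H₀ c m ξ → ∀ f : 𝓓(I, ℝ),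
      Filter.Tendsto
        (fun ε : ℝ => (2 * Real.pi * Complex.I)⁻¹ *
          ∫ t : ℝ, (f t : ℂ) * (SSF.sigma H H₀ c m (t + ε * Complex.I) -
            SSF.sigma H H₀ c m (t - ε * Complex.I)))
        (𝓝[>] 0) (𝓝 ((∂_{(1 : ℝ)} ξ) f)) := by
  have hc : (-c : ℂ) ∈ SSF.rho H := by
    by_contra h
    exact (hspec _ h).1 (by simp)
  have hc₀ : (-c : ℂ) ∈ SSF.rho H₀ := by
    by_contra h
    simpa using hspec₀ _ h
  -- The spectrum of `H₀` is real, so positivity of `z + c` already places it in the sector.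
  have hsec₀ : ∀ z ∈ SSF.spec H₀, z + c ∈ SSF.sector m := fun z hz => by
    have him : z.im = 0 := by
      by_contra h
      exact hz (SSF.mem_rho_of_isSelfAdjoint hH₀ h)
    have hz' : z + c = ((z.re + c : ℝ) : ℂ) := Complex.ext (by simp) (by simp [him])
    rw [hz']
    exact SSF.ofReal_mem_sector hm (by simpa using hspec₀ z hz)
  obtain ⟨M, hM⟩ := hyp2.exists_moderate I.isOpen
  have hM₀ (t : ℝ) := SSF.moderate_of_isSelfAdjoint hH₀ t
  have hD := SSF.Nuc.val_mk _ hyp3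
  have hT := SSF.Nuc.val_mk _ htr
  have hX (t : ℝ) (ht : t ∈ I) := SSF.resolventModerateAt_of_comp hm (SSF.add_pos_of_mem hIc ht)
    (SSF.exists_resolvent_pow_bound hm hc hspec (SSF.add_pos_of_mem hIc ht) (hM t ht))
  have hX₀ (t : ℝ) (ht : t ∈ I) := SSF.resolventModerateAt_of_comp hm (SSF.add_pos_of_mem hIc ht)
    (SSF.exists_resolvent_pow_bound hm hc₀ hsec₀ (SSF.add_pos_of_mem hIc ht) (hM₀ t))
  refine ⟨SSF.exists_isRelSSF hm hI hIc hyp3 hX hX₀, fun z hz => ?_, ?_, fun ξ hξ f => ?_⟩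
  · rw [SSF.sigmaOp_eq hm hc hc₀ hD hT hz.1 hz.2]
    exact SSF.Nuc.isTraceClass _
  · obtain ⟨a, ha, _, -, _, -, h⟩ := hyp2
    filter_upwards [Ioo_mem_nhdsGT ha] with ε hε
    have hp (s : ℝ) (hs : |s| = ε) (t : ℝ) (ht : t ∈ (I : Set ℝ)) :
        (t + s * Complex.I : ℂ) ∈ SSF.rho H ∧ (t + s * Complex.I : ℂ) ∈ SSF.rho H₀ := by
      have him : (t + s * Complex.I : ℂ).im = s := by simp
      refine ⟨(h _ (by simpa using ht) (by rw [him, hs]; exact hε.1)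
        (by rw [him, hs]; exact hε.2)).1, SSF.mem_rho_of_isSelfAdjoint hH₀ ?_⟩
      rw [him]
      rintro rfl
      exact hε.1.ne (by simpa using hs)
    have h1 := SSF.continuousOn_sigma_line hm hc hc₀ hD hT (hp ε (abs_of_pos hε.1))
    have h2 := SSF.continuousOn_sigma_line hm hc hc₀ hD hT
      (hp (-ε) (by rw [abs_neg, abs_of_pos hε.1]))
    simp only [Complex.ofReal_neg, neg_mul, ← sub_eq_add_neg] at h2
    exact (h1.sub h2).locallyIntegrableOn I.isOpen.measurableSet
  -- With `F((t + c)⁻ᵐ) = f(t)`, the value of `ξ'` at `f` is `ξ(-f') = η(F') = Tr (F(X) - F(X₀))`,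
  -- so any spectral shift function gives the same limit.
  · obtain ⟨J, hJ, η, hη, hξη⟩ := hξ
    obtain ⟨Φ, hΦ⟩ := SSF.exists_pullback_testFunction hm hIc hJ
      (w := fun _ => 1) contDiffOn_const
    have hF : ∀ t ∈ I, Φ f ((t + c) ^ m)⁻¹ = f t := fun t ht => by rw [hΦ f t ht, mul_one]
    obtain ⟨B, B₀, hB, hB₀, -, he⟩ := hη (Φ f)
    rw [Distribution.lineDerivOp_apply_apply, hξη _ (∂_{(1 : ℝ)} (Φ f))
      fun t ht => SSF.deriv_eq_of_forall_image hm hIc hF ht, he]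
    exact SSF.tendsto_jump_sigma hm hc hc₀ hspec hsec₀ hD hT hIc hJ hM (fun t _ => hM₀ t) hF hB hB₀
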